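/- Let $\kappa\in\mathbb R$, let $\epsilon\in\{-1,0,1\}$ be the sign of $\kappa$, and let $\varepsilon\in\{1,-1\}$. Let $\mathbb M^2(\kappa)$ be the simply connected complete surface of constant curvature $\kappa$. For $\kappa\neq0$ put $r=\sqrt{\epsilon/\kappa}$ and realize $\mathbb M^2(\kappa)$ as $\{\langle p,p\rangle=1/\kappa\}$ in $\mathbb R^3$ (if $\kappa>0$) or as the upper sheet of this quadric in the Lorentz space $\mathbb L^3$ (if $\kappa<0$); for $\kappa=0$ realize it as a plane in $\mathbb R^3$. Then $\mathbb M^2(\kappa)\times\mathbb R$, with the metric $d\sigma^2+\varepsilon\,dt^2$, lies in $\mathbb E^4=\mathbb R^3\times\mathbb R$ (respectively $\mathbb L^3\times\mathbb R$), whose flat metric and flat connection are denoted $\langle\cdot,\cdot\rangle$ and $D$. Let $\Sigma$ be a connected Riemann surface and $X=(p,t):\Sigma\to\mathbb M^2(\kappa)\times\mathbb R$ a smooth conformal immersion, space-like if $\varepsilon=-1$: in every holomorphic coordinate $z=u+iv$ the induced metric is $e^{2\omega}(du^2+dv^2)$. Let $n_1$ be a smooth unit normal field of $\Sigma$ in $\mathbb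 M^2(\kappa)\times\mathbb R$ (so $\langle n_1,n_1\rangle=\varepsilon$), and let $n_2=p/r$ for $\kappa\neq0$, and $n_2$ the constant unit normal of the plane for $\kappa=0$. For $k=1,2$ put $h^k(\partial_a,\partial_b)=\langle D_{\partial_a}\partial_b X,n_k\rangle$, let $$\Psi^k=\Big(\tfrac12\big(h^k(\partial_u,\partial_u)-h^k(\partial_v,\partial_v)\big)-i\,h^k(\partial_u,\partial_v)\Big)\,dz^2$$ be the Hopf differential of $n_k$, and let $H=\tfrac12 e^{-2\omega}\big(h^1(\partial_u,\partial_u)+h^1(\partial_v,\partial_v)\big)$ be the mean curvature. Put $$Q=2H\,\Psi^1-\varepsilon\,\frac{\epsilon}{r}\,\Psi^2,$$ where $\epsilon/r$ is read as $0$ if $\kappa=0$. Then $Q$ is a well-defined quadratic differential on $\Sigma$, and: 1. If $H$ is constant, then $Q$ is holomorphic on $\Sigma$. 2. Conversely, suppose that $\Sigma$ is compact, or, more generally, that $\Sigma$ does not admit a smooth real function without critical points, or that $\Sigma$ does not admit a smooth tangent vector field without zeros. If $Q$ is holomorphic, then $H$ is constant. -/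

import Mathlib

open scoped Manifold ContDiff

namespace HopfProduct

/-! ### The ambient space `𝔼⁴` and the products `M²(κ) × ℝ` -/

/-- The underlying vector space `ℝ³ × ℝ` of `𝔼⁴`; a point is written `X = (p, t)`. -/
abbrev Ambient : Type := (Fin 3 → ℝ) × ℝ

/-- The flat metric on the factor `ℝ³`: Euclidean if `κ ≥ 0`, Lorentzian (the space `𝕃³`)
if `κ < 0`. -/
noncomputable def flatForm (κ : ℝ) (p q : Fin 3 → ℝ) : ℝ :=
  p 0 * q 0 + p 1 * q 1 + (if κ < 0 then -1 else 1) * (p 2 * q 2)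

/-- The flat metric of `𝔼⁴`: the metric on `ℝ³` or `𝕃³`, plus `ε dt²`. -/
noncomputable def ambientForm (κ ε : ℝ) (x y : Ambient) : ℝ :=
  flatForm κ x.1 y.1 + ε * (x.2 * y.2)

/-- The simply connected complete surface of constant curvature `κ`: the round sphere
`⟨p, p⟩ = 1 / κ` if `κ > 0`, the upper sheet of the hyperboloid `⟨p, p⟩ = 1 / κ` in `𝕃³` if
`κ < 0`, and a plane in `ℝ³` if `κ = 0`. -/
def spaceForm (κ : ℝ) : Set (Fin 3 → ℝ) :=
  {p | (κ ≠ 0 → flatForm κ p p = 1 / κ) ∧ (κ < 0 → 0 < p 2) ∧ (κ = 0 → p 2 = 0)}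

/-- The sign `ϵ` of `κ`, as a real number. -/
noncomputable def curvSign (κ : ℝ) : ℝ := ((SignType.sign κ : SignType) : ℝ)

/-- The number `r > 0` with `r² = ϵ / κ`, for `κ ≠ 0`. -/
noncomputable def radius (κ : ℝ) : ℝ := Real.sqrt (curvSign κ / κ)

/-- The unit normal `n₂` of `M²(κ) × ℝ` in `𝔼⁴` at `(p, t)`: it is `p / r` if `κ ≠ 0`, and the
constant normal of the plane if `κ = 0`. -/
noncomputable def productNormal (κ : ℝ) (x : Ambient) : Ambient :=
  (if κ = 0 then ![0, 0, 1] else (radius κ)⁻¹ • x.1, 0)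

/-! ### Coordinate derivatives -/

/-- `∂_u f`, where `z = u + i v`. -/
noncomputable def dU (f : ℂ → Ambient) (z : ℂ) : Ambient := fderiv ℝ f z 1

/-- `∂_v f`, where `z = u + i v`. -/
noncomputable def dV (f : ℂ → Ambient) (z : ℂ) : Ambient := fderiv ℝ f z Complex.I

/-! ### Surfaces in `M²(κ) × ℝ` -/

section Surface

variable {S : Type*} [TopologicalSpace S] [ChartedSpace ℂ S]

/-- A Riemann surface is a smooth real surface. -/
instance realSmooth [IsManifold 𝓘(ℂ) ω S] (n : WithTop ℕ∞) : IsManifold 𝓘(ℝ, ℂ) n S := by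
  apply isManifold_of_contDiffOn
  intro e e' he he'
  have h := (contDiffGroupoid ω 𝓘(ℂ)).compatible he he'
  have h1 := (contDiffGroupoid_le (I := 𝓘(ℂ)) (le_top : n ≤ ω) h)
  exact ContDiffOn.restrict_scalars ℝ (mem_groupoid_of_pregroupoid.1 h1).1

/-- The holomorphic local coordinates `z = u + i v` of the Riemann surface `S`. -/
abbrev holCharts (S : Type*) [TopologicalSpace S] [ChartedSpace ℂ S] :
    Set (OpenPartialHomeomorph S ℂ) :=
  IsManifold.maximalAtlas 𝓘(ℂ) ω S

/-- `X : S → M²(κ) × ℝ ⊂ 𝔼⁴` is a smooth (space-like) immersion which is conformal: in each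
holomorphic coordinate the induced metric is `e^{2ω} (du² + dv²)`. -/
structure IsConformalImmersion (κ ε : ℝ) (X : S → Ambient) : Prop where
  smooth : ContMDiff 𝓘(ℝ, ℂ) 𝓘(ℝ, Ambient) ∞ X
  mem : ∀ x, (X x).1 ∈ spaceForm κ
  pos : ∀ φ ∈ holCharts S, ∀ z ∈ φ.target,
    0 < ambientForm κ ε (dU (X ∘ φ.symm) z) (dU (X ∘ φ.symm) z)
  eq : ∀ φ ∈ holCharts S, ∀ z ∈ φ.target,
    ambientForm κ ε (dV (X ∘ φ.symm) z) (dV (X ∘ φ.symm) z) =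
      ambientForm κ ε (dU (X ∘ φ.symm) z) (dU (X ∘ φ.symm) z)
  orthogonal : ∀ φ ∈ holCharts S, ∀ z ∈ φ.target,
    ambientForm κ ε (dU (X ∘ φ.symm) z) (dV (X ∘ φ.symm) z) = 0

/-- `N` is a smooth unit normal field `n₁` of the surface `X` in `M²(κ) × ℝ`; it satisfies
`⟨N, N⟩ = ε`, hence is time-like if `ε = -1`. -/
structure IsUnitNormal (κ ε : ℝ) (X N : S → Ambient) : Prop where
  smooth : ContMDiff 𝓘(ℝ, ℂ) 𝓘(ℝ, Ambient) ∞ N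
  unit : ∀ x, ambientForm κ ε (N x) (N x) = ε
  tangent : ∀ x, ambientForm κ ε (N x) (productNormal κ (X x)) = 0
  orthogonal_u : ∀ φ ∈ holCharts S, ∀ z ∈ φ.target,
    ambientForm κ ε (dU (X ∘ φ.symm) z) (N (φ.symm z)) = 0
  orthogonal_v : ∀ φ ∈ holCharts S, ∀ z ∈ φ.target,
    ambientForm κ ε (dV (X ∘ φ.symm) z) (N (φ.symm z)) = 0

/-! The second fundamental form `h(∂_a, ∂_b) = ⟨D_{∂_a} ∂_b, n⟩` in the direction of a normal
field `n`, in the coordinate `φ`; here `D` is the flat derivative of `𝔼⁴`. -/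

/-- The component `h(∂_u, ∂_u)`. -/
noncomputable def hUU (κ ε : ℝ) (X n : S → Ambient) (φ : OpenPartialHomeomorph S ℂ) (z : ℂ) : ℝ :=
  ambientForm κ ε (dU (dU (X ∘ φ.symm)) z) (n (φ.symm z))

/-- The component `h(∂_u, ∂_v)`. -/
noncomputable def hUV (κ ε : ℝ) (X n : S → Ambient) (φ : OpenPartialHomeomorph S ℂ) (z : ℂ) : ℝ :=
  ambientForm κ ε (dU (dV (X ∘ φ.symm)) z) (n (φ.symm z))

/-- The component `h(∂_v, ∂_v)`. -/
noncomputable def hVV (κ ε : ℝ) (X n : S → Ambient) (φ : OpenPartialHomeomorph S ℂ) (z : ℂ) : ℝ :=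
  ambientForm κ ε (dV (dV (X ∘ φ.symm)) z) (n (φ.symm z))

/-- The coefficient `ψ = (h(∂_u, ∂_u) - h(∂_v, ∂_v)) / 2 - i h(∂_u, ∂_v)` of the Hopf
differential `Ψ = ψ dz²` of the normal field `n`, in the coordinate `φ`. -/
noncomputable def hopf (κ ε : ℝ) (X n : S → Ambient) (φ : OpenPartialHomeomorph S ℂ) (z : ℂ) : ℂ :=
  (((hUU κ ε X n φ z - hVV κ ε X n φ z) / 2 : ℝ) : ℂ) - Complex.I * ((hUV κ ε X n φ z : ℝ) : ℂ)

/-- The mean curvature `H = (h¹₁₁ + h¹₂₂) / 2`, with `h¹₁₁ = e^{-2ω} h¹(∂_u, ∂_u)` and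
`h¹₂₂ = e^{-2ω} h¹(∂_v, ∂_v)`. The value does not depend on the coordinate; the preferred
one at `x` is used. -/
noncomputable def meanCurvature (κ ε : ℝ) (X N : S → Ambient) (x : S) : ℝ :=
  (hUU κ ε X N (chartAt ℂ x) (chartAt ℂ x x) + hVV κ ε X N (chartAt ℂ x) (chartAt ℂ x x)) /
    (2 * ambientForm κ ε (dU (X ∘ (chartAt ℂ x).symm) (chartAt ℂ x x))
      (dU (X ∘ (chartAt ℂ x).symm) (chartAt ℂ x x)))

/-- The coefficient, in the coordinate `φ`, of `Q = 2 H Ψ¹ - ε (ϵ / r) Ψ²`, where `Ψ¹` and `Ψ²`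
are the Hopf differentials of the normals `n₁ = N` and `n₂`. For `κ = 0` the factor `ϵ / r`
is zero. -/
noncomputable def qCoeff (κ ε : ℝ) (X N : S → Ambient) (φ : OpenPartialHomeomorph S ℂ) (z : ℂ) :
    ℂ :=
  2 * ((meanCurvature κ ε X N (φ.symm z) : ℝ) : ℂ) * hopf κ ε X N φ z -
    ((ε * (curvSign κ / radius κ) : ℝ) : ℂ) * hopf κ ε X (fun x => productNormal κ (X x)) φ z

/-- The local coefficients `q φ` define a quadratic differential `q dz²` on `S`: under a change of
holomorphic coordinate from `z` to `w` they satisfy `q_z = q_w (dw/dz)²`. -/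
def IsQuadraticDifferential (q : OpenPartialHomeomorph S ℂ → ℂ → ℂ) : Prop :=
  ∀ φ ∈ holCharts S, ∀ φ' ∈ holCharts S, ∀ x ∈ φ.source ∩ φ'.source,
    q φ (φ x) = q φ' (φ' x) * (deriv (φ' ∘ φ.symm) (φ x)) ^ 2

/-- The local coefficients `q φ` are holomorphic. -/
def IsHolomorphic (q : OpenPartialHomeomorph S ℂ → ℂ → ℂ) : Prop :=
  ∀ φ ∈ holCharts S, DifferentiableOn ℂ (q φ) φ.target

/-- `S` admits a smooth real function without critical points. -/
def AdmitsFunctionWithoutCriticalPoints (S : Type*) [TopologicalSpace S] [ChartedSpace ℂ S] :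
    Prop :=
  ∃ f : S → ℝ, ContMDiff 𝓘(ℝ, ℂ) 𝓘(ℝ) ∞ f ∧ ∀ x, mfderiv 𝓘(ℝ, ℂ) 𝓘(ℝ) f x ≠ 0

/-- `S` admits a smooth tangent vector field without singularities (zeros). -/
def AdmitsNonvanishingVectorField (S : Type*) [TopologicalSpace S] [ChartedSpace ℂ S]
    [IsManifold 𝓘(ℂ) ω S] : Prop :=
  ∃ V : ∀ x : S, TangentSpace 𝓘(ℝ, ℂ) x,
    ContMDiff 𝓘(ℝ, ℂ) 𝓘(ℝ, ℂ).tangent ∞ (fun x => (⟨x, V x⟩ : TangentBundle 𝓘(ℝ, ℂ) S)) ∧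
      ∀ x, V x ≠ 0

end Surface

end HopfProduct

/-!
The coefficient of `Q` can be rewritten without the second normal: since `n₂` is the position vector
up to scale, its second fundamental form is determined by the height function `t`, and
`Q = (2 H ψ¹ - 2 κ t_z²) dz²` (`LocalSurface.localQ_eq`). By the Codazzi equation and the formula
for the Laplacian of `t`, the defect in the Cauchy-Riemann equations for this coefficient is `A (∇H)`, up to
a constant, where `A` is the second fundamental form of `n₁` (`SurfaceData.cauchyRiemann_U`,
`SurfaceData.cauchyRiemann_V`). Hence `Q` is holomorphic if and only if `A (∇H) = 0`
(`LocalSurface.differentiableOn_localQ_iff`); in particular it is if `H` is constant.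

Conversely, let `Q` be holomorphic. Where `dH ≠ 0`, take an orthonormal frame `U`, `V` with `U`
along the gradient of `H`. Then the second fundamental form of `n₁` is `k V* ⊗ V*` with `k = 2 H`
and `V k = 0`, and the equations of Gauss and Codazzi form a closed system (`FrameSystem`).

* If `κ ≠ 0`, the integrability condition of this system forces `V t = 0`: otherwise the angle
  function `ν` is a parameter on the level curves of `H`, and the condition turns into the vanishing
  of a polynomial in `ν` of degree `7` with coefficients constant on these curves and the leading
  one nonzero (`ScaledSystem.one_eq_zero`). Then `ν` is locally constant, and `|dH|²` is an explicit
  function of `H` and `ν` (`SurfaceData.GradientFrame.curved_case`).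
* If `κ = 0`, then `|dH|²` is a locally constant multiple of `H⁴`
  (`SurfaceData.GradientFrame.flat_case`).

In both cases `|dH|² = g (4 H² + δ)² / 4` with `g` and `δ` locally constant. Along a segment
starting at a critical point of `H` this is an ordinary differential inequality for `4 H² + δ`, and
Grönwall's inequality shows that the segment consists of critical points
(`fderiv_eq_zero_of_rigid`). So the set of critical points is open and closed, and `H` is either
constant or has no critical points at all (`const_or_no_critical_points`). In the second case `H` is
a function without critical points, its gradient is a vector field without zeros, and the surface is
not compact.

The local computations are identities between functions on an open set of `ℂ`. They are carried out
in an arbitrary commutative ring with two derivations (`SurfaceData`), and applied to the ring of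
smooth functions (`smoothRing`).
-/

namespace HopfProduct

/-! ### Smooth functions on an open set of the plane -/

/-- The ring of smooth real functions on `W ⊂ ℂ` (for `W` open), as a subalgebra of the functions on
the subtype `W`, so that two functions are equal as soon as they agree on `W`. -/
def smoothRing (W : Set ℂ) : Subalgebra ℝ (W → ℝ) where
  carrier := {f | ∃ g : ℂ → ℝ, ContDiffOn ℝ ∞ g W ∧ ∀ z : W, f z = g z}
  mul_mem' := by
    rintro f f' ⟨g, hg, h⟩ ⟨g', hg', h'⟩
    exact ⟨fun z => g z * g' z, hg.mul hg', fun z => by simp [h, h']⟩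
  add_mem' := by
    rintro f f' ⟨g, hg, h⟩ ⟨g', hg', h'⟩
    exact ⟨fun z => g z + g' z, hg.add hg', fun z => by simp [h, h']⟩
  algebraMap_mem' c := ⟨fun _ => c, contDiffOn_const, fun z => rfl⟩

section SmoothRing

variable {W : Set ℂ}

/-- The restriction to `W` of a function which is smooth on `W`. -/
def toSmooth (g : ℂ → ℝ) (hg : ContDiffOn ℝ ∞ g W) : smoothRing W :=
  ⟨fun z => g z, g, hg, fun _ => rfl⟩

/-- The extension of a function on `W` to `ℂ` by zero. On the open set `W` its derivatives are those
of the function. -/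
noncomputable def extendZero (f : W → ℝ) : ℂ → ℝ :=
  open Classical in fun z => if h : z ∈ W then f ⟨z, h⟩ else 0

theorem extendZero_apply (f : W → ℝ) (z : W) : extendZero f z = f z := by
  simp [extendZero]

theorem contDiffOn_extendZero (f : smoothRing W) : ContDiffOn ℝ ∞ (extendZero f.1) W := by
  obtain ⟨g, hg, h⟩ := f.2
  exact hg.congr fun z hz => by rw [extendZero_apply f.1 ⟨z, hz⟩, h]

theorem eventuallyEq_of_eqOn {E : Type*} (hW : IsOpen W) {g g' : ℂ → E} (h : Set.EqOn g g' W)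
    {z : ℂ} (hz : z ∈ W) : g =ᶠ[nhds z] g' :=
  h.eventuallyEq_of_mem (hW.mem_nhds hz)

theorem contDiffOn_fderiv_apply {E : Type*} [NormedAddCommGroup E] [NormedSpace ℝ E]
    (hW : IsOpen W) {g : ℂ → E} (hg : ContDiffOn ℝ ∞ g W)
    (v : ℂ) : ContDiffOn ℝ ∞ (fun z => fderiv ℝ g z v) W :=
  (hg.fderiv_of_isOpen hW (by simp)).clm_apply contDiffOn_const

theorem differentiableAt_of_smooth {E : Type*} [NormedAddCommGroup E] [NormedSpace ℝ E]
    (hW : IsOpen W) {g : ℂ → E} (hg : ContDiffOn ℝ ∞ g W) {z : ℂ}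
    (hz : z ∈ W) : DifferentiableAt ℝ g z :=
  (hg.contDiffAt (hW.mem_nhds hz)).differentiableAt (by simp)

/-- The derivative in the constant direction `v`, as a derivation of the ring of smooth functions
on the open set `W`. -/
noncomputable def dirDeriv (hW : IsOpen W) (v : ℂ) : Derivation ℝ (smoothRing W) (smoothRing W) :=
  Derivation.mk'
    { toFun := fun f => toSmooth (fun z => fderiv ℝ (extendZero f.1) z v)
        (contDiffOn_fderiv_apply hW (contDiffOn_extendZero f) v)
      map_add' := by
        intro f g
        ext z
        have h : extendZero (f + g).1 =ᶠ[nhds (z : ℂ)] extendZero f.1 + extendZero g.1 :=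
          eventuallyEq_of_eqOn hW (fun x hx => by
            simp [extendZero, hx]) z.2
        change fderiv ℝ (extendZero (f + g).1) z v = fderiv ℝ (extendZero f.1) z v +
          fderiv ℝ (extendZero g.1) z v
        rw [h.fderiv_eq, fderiv_add
          (differentiableAt_of_smooth hW (contDiffOn_extendZero f) z.2)
          (differentiableAt_of_smooth hW (contDiffOn_extendZero g) z.2)]
        rfl
      map_smul' := by
        intro c f
        ext z
        have h : extendZero (c • f).1 =ᶠ[nhds (z : ℂ)] c • extendZero f.1 :=
          eventuallyEq_of_eqOn hW (fun x hx => by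
            simp [extendZero, hx]) z.2
        change fderiv ℝ (extendZero (c • f).1) z v = c • fderiv ℝ (extendZero f.1) z v
        rw [h.fderiv_eq, fderiv_const_smul
          (differentiableAt_of_smooth hW (contDiffOn_extendZero f) z.2)]
        rfl }
    (by
      intro f g
      ext z
      have h : extendZero (f * g).1 =ᶠ[nhds (z : ℂ)] extendZero f.1 * extendZero g.1 :=
        eventuallyEq_of_eqOn hW (fun x hx => by
          simp [extendZero, hx]) z.2
      change fderiv ℝ (extendZero (f * g).1) z v = f.1 z * fderiv ℝ (extendZero g.1) z v +
          g.1 z * fderiv ℝ (extendZero f.1) z v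
      rw [h.fderiv_eq, fderiv_mul
          (differentiableAt_of_smooth hW (contDiffOn_extendZero f) z.2)
          (differentiableAt_of_smooth hW (contDiffOn_extendZero g) z.2)]
      simp [extendZero_apply])

theorem dirDeriv_toSmooth (hW : IsOpen W) (v : ℂ) (g : ℂ → ℝ) (hg : ContDiffOn ℝ ∞ g W) :
    dirDeriv hW v (toSmooth g hg) =
      toSmooth (fun z => fderiv ℝ g z v) (contDiffOn_fderiv_apply hW hg v) := by
  ext z
  have h : extendZero (toSmooth g hg).1 =ᶠ[nhds (z : ℂ)] g :=
    eventuallyEq_of_eqOn hW (fun x hx => by simp [extendZero, hx, toSmooth]) z.2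
  change fderiv ℝ (extendZero (toSmooth g hg).1) z v = fderiv ℝ g z v
  rw [h.fderiv_eq]

theorem exists_toSmooth (f : smoothRing W) : ∃ g hg, f = toSmooth (W := W) g hg := by
  obtain ⟨g, hg, h⟩ := f.2
  exact ⟨g, hg, Subtype.ext (funext h)⟩

theorem fderiv_fderiv_apply_comm {E : Type*} [NormedAddCommGroup E] [NormedSpace ℝ E]
    (hW : IsOpen W) {g : ℂ → E} (hg : ContDiffOn ℝ ∞ g W) {z : ℂ} (hz : z ∈ W) (v w : ℂ) :
    fderiv ℝ (fun x => fderiv ℝ g x v) z w = fderiv ℝ (fun x => fderiv ℝ g x w) z v := by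
  have hd : DifferentiableAt ℝ (fderiv ℝ g) z :=
    differentiableAt_of_smooth hW (hg.fderiv_of_isOpen hW (by simp)) hz
  have hs : IsSymmSndFDerivAt ℝ g z :=
    (hg.contDiffAt (hW.mem_nhds hz)).isSymmSndFDerivAt (by
      simpa using (WithTop.coe_le_coe.2 le_top : ((2 : ℕ∞) : WithTop ℕ∞) ≤ ∞))
  rw [fderiv_clm_apply hd (by fun_prop), fderiv_clm_apply hd (by fun_prop)]
  simpa using hs w v

theorem dirDeriv_comm (hW : IsOpen W) (v w : ℂ) (f : smoothRing W) :
    dirDeriv hW v (dirDeriv hW w f) = dirDeriv hW w (dirDeriv hW v f) := by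
  obtain ⟨g, hg, rfl⟩ := exists_toSmooth f
  simp only [dirDeriv_toSmooth]
  ext z
  exact fderiv_fderiv_apply_comm hW hg z.2 w v

/-- A smooth function without zeros is a unit. -/
theorem exists_mul_eq_one (f : smoothRing W) (hf : ∀ z, f.1 z ≠ 0) :
    ∃ g : smoothRing W, f * g = 1 := by
  obtain ⟨g, hg, rfl⟩ := exists_toSmooth f
  refine ⟨toSmooth (fun z => (g z)⁻¹) (hg.inv fun z hz => hf ⟨z, hz⟩), ?_⟩
  ext z
  exact mul_inv_cancel₀ (hf z)

end SmoothRing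

/-! ### Diagonal forms and Parseval's identity -/

section Form

variable {R : Type*} [CommRing R]

/-- The diagonal form `x₀y₀ + x₁y₁ + σ x₂y₂ + ε x₃y₃` on `R⁴`. -/
def diagForm (σ ε : R) (x y : Fin 4 → R) : R :=
  x 0 * y 0 + x 1 * y 1 + σ * (x 2 * y 2) + ε * (x 3 * y 3)

theorem diagForm_comm (σ ε : R) (x y : Fin 4 → R) : diagForm σ ε x y = diagForm σ ε y x := by
  simp only [diagForm]; ring

theorem diagForm_add_left (σ ε : R) (x x' y : Fin 4 → R) :
    diagForm σ ε (x + x') y = diagForm σ ε x y + diagForm σ ε x' y := by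
  simp only [diagForm, Pi.add_apply]; ring

theorem diagForm_smul_left (σ ε c : R) (x y : Fin 4 → R) :
    diagForm σ ε (c • x) y = c * diagForm σ ε x y := by
  simp only [diagForm, Pi.smul_apply, smul_eq_mul]; ring

theorem diagForm_add_right (σ ε : R) (x y y' : Fin 4 → R) :
    diagForm σ ε x (y + y') = diagForm σ ε x y + diagForm σ ε x y' := by
  simp only [diagForm, Pi.add_apply]; ring

theorem diagForm_smul_right (σ ε c : R) (x y : Fin 4 → R) :
    diagForm σ ε x (c • y) = c * diagForm σ ε x y := by
  simp only [diagForm, Pi.smul_apply, smul_eq_mul]; ring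

/-- A derivation applied to the entries of a vector. -/
def dvec (D : Derivation ℤ R R) (x : Fin 4 → R) : Fin 4 → R := fun i => D (x i)

theorem deriv_diagForm {σ ε : R} (D : Derivation ℤ R R) (hσ : D σ = 0) (hε : D ε = 0)
    (x y : Fin 4 → R) :
    D (diagForm σ ε x y) = diagForm σ ε (dvec D x) y + diagForm σ ε x (dvec D y) := by
  simp only [diagForm, dvec, map_add, Derivation.leibniz, smul_eq_mul, hσ, hε]; ring

/-- Parseval's identity: if `b 0, …, b 3` are orthogonal with squared norms `g i` invertible in `R`,
then the form is the sum of the products of coefficients. The left inverse of the Gram relation is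
turned into a right inverse, which is possible for square matrices over any commutative ring. -/
theorem diagForm_parseval {σ ε : R} (hσ : σ * σ = 1) (hε : ε * ε = 1) (b : Fin 4 → Fin 4 → R)
    (g g' : Fin 4 → R) (hb : ∀ i j, diagForm σ ε (b i) (b j) = if i = j then g i else 0)
    (hg : ∀ i, g' i * g i = 1) (x y : Fin 4 → R) :
    diagForm σ ε x y = ∑ i, g' i * (diagForm σ ε x (b i) * diagForm σ ε y (b i)) := by
  let J : Matrix (Fin 4) (Fin 4) R := Matrix.diagonal ![1, 1, σ, ε]
  let A : Matrix (Fin 4) (Fin 4) R := Matrix.of b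
  have hform : ∀ x y, diagForm σ ε x y = x ⬝ᵥ (J.mulVec y) := by
    intro x y
    simp [diagForm, J, dotProduct, Fin.sum_univ_four, Matrix.mulVec_diagonal]
    ring
  have hJJ : J * J = 1 := by
    simp only [J, Matrix.diagonal_mul_diagonal]
    rw [← Matrix.diagonal_one]
    congr 1
    funext i
    fin_cases i <;> simp [hσ, hε]
  have h1 : (Matrix.diagonal g' * A) * (J * A.transpose) = 1 := by
    ext i j
    have h2 : (A * (J * A.transpose)) i j = if i = j then g i else 0 := by
      rw [← hb i j, hform]
      simp only [Matrix.mul_apply, dotProduct, Matrix.mulVec, A, Matrix.of_apply,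
        Matrix.transpose_apply]
    rw [Matrix.mul_assoc, Matrix.diagonal_mul, h2, Matrix.one_apply]
    split_ifs with h
    · exact hg i
    · simp
  have h3 : (J * A.transpose) * (Matrix.diagonal g' * A) = 1 := mul_eq_one_comm.1 h1
  have h4 : A.transpose * (Matrix.diagonal g' * A) = J := by
    calc A.transpose * (Matrix.diagonal g' * A)
        = (J * J) * (A.transpose * (Matrix.diagonal g' * A)) := by rw [hJJ, one_mul]
      _ = J * ((J * A.transpose) * (Matrix.diagonal g' * A)) := by simp only [Matrix.mul_assoc]
      _ = J := by rw [h3, mul_one]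
  have h5 : J * (A.transpose * (Matrix.diagonal g' * A)) * J = J := by
    rw [h4, hJJ, one_mul]
  have h6 : ∀ i, diagForm σ ε x (b i) = (A.mulVec (J.mulVec x)) i := by
    intro i
    rw [diagForm_comm, hform]; rfl
  have h7 : ∀ i, diagForm σ ε y (b i) = (A.mulVec (J.mulVec y)) i := by
    intro i
    rw [diagForm_comm, hform]; rfl
  have h8 : ∑ i, g' i * (diagForm σ ε x (b i) * diagForm σ ε y (b i)) =
      (A.mulVec (J.mulVec x)) ⬝ᵥ ((Matrix.diagonal g').mulVec (A.mulVec (J.mulVec y))) := by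
    simp only [dotProduct, Matrix.mulVec_diagonal, h6, h7]
    exact Finset.sum_congr rfl fun i _ => by ring
  have hJt : J.transpose = J := Matrix.diagonal_transpose _
  rw [h8, hform]
  conv_lhs => rw [← h5]
  simp only [Matrix.mulVec_mulVec, Matrix.dotProduct_mulVec, Matrix.vecMul_mulVec]
  simp only [Matrix.transpose_mul, hJt, Matrix.mul_assoc]

end Form

/-! ### Surfaces over a ring with two derivations: Codazzi and Cauchy-Riemann equations -/

/-- The algebraic data of a surface in `M²(κ) × ℝ` over a ring `R` of functions: the derivations
`U`, `V` span the tangent bundle, `F` is the immersion, `N` its unit normal, and `η` is the normal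
of `M²(κ) × ℝ`, normalized by `dη = lam • (dF)ʰ`, where `ʰ` is the projection to the first three
coordinates. The fields `dF U` and `dF V` are orthogonal with squared norm `E`. The squared norm of
`η` is the inverse of `rho`; the parameters `lam` and `rho` are `1` and `κ` if `κ ≠ 0`, and `0` and
`1` if `κ = 0`. Coordinate derivatives have `p = q = 0`, an orthonormal frame has `E = 1`. -/
structure SurfaceData (R : Type*) [CommRing R] where
  (U V : Derivation ℤ R R)
  (half κ ε σ lam rho E E' p q : R)
  (F N η : Fin 4 → R)
  two_half : 2 * half = 1
  comm : ∀ f, U (V f) = V (U f) + p * U f + q * V f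
  Uκ : U κ = 0
  Vκ : V κ = 0
  Uε : U ε = 0
  Vε : V ε = 0
  Uσ : U σ = 0
  Vσ : V σ = 0
  εε : ε * ε = 1
  σσ : σ * σ = 1
  lam_rho : lam * lam * rho = κ
  ηη : rho * diagForm σ ε η η = 1
  η3 : η 3 = 0
  Uη : ∀ i, i ≠ 3 → U (η i) = lam * U (F i)
  Vη : ∀ i, i ≠ 3 → V (η i) = lam * V (F i)
  EE : E' * E = 1
  UU : diagForm σ ε (dvec U F) (dvec U F) = E
  VV : diagForm σ ε (dvec V F) (dvec V F) = E
  UV : diagForm σ ε (dvec U F) (dvec V F) = 0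
  UN : diagForm σ ε (dvec U F) N = 0
  VN : diagForm σ ε (dvec V F) N = 0
  NN : diagForm σ ε N N = ε
  Nη : diagForm σ ε N η = 0
  UFη : diagForm σ ε (dvec U F) η = 0
  VFη : diagForm σ ε (dvec V F) η = 0

namespace SurfaceData

variable {R : Type*} [CommRing R] (S : SurfaceData R)

/-- The flat metric. -/
def B (x y : Fin 4 → R) : R := diagForm S.σ S.ε x y

/-- The tangent vector `dF U`. -/
def FU : Fin 4 → R := dvec S.U S.F

/-- The tangent vector `dF V`. -/
def FV : Fin 4 → R := dvec S.V S.F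

/-- The component `h(U, U)` of the second fundamental form in the direction `N`. -/
def hUU : R := S.B (dvec S.U S.FU) S.N

/-- The component `h(U, V)` of the second fundamental form in the direction `N`. -/
def hUV : R := S.B (dvec S.U S.FV) S.N

/-- The component `h(V, V)` of the second fundamental form in the direction `N`. -/
def hVV : R := S.B (dvec S.V S.FV) S.N

/-- The derivative of the height function along `U`. -/
def tU : R := S.U (S.F 3)

/-- The derivative of the height function along `V`. -/
def tV : R := S.V (S.F 3)

/-- The vertical component of the unit normal (the angle function). -/
def ν : R := S.N 3

theorem U_B (x y : Fin 4 → R) : S.U (S.B x y) = S.B (dvec S.U x) y + S.B x (dvec S.U y) :=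
  deriv_diagForm S.U S.Uσ S.Uε x y

theorem V_B (x y : Fin 4 → R) : S.V (S.B x y) = S.B (dvec S.V x) y + S.B x (dvec S.V y) :=
  deriv_diagForm S.V S.Vσ S.Vε x y

theorem B_comm (x y : Fin 4 → R) : S.B x y = S.B y x := diagForm_comm _ _ _ _

theorem parseval (x y : Fin 4 → R) :
    S.B x y = S.E' * (S.B x S.FU * S.B y S.FU) + S.E' * (S.B x S.FV * S.B y S.FV) +
      S.ε * (S.B x S.N * S.B y S.N) + S.rho * (S.B x S.η * S.B y S.η) := by
  have h := diagForm_parseval S.σσ S.εε ![S.FU, S.FV, S.N, S.η]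
    ![S.E, S.E, S.ε, diagForm S.σ S.ε S.η S.η] ![S.E', S.E', S.ε, S.rho] ?_ ?_ x y
  · simpa [Fin.sum_univ_four, B] using h
  · have h1 := diagForm_comm S.σ S.ε
    intro i j
    fin_cases i <;> fin_cases j <;>
      simp [S.UU, S.VV, S.UV, S.UN, S.VN, S.NN, S.Nη, S.UFη, S.VFη, FU, FV, h1 (dvec S.V S.F),
        h1 S.N, h1 S.η]
  · intro i
    fin_cases i <;> simp [S.EE, S.εε, S.ηη]

/-- The unit vertical vector of the ambient space is `Pi.single 3 1`. -/
theorem B_vertical (x : Fin 4 → R) : S.B x (Pi.single 3 1) = S.ε * x 3 := by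
  simp [B, diagForm]

/-- Parseval's identity for the vertical vector, whose components in the frame are the derivatives
of the height and the angle function. It has no component along `η`. -/
theorem coord_three (x : Fin 4 → R) :
    x 3 = S.E' * (S.B x S.FU * S.tU + S.B x S.FV * S.tV) + S.ε * (S.B x S.N * S.ν) := by
  have h := S.parseval x (Pi.single 3 1)
  have hv : ∀ y, S.B (Pi.single 3 1) y = S.ε * y 3 := fun y => by rw [B_comm, B_vertical]
  simp only [hv, B_vertical, S.η3] at h
  simp only [FU, FV, dvec] at h ⊢
  change S.ε * x 3 = S.E' * (_ * (S.ε * S.tU)) + S.E' * (_ * (S.ε * S.tV)) +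
    S.ε * (_ * (S.ε * S.ν)) + _ at h
  linear_combination S.ε * h + (S.E' * (S.B x (dvec S.U S.F) * S.tU + S.B x (dvec S.V S.F) * S.tV) +
    S.ε * (S.B x S.N * S.ν) - x 3) * S.εε

/-- The squared norm of the vertical field. -/
theorem vertical_norm : S.ε * S.E' * (S.tU ^ 2 + S.tV ^ 2) + S.ν ^ 2 = 1 := by
  have h := S.coord_three (Pi.single 3 1)
  have hv : ∀ y, S.B (Pi.single 3 1) y = S.ε * y 3 := fun y => by rw [B_comm, B_vertical]
  simp only [hv, Pi.single_eq_same] at h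
  change 1 = S.E' * (S.ε * S.tU * S.tU + S.ε * S.tV * S.tV) + S.ε * (S.ε * S.ν * S.ν) at h
  linear_combination -h + S.ν ^ 2 * (-S.εε)

/-- The derivative of `η` is `lam` times the horizontal part of the derivative of `F`. -/
theorem B_dvec_η {D : Derivation ℤ R R} (h : ∀ i, i ≠ 3 → D (S.η i) = S.lam * D (S.F i))
    (x : Fin 4 → R) :
    S.B x (dvec D S.η) = S.lam * (S.B x (dvec D S.F) - S.ε * (x 3 * D (S.F 3))) := by
  simp only [B, diagForm, dvec, h 0 (by decide), h 1 (by decide), h 2 (by decide), S.η3, map_zero]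
  ring

theorem FUU : S.B S.FU S.FU = S.E := S.UU
theorem FVV : S.B S.FV S.FV = S.E := S.VV
theorem FUV : S.B S.FU S.FV = 0 := S.UV
theorem FVU : S.B S.FV S.FU = 0 := by rw [B_comm, FUV]

theorem U_FV : dvec S.U S.FV = dvec S.V S.FU + S.p • S.FU + S.q • S.FV := by
  funext i
  exact S.comm (S.F i)

theorem two_cancel (S : SurfaceData R) {x y : R} (h : 2 * x = 2 * y) : x = y := by
  linear_combination S.half * h - (x - y) * S.two_half

theorem UFU_FU : 2 * S.B (dvec S.U S.FU) S.FU = S.U S.E := by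
  rw [← S.FUU, U_B, S.B_comm S.FU]; ring

theorem VFU_FU : 2 * S.B (dvec S.V S.FU) S.FU = S.V S.E := by
  rw [← S.FUU, V_B, S.B_comm S.FU]; ring

theorem UFV_FV : 2 * S.B (dvec S.U S.FV) S.FV = S.U S.E := by
  rw [← S.FVV, U_B, S.B_comm S.FV]; ring

theorem VFV_FV : 2 * S.B (dvec S.V S.FV) S.FV = S.V S.E := by
  rw [← S.FVV, V_B, S.B_comm S.FV]; ring

theorem UFU_FV : S.B (dvec S.U S.FU) S.FV = -S.B (dvec S.U S.FV) S.FU := by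
  have h := S.U_B S.FU S.FV
  rw [S.FUV, map_zero, S.B_comm S.FU] at h
  linear_combination -h

theorem VFU_FV : S.B (dvec S.V S.FU) S.FV = -S.B (dvec S.V S.FV) S.FU := by
  have h := S.V_B S.FU S.FV
  rw [S.FUV, map_zero, S.B_comm S.FU] at h
  linear_combination -h

theorem UFV (x : Fin 4 → R) : S.B (dvec S.U S.FV) x =
    S.B (dvec S.V S.FU) x + S.p * S.B S.FU x + S.q * S.B S.FV x := by
  rw [U_FV]
  simp only [B, diagForm_add_left, diagForm_smul_left]

theorem hVU : S.B (dvec S.V S.FU) S.N = S.hUV := by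
  have h1 : S.B S.FU S.N = 0 := S.UN
  have h2 : S.B S.FV S.N = 0 := S.VN
  rw [hUV, UFV, h1, h2]; ring

theorem UFU_η : S.B (dvec S.U S.FU) S.η = -S.lam * (S.E - S.ε * S.tU ^ 2) := by
  have h := S.U_B S.FU S.η
  rw [show S.B S.FU S.η = 0 from S.UFη, map_zero, B_dvec_η S S.Uη] at h
  change 0 = _ + S.lam * (S.B S.FU S.FU - S.ε * (S.tU * S.tU)) at h
  rw [FUU] at h
  linear_combination -h

theorem VFV_η : S.B (dvec S.V S.FV) S.η = -S.lam * (S.E - S.ε * S.tV ^ 2) := by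
  have h := S.V_B S.FV S.η
  rw [show S.B S.FV S.η = 0 from S.VFη, map_zero, B_dvec_η S S.Vη] at h
  change 0 = _ + S.lam * (S.B S.FV S.FV - S.ε * (S.tV * S.tV)) at h
  rw [FVV] at h
  linear_combination -h

theorem UFV_η : S.B (dvec S.U S.FV) S.η = S.lam * S.ε * S.tU * S.tV := by
  have h := S.U_B S.FV S.η
  rw [show S.B S.FV S.η = 0 from S.VFη, map_zero, B_dvec_η S S.Uη] at h
  change 0 = _ + S.lam * (S.B S.FV S.FU - S.ε * (S.tV * S.tU)) at h
  rw [FVU] at h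
  linear_combination -h

theorem VFU_η : S.B (dvec S.V S.FU) S.η = S.lam * S.ε * S.tU * S.tV := by
  have h := S.V_B S.FU S.η
  rw [show S.B S.FU S.η = 0 from S.UFη, map_zero, B_dvec_η S S.Vη] at h
  change 0 = _ + S.lam * (S.B S.FU S.FV - S.ε * (S.tU * S.tV)) at h
  rw [FUV] at h
  linear_combination -h

theorem UN_FU : S.B (dvec S.U S.N) S.FU = -S.hUU := by
  have h := S.U_B S.FU S.N
  rw [show S.B S.FU S.N = 0 from S.UN, map_zero, S.B_comm S.FU] at h
  simp only [hUU]; linear_combination -h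

theorem UN_FV : S.B (dvec S.U S.N) S.FV = -S.hUV := by
  have h := S.U_B S.FV S.N
  rw [show S.B S.FV S.N = 0 from S.VN, map_zero, S.B_comm S.FV] at h
  simp only [hUV]; linear_combination -h

theorem VN_FU : S.B (dvec S.V S.N) S.FU = -S.hUV := by
  have h := S.V_B S.FU S.N
  rw [show S.B S.FU S.N = 0 from S.UN, map_zero, S.B_comm S.FU, hVU] at h
  linear_combination -h

theorem VN_FV : S.B (dvec S.V S.N) S.FV = -S.hVV := by
  have h := S.V_B S.FV S.N
  rw [show S.B S.FV S.N = 0 from S.VN, map_zero, S.B_comm S.FV] at h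
  simp only [hVV]; linear_combination -h

theorem UN_N : S.B (dvec S.U S.N) S.N = 0 := by
  have h := S.U_B S.N S.N
  rw [show S.B S.N S.N = S.ε from S.NN, S.Uε, S.B_comm S.N] at h
  exact S.two_cancel (by linear_combination -h)

theorem VN_N : S.B (dvec S.V S.N) S.N = 0 := by
  have h := S.V_B S.N S.N
  rw [show S.B S.N S.N = S.ε from S.NN, S.Vε, S.B_comm S.N] at h
  exact S.two_cancel (by linear_combination -h)

theorem UN_η : S.B (dvec S.U S.N) S.η = S.lam * S.ε * S.ν * S.tU := by
  have h := S.U_B S.N S.η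
  rw [show S.B S.N S.η = 0 from S.Nη, map_zero, B_dvec_η S S.Uη, S.B_comm S.N] at h
  change 0 = _ + S.lam * (S.B S.FU S.N - S.ε * (S.ν * S.tU)) at h
  rw [show S.B S.FU S.N = 0 from S.UN] at h
  linear_combination -h

theorem VN_η : S.B (dvec S.V S.N) S.η = S.lam * S.ε * S.ν * S.tV := by
  have h := S.V_B S.N S.η
  rw [show S.B S.N S.η = 0 from S.Nη, map_zero, B_dvec_η S S.Vη, S.B_comm S.N] at h
  change 0 = _ + S.lam * (S.B S.FV S.N - S.ε * (S.ν * S.tV)) at h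
  rw [show S.B S.FV S.N = 0 from S.VN] at h
  linear_combination -h

/-- The commutator of the derivations on vectors. -/
theorem B_comm_deriv (x y : Fin 4 → R) : S.B (dvec S.U (dvec S.V x)) y =
    S.B (dvec S.V (dvec S.U x)) y + S.p * S.B (dvec S.U x) y + S.q * S.B (dvec S.V x) y := by
  have h : dvec S.U (dvec S.V x) =
      dvec S.V (dvec S.U x) + S.p • dvec S.U x + S.q • dvec S.V x := funext fun i => S.comm (x i)
  rw [h]
  simp only [B, diagForm_add_left, diagForm_smul_left]

/-- The Codazzi equation for coordinate derivatives. -/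
theorem codazzi_U (hp : S.p = 0) (hq : S.q = 0) :
    2 * (S.V S.hUU - S.U S.hUV) = S.E' * (S.hUU + S.hVV) * S.V S.E
      - 2 * S.ε * S.κ * S.E * S.ν * S.tV := by
  have h1 : S.V S.hUU = _ := S.V_B (dvec S.U S.FU) S.N
  have h2 : S.U S.hUV = _ := congrArg S.U S.hVU.symm
  rw [U_B, B_comm_deriv] at h2
  have h3 := S.parseval (dvec S.U S.FU) (dvec S.V S.N)
  have h4 := S.parseval (dvec S.V S.FU) (dvec S.U S.N)
  rw [VN_FU, VN_FV, VN_N, VN_η, UFU_η, UFU_FV, UFV, FUU, FVU, hp, hq] at h3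
  rw [UN_FU, UN_FV, UN_N, UN_η, VFU_η, VFU_FV] at h4
  have a1 := S.UFU_FU
  have a2 := S.VFU_FU
  have a3 := S.UFV_FV
  have a5 := S.VFU_FV
  have a4 : S.B (dvec S.U S.FV) S.FV = S.B (dvec S.V S.FU) S.FV := by
    rw [UFV, hp, hq]; ring
  rw [h1, h2, h3, h4, hp, hq]
  linear_combination S.E' * (S.hUU + S.hVV) * a2 - 2 * S.ε * S.E * S.ν * S.tV * S.lam_rho
    - S.E' * S.hUV * (a1 - a3) - 2 * S.E' * S.hUV * (a4 + a5)

/-- The surface data with the roles of the two derivations exchanged; it turns each identity into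
its mirror image. -/
def swap : SurfaceData R where
  U := S.V
  V := S.U
  half := S.half
  κ := S.κ
  ε := S.ε
  σ := S.σ
  lam := S.lam
  rho := S.rho
  E := S.E
  E' := S.E'
  p := -S.q
  q := -S.p
  F := S.F
  N := S.N
  η := S.η
  two_half := S.two_half
  comm f := by linear_combination -S.comm f
  Uκ := S.Vκ
  Vκ := S.Uκ
  Uε := S.Vε
  Vε := S.Uε
  Uσ := S.Vσ
  Vσ := S.Uσ
  εε := S.εε
  σσ := S.σσ
  lam_rho := S.lam_rho
  ηη := S.ηη
  η3 := S.η3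
  Uη := S.Vη
  Vη := S.Uη
  EE := S.EE
  UU := S.VV
  VV := S.UU
  UV := S.FVU
  UN := S.VN
  VN := S.UN
  NN := S.NN
  Nη := S.Nη
  UFη := S.VFη
  VFη := S.UFη

/-- The second Codazzi equation for coordinate derivatives. -/
theorem codazzi_V (hp : S.p = 0) (hq : S.q = 0) :
    2 * (S.U S.hVV - S.V S.hUV) = S.E' * (S.hUU + S.hVV) * S.U S.E
      - 2 * S.ε * S.κ * S.E * S.ν * S.tU := by
  have h := S.swap.codazzi_U (by simp [swap, hq]) (by simp [swap, hp])
  have h1 : S.swap.hUU = S.hVV := rfl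
  have h2 : S.swap.hVV = S.hUU := rfl
  have h3 : S.swap.hUV = S.hUV := S.hVU
  rw [h1, h2, h3] at h
  change 2 * (S.U S.hVV - S.V S.hUV) = S.E' * (S.hVV + S.hUU) * S.U S.E
      - 2 * S.ε * S.κ * S.E * S.ν * S.tU at h
  linear_combination h

/-- The Laplacian of the height function. -/
theorem laplacian_height (hp : S.p = 0) (hq : S.q = 0) :
    S.U S.tU + S.V S.tV = S.ε * (S.hUU + S.hVV) * S.ν := by
  have h1 : S.U S.tU = _ := S.coord_three (dvec S.U S.FU)
  have h2 : S.V S.tV = _ := S.coord_three (dvec S.V S.FV)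
  have a1 := S.UFU_FU
  have a2 := S.VFU_FU
  have a3 := S.UFV_FV
  have a4 := S.VFV_FV
  have a5 := S.VFU_FV
  have a6 := S.UFU_FV
  rw [UFV, hp, hq] at a3 a6
  rw [h1, h2]
  simp only [hUU, hVV]
  apply S.two_cancel
  linear_combination S.E' * S.tU * (a1 - a3 + 2 * a5) + S.E' * S.tV * (a4 - a2 + 2 * a6)

/-- The mean curvature `H`. -/
def meanCurv : R := S.half * S.E' * (S.hUU + S.hVV)

/-- The real part of the coefficient `2 H ψ¹ - 2 κ t_z²` of `Q`, where `t` is the height. -/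
def reQ : R := S.meanCurv * (S.hUU - S.hVV) - S.κ * S.half * (S.tU ^ 2 - S.tV ^ 2)

/-- The imaginary part of the coefficient `2 H ψ¹ - 2 κ t_z²` of `Q`. -/
def imQ : R := -2 * S.meanCurv * S.hUV + S.κ * (S.tU * S.tV)

theorem two_meanCurv : 2 * S.E * S.meanCurv = S.hUU + S.hVV := by
  simp only [meanCurv]
  linear_combination S.E * S.E' * (S.hUU + S.hVV) * S.two_half + (S.hUU + S.hVV) * S.EE

theorem hVV_eq : S.hVV = 2 * S.E * S.meanCurv - S.hUU := by
  rw [two_meanCurv]; ring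

theorem map_half (D : Derivation ℤ R R) : D S.half = 0 := by
  have h := congrArg D S.two_half
  have h2 : D 2 = 0 := by simpa using D.map_natCast 2
  simp only [Derivation.leibniz, smul_eq_mul, h2, Derivation.map_one_eq_zero] at h
  linear_combination S.half * h - D S.half * S.two_half

/-- The defect in the first Cauchy-Riemann equation for `Q`. -/
theorem cauchyRiemann_U (hp : S.p = 0) (hq : S.q = 0) :
    S.U S.reQ - S.V S.imQ = 2 * (S.U S.meanCurv * S.hUU + S.V S.meanCurv * S.hUV) := by
  have c1 := S.codazzi_U hp hq
  have c2 := S.codazzi_V hp hq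
  have l := S.laplacian_height hp hq
  have hc := S.comm (S.F 3)
  rw [hp, hq] at hc
  have hV := S.hVV_eq
  have h2 : ∀ D : Derivation ℤ R R, D 2 = 0 := fun D => by simpa using D.map_natCast 2
  have hUV := congrArg S.U hV
  have hE : S.E' * (S.hUU + S.hVV) = 2 * S.meanCurv := by
    simp only [meanCurv]
    linear_combination -S.E' * (S.hUU + S.hVV) * S.two_half
  have hc' : S.U S.tV = S.V S.tU := by simp only [tU, tV]; linear_combination hc
  simp only [map_sub, Derivation.leibniz, smul_eq_mul, h2] at hUV
  simp only [reQ, imQ, map_add, map_sub, map_neg, Derivation.leibniz, Derivation.leibniz_pow,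
    smul_eq_mul, h2, map_half, S.Uκ, S.Vκ, neg_mul, nsmul_eq_mul]
  push_cast
  linear_combination -S.meanCurv * c2 + S.meanCurv * hUV - S.U S.meanCurv * hV
    - S.κ * S.tU * l - S.meanCurv * S.U S.E * hE - S.ε * S.κ * S.ν * S.tU * hV
    + (-S.κ * S.tU * S.U S.tU + S.κ * S.tV * S.U S.tV) * S.two_half + S.κ * S.tV * hc'

/-- The defect in the second Cauchy-Riemann equation for `Q`. -/
theorem cauchyRiemann_V (hp : S.p = 0) (hq : S.q = 0) :
    S.V S.reQ + S.U S.imQ = -2 * (S.V S.meanCurv * S.hVV + S.U S.meanCurv * S.hUV) := by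
  have h := S.swap.cauchyRiemann_U (by simp [swap, hq]) (by simp [swap, hp])
  have h1 : S.swap.hUU = S.hVV := rfl
  have h2 : S.swap.hVV = S.hUU := rfl
  have h3 : S.swap.hUV = S.hUV := S.hVU
  have h4 : S.swap.meanCurv = S.meanCurv := by
    simp only [meanCurv, h1, h2, add_comm S.hVV]; rfl
  have h5 : S.swap.imQ = S.imQ := by
    simp only [imQ, h3, h4]
    change _ + S.κ * (S.tV * S.tU) = _
    ring
  have h6 : S.swap.reQ = -S.reQ := by
    simp only [reQ, h1, h2, h4]
    change _ - S.κ * S.half * (S.tV ^ 2 - S.tU ^ 2) = _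
    ring
  rw [h1, h3, h4, h5, h6] at h
  change S.V (-S.reQ) - S.U S.imQ = 2 * (S.V S.meanCurv * S.hVV + S.U S.meanCurv * S.hUV) at h
  rw [map_neg] at h
  linear_combination -h

end SurfaceData

/-! ### Structure equations in a frame adapted to the kernel of the second form -/

/-- The structure equations, over a ring of functions, of a surface in `M²(κ) × ℝ` in an orthonormal
frame `U`, `V` for which the second fundamental form is `k V* ⊗ V*` with `V k = 0`. Here `ν` is the
angle function, `a` and `b` are the derivatives of the height, and `α`, `β` are the coefficients of
the Levi-Civita connection, `∇_U U = α V` and `∇_V U = β V`. -/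
structure FrameSystem (R : Type*) [CommRing R] where
  (U V : Derivation ℤ R R)
  (κ ε k ν a b α β : R)
  comm : ∀ f, U (V f) = V (U f) - α * U f - β * V f
  Uκ : U κ = 0
  Vκ : V κ = 0
  Uε : U ε = 0
  Vε : V ε = 0
  εε : ε * ε = 1
  norm : ε * (a ^ 2 + b ^ 2) + ν ^ 2 = 1
  Uk : U k = -β * k - ε * κ * ν * a
  Vk : V k = 0
  kα : k * α = -ε * κ * ν * b
  Uν : U ν = 0
  Vν : V ν = -k * b
  Ua : U a = α * b
  Ub : U b = -α * a
  Va : V a = β * b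
  Vb : V b = -β * a + ε * k * ν
  gauss : U β - V α + α ^ 2 + β ^ 2 = -κ * ν ^ 2

namespace SurfaceData

variable {R : Type*} [CommRing R] (S : SurfaceData R)

/-- The structure equations of a surface in an orthonormal frame whose first vector spans the kernel
of the second fundamental form; the equations for `k` and `α` are the Codazzi equations. -/
def toFrameSystem (hE : S.E = 1) (hU : S.hUU = 0) (hV : S.hUV = 0) (hk : S.V S.hVV = 0) :
    FrameSystem R :=
  have hE' : S.E' = 1 := by have h := S.EE; rwa [hE, mul_one] at h
  have one_zero : ∀ D : Derivation ℤ R R, D S.E = 0 := fun D => by rw [hE, D.map_one_eq_zero]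
  have a1 : S.B (dvec S.U S.FU) S.FU = 0 := S.two_cancel (by rw [S.UFU_FU, one_zero, mul_zero])
  have a2 : S.B (dvec S.V S.FU) S.FU = 0 := S.two_cancel (by rw [S.VFU_FU, one_zero, mul_zero])
  have a3 : S.B (dvec S.U S.FV) S.FV = 0 := S.two_cancel (by rw [S.UFV_FV, one_zero, mul_zero])
  have a4 : S.B (dvec S.V S.FV) S.FV = 0 := S.two_cancel (by rw [S.VFV_FV, one_zero, mul_zero])
  have a5 := S.VFU_FV
  have a6 := S.UFU_FV
  have hp : S.p = -S.B (dvec S.U S.FU) S.FV := by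
    rw [a6, S.UFV, a2, S.FUU, S.FVU, hE]; ring
  have hq : S.q = -S.B (dvec S.V S.FU) S.FV := by
    rw [S.UFV, S.FUV, S.FVV, hE] at a3
    linear_combination a3
  have n1 : S.B (dvec S.V S.FU) S.N = 0 := by rw [S.hVU, hV]
  have b1 := S.UN_FU
  have b2 := S.UN_FV
  have b3 := S.VN_FU
  have b4 := S.VN_FV
  { U := S.U
    V := S.V
    κ := S.κ
    ε := S.ε
    k := S.hVV
    ν := S.ν
    a := S.tU
    b := S.tV
    α := S.B (dvec S.U S.FU) S.FV
    β := S.B (dvec S.V S.FU) S.FV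
    comm := fun f => by rw [S.comm, hp, hq]; ring
    Uκ := S.Uκ
    Vκ := S.Vκ
    Uε := S.Uε
    Vε := S.Vε
    εε := S.εε
    norm := by have h := S.vertical_norm; rw [hE'] at h; linear_combination h
    -- the component along `V` of the Codazzi equation
    Uk := by
      have h := S.B_comm_deriv S.N S.FV
      have h1 := S.U_B (dvec S.V S.N) S.FV
      have h2 := S.V_B (dvec S.U S.N) S.FV
      have h3 := S.parseval (dvec S.V S.N) (dvec S.U S.FV)
      have h4 := S.parseval (dvec S.U S.N) (dvec S.V S.FV)
      rw [b1, b2, hU, hV, S.UN_N, S.UN_η, S.VFV_η, hE] at h4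
      rw [b3, b4, hV, S.VN_N, S.VN_η, a3, S.UFV_η] at h3
      rw [b4, map_neg, h3] at h1
      rw [b2, hV, map_neg, map_zero, h4] at h2
      rw [hp, hq, b2, b4, hV] at h
      linear_combination -h - h1 + h2 - S.ε * S.ν * S.tU * S.lam_rho
    Vk := hk
    -- the component along `U` of the Codazzi equation
    kα := by
      have h := S.B_comm_deriv S.N S.FU
      have h1 := S.U_B (dvec S.V S.N) S.FU
      have h2 := S.V_B (dvec S.U S.N) S.FU
      have h3 := S.parseval (dvec S.V S.N) (dvec S.U S.FU)
      have h4 := S.parseval (dvec S.U S.N) (dvec S.V S.FU)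
      rw [b1, b2, hU, hV, S.UN_N, S.UN_η, S.VFU_η] at h4
      rw [b3, b4, hV, S.VN_N, S.VN_η, S.UFU_η, hE, hE'] at h3
      rw [b3, hV, map_neg, map_zero, h3] at h1
      rw [b1, hU, map_neg, map_zero, h4] at h2
      rw [b1, b3, hU, hV] at h
      linear_combination h - h2 + h1 - S.ε * S.ν * S.tV * S.lam_rho
    Uν := by
      have h : S.U S.ν = _ := S.coord_three (dvec S.U S.N)
      rw [h, b1, b2, hU, hV, S.UN_N]; ring
    Vν := by
      have h : S.V S.ν = _ := S.coord_three (dvec S.V S.N)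
      rw [h, b3, b4, hV, S.VN_N, hE']; ring
    Ua := by
      have h : S.U S.tU = _ := S.coord_three (dvec S.U S.FU)
      rw [h, a1, show S.B (dvec S.U S.FU) S.N = 0 from hU, hE']; ring
    Ub := by
      have h : S.U S.tV = _ := S.coord_three (dvec S.U S.FV)
      rw [h, a3, show S.B (dvec S.U S.FV) S.N = 0 from hV, hE', a6]; ring
    Va := by
      have h : S.V S.tU = _ := S.coord_three (dvec S.V S.FU)
      rw [h, a2, n1, hE']; ring
    Vb := by
      have h : S.V S.tV = _ := S.coord_three (dvec S.V S.FV)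
      rw [h, a4, hE', a5]; simp only [hVV]; ring
    -- the curvature of the surface is `κ ν²`, because the second form has determinant zero
    gauss := by
      have h := S.B_comm_deriv S.FU S.FV
      have h1 := S.U_B (dvec S.V S.FU) S.FV
      have h2 := S.V_B (dvec S.U S.FU) S.FV
      have h3 := S.parseval (dvec S.V S.FU) (dvec S.U S.FV)
      have h4 := S.parseval (dvec S.U S.FU) (dvec S.V S.FV)
      rw [a1, a4, S.UFU_η, S.VFV_η, hE, show S.B (dvec S.U S.FU) S.N = 0 from hU] at h4
      rw [a2, a3, S.UFV_η, S.VFU_η, n1] at h3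
      rw [hp, hq] at h
      have hn := S.vertical_norm
      rw [hE'] at hn
      rw [h3] at h1
      rw [h4] at h2
      linear_combination h + h1 - h2 + S.κ * hn
        - (1 - S.ε * S.tU ^ 2 - S.ε * S.tV ^ 2) * S.lam_rho }

end SurfaceData

namespace FrameSystem

variable {R : Type*} [CommRing R] (S : FrameSystem R)

theorem V_Uk : S.V (S.U S.k) = S.α * S.U S.k := by
  have h := S.comm S.k
  rw [S.Vk, map_zero] at h
  linear_combination -h

/-- The derivative of the Codazzi equation `U k = -β k - ε κ ν a` along `V`. -/
theorem k_Vβ : S.k * S.V S.β = S.ε * S.κ * S.k * S.a * S.b + 2 * S.k * S.α * S.β +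
    S.ε * S.κ * S.α * S.ν * S.a := by
  have h := S.V_Uk
  rw [S.Uk] at h
  simp only [map_sub, map_neg, Derivation.leibniz, smul_eq_mul, S.Vk, S.Vε, S.Vκ, S.Va, S.Vν,
    neg_mul] at h
  linear_combination -h - S.β * S.kα

end FrameSystem

/-- A frame system with both frame vectors divided by `k`. Here `σ = ε κ / k²` and `y = β / k`, and
`α / k = -σ ν b` is eliminated. -/
structure ScaledSystem (R : Type*) [CommRing R] where
  (U V : Derivation ℤ R R)
  (ε σ ν a b y : R)
  comm : ∀ f, U (V f) = V (U f) + σ * ν * b * U f + σ * ν * a * V f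
  Uε : U ε = 0
  Vε : V ε = 0
  εε : ε * ε = 1
  norm : ε * (a ^ 2 + b ^ 2) + ν ^ 2 = 1
  Uσ : U σ = 2 * σ * (y + σ * ν * a)
  Vσ : V σ = 0
  Uν : U ν = 0
  Vν : V ν = -b
  Ua : U a = -σ * ν * b * b
  Ub : U b = σ * ν * b * a
  Va : V a = y * b
  Vb : V b = -y * a + ε * ν
  Uy : U y = σ * b ^ 2 + 2 * σ * ν * y * a - 2 * ε * σ * ν ^ 2 - (σ * ν * b) ^ 2
  Vy : V y = σ * a * b - 2 * σ * ν * b * y - σ * ν * b * σ * ν * a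

namespace FrameSystem

variable {R : Type*} [CommRing R] (S : FrameSystem R)

/-- Rescaling of a frame system by an inverse `w` of `k`. -/
def scaled (w : R) (hw : w * S.k = 1) : ScaledSystem R :=
  have hVw : S.V w = 0 := by
    have h := congrArg S.V hw
    simp only [Derivation.leibniz, smul_eq_mul, S.Vk, Derivation.map_one_eq_zero] at h
    linear_combination w * h - S.V w * hw
  have hUw : S.U w = w * S.β + S.ε * S.κ * S.ν * S.a * w ^ 2 := by
    have h := congrArg S.U hw
    simp only [Derivation.leibniz, smul_eq_mul, S.Uk, Derivation.map_one_eq_zero] at h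
    linear_combination w * h - (S.U w - w * S.β) * hw
  have hα : S.α = -S.ε * S.κ * S.ν * S.b * w := by
    linear_combination w * S.kα - S.α * hw
  have hVβ : S.V S.β = S.ε * S.κ * S.a * S.b + 2 * S.α * S.β +
      w * S.ε * S.κ * S.α * S.ν * S.a := by
    linear_combination w * S.k_Vβ - (S.V S.β - S.ε * S.κ * S.a * S.b - 2 * S.α * S.β) * hw
  have hVα : S.V S.α = S.ε * S.κ * S.b ^ 2 + S.ε * S.κ * S.ν * w * S.β * S.a -
      S.κ * S.ν ^ 2 := by
    rw [hα]
    simp only [map_neg, Derivation.leibniz, smul_eq_mul, hVw, S.Vε, S.Vκ, S.Vb, S.Vν,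
      neg_mul]
    linear_combination (S.ε * S.κ * S.b ^ 2 - S.ε * S.ε * S.κ * S.ν ^ 2) * hw -
      S.κ * S.ν ^ 2 * S.εε
  { U := w • S.U
    V := w • S.V
    ε := S.ε
    σ := S.ε * S.κ * w ^ 2
    ν := S.ν
    a := S.a
    b := S.b
    y := w * S.β
    comm := fun f => by
      simp only [Derivation.smul_apply, smul_eq_mul, Derivation.leibniz, hVw, hUw, S.comm]
      rw [hα]
      ring
    Uε := by simp [S.Uε]
    Vε := by simp [S.Vε]
    εε := S.εε
    norm := S.norm
    Uσ := by
      simp only [Derivation.smul_apply, smul_eq_mul, Derivation.leibniz, Derivation.leibniz_pow,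
        nsmul_eq_mul, hUw, S.Uε, S.Uκ]
      push_cast
      ring
    Vσ := by
      simp only [Derivation.smul_apply, smul_eq_mul, Derivation.leibniz, Derivation.leibniz_pow,
        nsmul_eq_mul, hVw, S.Vε, S.Vκ]
      ring
    Uν := by simp [S.Uν]
    Vν := by
      simp only [Derivation.smul_apply, smul_eq_mul, S.Vν]
      linear_combination -S.b * hw
    Ua := by
      simp only [Derivation.smul_apply, smul_eq_mul, S.Ua, hα]
      ring
    Ub := by
      simp only [Derivation.smul_apply, smul_eq_mul, S.Ub, hα]
      ring
    Va := by
      simp only [Derivation.smul_apply, smul_eq_mul, S.Va]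
      ring
    Vb := by
      simp only [Derivation.smul_apply, smul_eq_mul, S.Vb]
      linear_combination S.ε * S.ν * hw
    Uy := by
      have h := S.gauss
      rw [hVα, hα] at h
      simp only [Derivation.smul_apply, smul_eq_mul, Derivation.leibniz, hUw]
      linear_combination w ^ 2 * h + 2 * S.κ * S.ν ^ 2 * w ^ 2 * S.εε
    Vy := by
      simp only [Derivation.smul_apply, smul_eq_mul, Derivation.leibniz, hVw, hVβ, hα]
      ring }

end FrameSystem

/-! ### The integrability condition -/

namespace ScaledSystem

variable {R : Type*} [CommRing R] (S : ScaledSystem R)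

/-- The integrability condition of the two equations for `y`, from the commutator of `U` and `V`. -/
theorem integrability : 2 * S.σ * S.b * (-3 * S.ε * S.ν + 3 * S.a * S.y + 4 * S.ε * S.σ * S.ν ^ 3
    - 3 * S.σ * S.ν * S.b ^ 2 - 3 * S.ν * S.y ^ 2 - 6 * S.σ * S.ν ^ 2 * S.a * S.y
    - S.σ ^ 2 * S.ν ^ 3 * S.a ^ 2 + 2 * S.σ ^ 2 * S.ν ^ 3 * S.b ^ 2) = 0 := by
  have h := S.comm S.y
  rw [S.Uy, S.Vy] at h
  have h2 : ∀ D : Derivation ℤ R R, D 2 = 0 := fun D => by simpa using D.map_natCast 2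
  simp only [map_sub, map_add, Derivation.leibniz, Derivation.leibniz_pow, nsmul_eq_mul,
    smul_eq_mul, h2, S.Vε, S.Uσ, S.Vσ, S.Uν, S.Vν, S.Ua, S.Va, S.Ub, S.Vb, S.Uy, S.Vy] at h
  push_cast at h
  linear_combination h

/-- An odd polynomial of degree `7` with constant coefficients in a function of derivative `1`
vanishes only if its leading coefficient does: differentiate it seven times. -/
theorem leading_coeff_eq_zero [Algebra ℝ R] (d : Derivation ℤ R R) {x q₁ q₃ q₅ q₇ : R}
    (hx : d x = 1) (h₁ : d q₁ = 0) (h₃ : d q₃ = 0) (h₅ : d q₅ = 0) (h₇ : d q₇ = 0)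
    (h : q₁ * x + q₃ * x ^ 3 + q₅ * x ^ 5 + q₇ * x ^ 7 = 0) : q₇ = 0 := by
  have hn : ∀ n : ℕ, d (n : R) = 0 := fun n => d.map_natCast n
  have h6 : d 6 = 0 := by simpa using hn 6
  have h20 : d 20 = 0 := by simpa using hn 20
  have h42 : d 42 = 0 := by simpa using hn 42
  have D1 : q₁ + q₃ * (3 * x ^ 2) + q₅ * (5 * x ^ 4) + q₇ * (7 * x ^ 6) = 0 := by
    have e := congrArg d h
    simpa [Derivation.leibniz, Derivation.leibniz_pow, hx, h₁, h₃, h₅, h₇] using e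
  have D2 : 6 * q₃ * x + 20 * q₅ * x ^ 3 + 42 * q₇ * x ^ 5 = 0 := by
    have e := congrArg d D1
    have h3 : d 3 = 0 := by simpa using hn 3
    have h5 : d 5 = 0 := by simpa using hn 5
    have h7 : d 7 = 0 := by simpa using hn 7
    simp [Derivation.leibniz, Derivation.leibniz_pow, hx, h₁, h₃, h₅, h₇, h3, h5, h7] at e
    linear_combination e
  have D3 : 6 * q₃ + 60 * q₅ * x ^ 2 + 210 * q₇ * x ^ 4 = 0 := by
    have e := congrArg d D2
    simp [Derivation.leibniz, Derivation.leibniz_pow, hx, h₃, h₅, h₇, h6, h20, h42] at e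
    linear_combination e
  have D4 : 120 * q₅ * x + 840 * q₇ * x ^ 3 = 0 := by
    have e := congrArg d D3
    have h60 : d 60 = 0 := by simpa using hn 60
    have h210 : d 210 = 0 := by simpa using hn 210
    simp [Derivation.leibniz, Derivation.leibniz_pow, hx, h₃, h₅, h₇, h6, h60, h210] at e
    linear_combination e
  have D5 : 120 * q₅ + 2520 * q₇ * x ^ 2 = 0 := by
    have e := congrArg d D4
    have h120 : d 120 = 0 := by simpa using hn 120
    have h840 : d 840 = 0 := by simpa using hn 840
    simp [Derivation.leibniz, Derivation.leibniz_pow, hx, h₅, h₇, h120, h840] at e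
    linear_combination e
  have h5040 : d 5040 = 0 := by simpa using hn 5040
  have D6 : 5040 * q₇ * x = 0 := by
    have e := congrArg d D5
    have h120 : d 120 = 0 := by simpa using hn 120
    have h2520 : d 2520 = 0 := by simpa using hn 2520
    simp [Derivation.leibniz, Derivation.leibniz_pow, hx, h₅, h₇, h120, h2520] at e
    linear_combination e
  have D7 : 5040 * q₇ = 0 := by
    have e := congrArg d D6
    simpa [Derivation.leibniz, hx, h₇, h5040] using e
  have hc : algebraMap ℝ R (1 / 5040) * 5040 = 1 := by
    rw [show (5040 : R) = algebraMap ℝ R 5040 from (map_ofNat _ 5040).symm, ← map_mul]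
    norm_num
  linear_combination algebraMap ℝ R (1 / 5040) * D7 - q₇ * hc

/-- There is no scaled system in which `σ` and `b` are invertible. Along the second frame vector,
`σ` is constant, and with the angle function `ν` as parameter `p = y + σ ν a` and `r = a + ν p`
solve `x' = σ ν x`. The integrability condition is `3 p (r - 2 ν p) + P(ν) = 0` for a polynomial `P`
whose coefficients are constant along that vector, and applying `x ↦ x' - 2 σ ν x` twice removes the
first term but not the second. -/
theorem one_eq_zero [Algebra ℝ R] {σ' b' : R} (hσ : S.σ * σ' = 1) (hb : S.b * b' = 1) :
    (1 : R) = 0 := by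
  have hn : ∀ (D : Derivation ℤ R R) (n : ℕ), D (n : R) = 0 := fun D n => D.map_natCast n
  -- the derivation `d` is the derivative with respect to `ν` along the second frame vector
  obtain ⟨d, hd⟩ : ∃ d : Derivation ℤ R R, ∀ f, d f = -b' * S.V f :=
    ⟨(-b') • S.V, fun f => by simp⟩
  have dν : d S.ν = 1 := by rw [hd, S.Vν]; linear_combination hb
  have dσ : d S.σ = 0 := by rw [hd, S.Vσ, mul_zero]
  have dε : d S.ε = 0 := by rw [hd, S.Vε, mul_zero]
  obtain ⟨p, hp⟩ : ∃ p, p = S.y + S.σ * S.ν * S.a := ⟨_, rfl⟩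
  obtain ⟨r, hr⟩ : ∃ r, r = S.a + S.ν * p := ⟨_, rfl⟩
  have da : d S.a = -S.y := by rw [hd, S.Va]; linear_combination -S.y * hb
  have dy : d S.y = -(S.σ * S.a - 2 * S.σ * S.ν * S.y - S.σ ^ 2 * S.ν ^ 2 * S.a) := by
    rw [hd, S.Vy]
    linear_combination -(S.σ * S.a - 2 * S.σ * S.ν * S.y - S.σ ^ 2 * S.ν ^ 2 * S.a) * hb
  have dp : d p = S.σ * S.ν * p := by
    rw [hp]
    simp only [map_add, Derivation.leibniz, smul_eq_mul, dy, da, dσ, dν]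
    ring
  have dr : d r = S.σ * S.ν * r := by
    rw [hr]
    simp only [map_add, Derivation.leibniz, smul_eq_mul, dp, da, dν]
    rw [hp]
    ring
  have h2 : d 2 = 0 := by simpa using hn d 2
  have h3 : d 3 = 0 := by simpa using hn d 3
  have h7 : d 7 = 0 := by simpa using hn d 7
  have hu : algebraMap ℝ R (1 / 2) * 2 = 1 := by
    rw [show (2 : R) = algebraMap ℝ R 2 from (map_ofNat _ 2).symm, ← map_mul]
    norm_num
  have E0 : 3 * p * r - 6 * S.ν * p ^ 2 + S.ε * (-3 * (1 + S.σ) * S.ν +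
      (7 * S.σ + 2 * S.σ ^ 2) * S.ν ^ 3 - 2 * S.σ ^ 2 * S.ν ^ 5) = 0 := by
    have h := S.integrability
    have h' := congrArg (fun x => algebraMap ℝ R (1 / 2) * σ' * b' * x) h
    simp only [mul_zero] at h'
    have hN := S.norm
    have hε := S.εε
    have hb2 : S.b ^ 2 = S.ε - S.ε * S.ν ^ 2 - S.a ^ 2 := by
      linear_combination S.ε * hN - (S.a ^ 2 + S.b ^ 2) * hε
    have hR : -3 * S.ε * S.ν + 3 * S.a * S.y + 4 * S.ε * S.σ * S.ν ^ 3
        - 3 * S.σ * S.ν * S.b ^ 2 - 3 * S.ν * S.y ^ 2 - 6 * S.σ * S.ν ^ 2 * S.a * S.y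
        - S.σ ^ 2 * S.ν ^ 3 * S.a ^ 2 + 2 * S.σ ^ 2 * S.ν ^ 3 * S.b ^ 2 = 0 := by
      generalize -3 * S.ε * S.ν + 3 * S.a * S.y + 4 * S.ε * S.σ * S.ν ^ 3
        - 3 * S.σ * S.ν * S.b ^ 2 - 3 * S.ν * S.y ^ 2 - 6 * S.σ * S.ν ^ 2 * S.a * S.y
        - S.σ ^ 2 * S.ν ^ 3 * S.a ^ 2 + 2 * S.σ ^ 2 * S.ν ^ 3 * S.b ^ 2 = x at h' ⊢
      generalize algebraMap ℝ R (1 / 2) = u at h' hu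
      linear_combination h' - S.σ * σ' * S.b * b' * x * hu - S.b * b' * x * hσ - x * hb
    rw [hb2] at hR
    rw [hr, hp]
    linear_combination hR
  have E1 : -6 * p ^ 2 + S.ε * (-3 * (1 + S.σ) + (27 * S.σ + 12 * S.σ ^ 2) * S.ν ^ 2 -
      (24 * S.σ ^ 2 + 4 * S.σ ^ 3) * S.ν ^ 4 + 4 * S.σ ^ 3 * S.ν ^ 6) = 0 := by
    have e := congrArg d E0
    have h6 : d 6 = 0 := by simpa using hn d 6
    simp only [map_add, map_sub, map_neg, Derivation.leibniz, Derivation.leibniz_pow, smul_eq_mul,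
      nsmul_eq_mul, dp, dr, dν, dσ, dε, h2, h3, h6, h7, Derivation.map_one_eq_zero, map_zero] at e
    push_cast at e
    linear_combination e - 2 * S.σ * S.ν * E0
  have E2 : (60 * S.σ + 30 * S.σ ^ 2) * S.ν + -(150 * S.σ ^ 2 + 40 * S.σ ^ 3) * S.ν ^ 3 +
      (72 * S.σ ^ 3 + 8 * S.σ ^ 4) * S.ν ^ 5 + (-8 * S.σ ^ 4) * S.ν ^ 7 = 0 := by
    have e := congrArg d E1
    have h4 : d 4 = 0 := by simpa using hn d 4
    have h6 : d 6 = 0 := by simpa using hn d 6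
    have h12 : d 12 = 0 := by simpa using hn d 12
    have h24 : d 24 = 0 := by simpa using hn d 24
    have h27 : d 27 = 0 := by simpa using hn d 27
    simp only [map_add, map_sub, map_neg, Derivation.leibniz, Derivation.leibniz_pow, smul_eq_mul,
      nsmul_eq_mul, dp, dν, dσ, dε, h3, h4, h6, h12, h24, h27,
      Derivation.map_one_eq_zero, map_zero] at e
    push_cast at e
    linear_combination S.ε * (e - 2 * S.σ * S.ν * E1) - ((60 * S.σ + 30 * S.σ ^ 2) * S.ν +
      -(150 * S.σ ^ 2 + 40 * S.σ ^ 3) * S.ν ^ 3 +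
      (72 * S.σ ^ 3 + 8 * S.σ ^ 4) * S.ν ^ 5 + (-8 * S.σ ^ 4) * S.ν ^ 7) * S.εε
  have dc : ∀ (n : ℕ) (m : ℕ), d ((n : R) * S.σ ^ m) = 0 := fun n m => by
    simp [Derivation.leibniz, Derivation.leibniz_pow, dσ]
  have c : ∀ (n : ℕ) (m : ℕ) (n' : ℕ) (m' : ℕ),
      d ((n : R) * S.σ ^ m + (n' : R) * S.σ ^ m') = 0 := fun n m n' m' => by
    rw [map_add, dc, dc, add_zero]
  have hl := leading_coeff_eq_zero d dν (by simpa using c 60 1 30 2)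
    (by rw [map_neg]; exact neg_eq_zero.2 (by simpa using c 150 2 40 3)) (by simpa using c 72 3 8 4)
    (by rw [neg_mul, map_neg]; exact neg_eq_zero.2 (by simpa using dc 8 4)) E2
  have h8 : algebraMap ℝ R (1 / 8) * 8 = 1 := by
    rw [show (8 : R) = algebraMap ℝ R 8 from (map_ofNat _ 8).symm, ← map_mul]
    norm_num
  have h4 : S.σ ^ 4 * σ' ^ 4 = 1 := by rw [← mul_pow, hσ, one_pow]
  linear_combination -algebraMap ℝ R (1 / 8) * σ' ^ 4 * hl - S.σ ^ 4 * σ' ^ 4 * h8 - h4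

end ScaledSystem

/-! ### The frame along the gradient of the mean curvature -/

namespace FrameSystem

variable {R : Type*} [CommRing R] (S : FrameSystem R)

/-- If `κ ≠ 0`, the function `b` cannot be invertible where `k` is. -/
theorem one_eq_zero [Algebra ℝ R] {κ' k' b' : R} (hκ : S.κ * κ' = 1) (hk : k' * S.k = 1)
    (hb : S.b * b' = 1) : (1 : R) = 0 :=
  (S.scaled k' hk).one_eq_zero (σ' := S.ε * κ' * S.k ^ 2)
    (by
      change S.ε * S.κ * k' ^ 2 * (S.ε * κ' * S.k ^ 2) = 1
      linear_combination S.κ * κ' * (k' * S.k) ^ 2 * S.εε + (k' * S.k) ^ 2 * hκ +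
        (k' * S.k + 1) * hk) hb

/-- If `b = 0`, then `a U k = -ε ν (k² + κ a²)`. -/
theorem a_mul_Uk (hb : S.b = 0) : S.a * S.U S.k = -S.ε * S.ν * (S.k ^ 2 + S.κ * S.a ^ 2) := by
  have h := S.Vb
  rw [hb, map_zero] at h
  rw [S.Uk]
  linear_combination -S.k * h

theorem a_mul_Uβ (hb : S.b = 0) : S.a * S.U S.β = S.ε * S.ν * S.U S.k := by
  have h := congrArg S.U S.Vb
  rw [hb, map_zero, map_zero] at h
  simp only [map_add, map_neg, neg_mul, Derivation.leibniz, smul_eq_mul, S.Uε, S.Uν, S.Ua, hb] at h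
  linear_combination h

/-- If `κ = 0`, then `U k = -y k²` with `y = β / k` constant. -/
theorem flat_case (hκ : S.κ = 0) {w : R} (hw : w * S.k = 1) :
    S.U (w * S.β) = 0 ∧ S.V (w * S.β) = 0 ∧ S.U S.k = -(w * S.β) * S.k ^ 2 := by
  have h1 := (S.scaled w hw).Uy
  have h2 := (S.scaled w hw).Vy
  change w * S.U (w * S.β) = S.ε * S.κ * w ^ 2 * S.b ^ 2 + 2 * (S.ε * S.κ * w ^ 2) * S.ν *
    (w * S.β) * S.a - 2 * S.ε * (S.ε * S.κ * w ^ 2) * S.ν ^ 2 -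
    (S.ε * S.κ * w ^ 2 * S.ν * S.b) ^ 2 at h1
  change w * S.V (w * S.β) = S.ε * S.κ * w ^ 2 * S.a * S.b - 2 * (S.ε * S.κ * w ^ 2) * S.ν *
    S.b * (w * S.β) - S.ε * S.κ * w ^ 2 * S.ν * S.b * (S.ε * S.κ * w ^ 2) * S.ν * S.a at h2
  have h3 := S.Uk
  rw [hκ] at h1 h2 h3
  refine ⟨?_, ?_, ?_⟩
  · linear_combination S.k * h1 - S.U (w * S.β) * hw
  · linear_combination S.k * h2 - S.V (w * S.β) * hw
  · linear_combination h3 + S.β * S.k * hw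

end FrameSystem

namespace SurfaceData

variable {R : Type*} [CommRing R] (S : SurfaceData R)

theorem dvec_smul_add (D D' : Derivation ℤ R R) (c s : R) (x : Fin 4 → R) :
    dvec (c • D + s • D') x = c • dvec D x + s • dvec D' x := rfl

theorem dvec_add (D : Derivation ℤ R R) (x y : Fin 4 → R) :
    dvec D (x + y) = dvec D x + dvec D y := funext fun _ => map_add D _ _

theorem dvec_smul (D : Derivation ℤ R R) (c : R) (x : Fin 4 → R) :
    dvec D (c • x) = c • dvec D x + D c • x := by
  funext i
  simp only [dvec, Pi.smul_apply, Pi.add_apply, smul_eq_mul, Derivation.leibniz]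
  ring

theorem B_lin_left (c s : R) (x y z : Fin 4 → R) :
    S.B (c • x + s • y) z = c * S.B x z + s * S.B y z := by
  simp only [B, diagForm_add_left, diagForm_smul_left]

theorem B_lin_right (c s : R) (x y z : Fin 4 → R) :
    S.B z (c • x + s • y) = c * S.B z x + s * S.B z y := by
  simp only [B, diagForm_add_right, diagForm_smul_right]

theorem dvec_F (c s : R) : dvec (c • S.U + s • S.V) S.F = c • S.FU + s • S.FV := rfl

theorem FUN : S.B S.FU S.N = 0 := S.UN
theorem FVN : S.B S.FV S.N = 0 := S.VN
theorem FUη : S.B S.FU S.η = 0 := S.UFη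
theorem FVη : S.B S.FV S.η = 0 := S.VFη

/-- The surface data in the orthonormal frame `c U + s V`, `-s U + c V`. -/
def rotate (c s : R) (h : S.E * (c ^ 2 + s ^ 2) = 1) : SurfaceData R where
  U := c • S.U + s • S.V
  V := (-s) • S.U + c • S.V
  half := S.half
  κ := S.κ
  ε := S.ε
  σ := S.σ
  lam := S.lam
  rho := S.rho
  E := 1
  E' := 1
  -- the commutator of the new frame is first expanded in `U`, `V`, and then in the new frame, whose
  -- Gram matrix is inverted by the factor `E`
  p :=
    S.E * (c * ((c ^ 2 + s ^ 2) * S.p - (c * S.U s + s * S.V s) - (-s * S.U c + c * S.V c)) +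
      s * ((c ^ 2 + s ^ 2) * S.q + (c * S.U c + s * S.V c) - (-s * S.U s + c * S.V s)))
  q :=
    S.E * (-s * ((c ^ 2 + s ^ 2) * S.p - (c * S.U s + s * S.V s) - (-s * S.U c + c * S.V c)) +
      c * ((c ^ 2 + s ^ 2) * S.q + (c * S.U c + s * S.V c) - (-s * S.U s + c * S.V s)))
  F := S.F
  N := S.N
  η := S.η
  two_half := S.two_half
  comm f := by
    simp only [Derivation.add_apply, Derivation.smul_apply, smul_eq_mul, map_add,
      Derivation.leibniz, map_neg, neg_mul, S.comm f]
    linear_combination -(((c ^ 2 + s ^ 2) * S.p - (c * S.U s + s * S.V s) -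
      (-s * S.U c + c * S.V c)) * S.U f + ((c ^ 2 + s ^ 2) * S.q + (c * S.U c + s * S.V c) -
      (-s * S.U s + c * S.V s)) * S.V f) * h
  Uκ := by simp [S.Uκ, S.Vκ]
  Vκ := by simp [S.Uκ, S.Vκ]
  Uε := by simp [S.Uε, S.Vε]
  Vε := by simp [S.Uε, S.Vε]
  Uσ := by simp [S.Uσ, S.Vσ]
  Vσ := by simp [S.Uσ, S.Vσ]
  εε := S.εε
  σσ := S.σσ
  lam_rho := S.lam_rho
  ηη := S.ηη
  η3 := S.η3
  Uη i hi := by simp [S.Uη i hi, S.Vη i hi]; ring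
  Vη i hi := by simp [S.Uη i hi, S.Vη i hi]; ring
  EE := one_mul 1
  UU := by
    change S.B _ _ = 1
    rw [S.dvec_F, B_lin_left, B_lin_right, B_lin_right]
    linear_combination c ^ 2 * S.FUU + s ^ 2 * S.FVV + c * s * (S.FUV + S.FVU) + h
  VV := by
    change S.B _ _ = 1
    rw [S.dvec_F, B_lin_left, B_lin_right, B_lin_right]
    linear_combination s ^ 2 * S.FUU + c ^ 2 * S.FVV - c * s * (S.FUV + S.FVU) + h
  UV := by
    change S.B _ _ = 0
    rw [S.dvec_F, S.dvec_F, B_lin_left, B_lin_right, B_lin_right]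
    linear_combination -s * c * S.FUU + s * c * S.FVV + c ^ 2 * S.FUV - s ^ 2 * S.FVU
  UN := by
    change S.B _ _ = 0
    rw [S.dvec_F, B_lin_left]
    linear_combination c * S.FUN + s * S.FVN
  VN := by
    change S.B _ _ = 0
    rw [S.dvec_F, B_lin_left]
    linear_combination -s * S.FUN + c * S.FVN
  NN := S.NN
  Nη := S.Nη
  UFη := by
    change S.B _ _ = 0
    rw [S.dvec_F, B_lin_left]
    linear_combination c * S.FUη + s * S.FVη
  VFη := by
    change S.B _ _ = 0
    rw [S.dvec_F, B_lin_left]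
    linear_combination -s * S.FUη + c * S.FVη

theorem second_form_lin (a b c s : R) :
    S.B (dvec (a • S.U + b • S.V) (dvec (c • S.U + s • S.V) S.F)) S.N =
      a * c * S.hUU + (a * s + b * c) * S.hUV + b * s * S.hVV := by
  have h1 : S.B (dvec S.U S.F) S.N = 0 := S.UN
  have h2 : S.B (dvec S.V S.F) S.N = 0 := S.VN
  have h3 := S.hVU
  simp only [FU] at h3
  simp only [dvec_smul_add, dvec_add, dvec_smul]
  simp only [B, diagForm_add_left, diagForm_smul_left, hUU, hVV, hUV, FU, FV] at *
  rw [h1, h2, h3]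
  ring

section Rotate

variable {c s : R} (h : S.E * (c ^ 2 + s ^ 2) = 1)

theorem rotate_hUU : (S.rotate c s h).hUU =
    c ^ 2 * S.hUU + 2 * c * s * S.hUV + s ^ 2 * S.hVV := by
  have h1 : (S.rotate c s h).hUU = _ := S.second_form_lin c s c s
  rw [h1]; ring

theorem rotate_hUV : (S.rotate c s h).hUV =
    -c * s * S.hUU + (c ^ 2 - s ^ 2) * S.hUV + c * s * S.hVV := by
  have h1 : (S.rotate c s h).hUV = _ := S.second_form_lin c s (-s) c
  rw [h1]; ring

theorem rotate_hVV : (S.rotate c s h).hVV =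
    s ^ 2 * S.hUU - 2 * c * s * S.hUV + c ^ 2 * S.hVV := by
  have h1 : (S.rotate c s h).hVV = _ := S.second_form_lin (-s) c (-s) c
  rw [h1]; ring

end Rotate

/-- A surface with holomorphic `Q` where `dH ≠ 0`: the gradient of `H` is in the kernel of the
second fundamental form, and `c U + s V` is a unit vector in the direction of the gradient. -/
structure GradientFrame (c s : R) : Prop where
  unit : S.E * (c ^ 2 + s ^ 2) = 1
  direction : c * S.V S.meanCurv = s * S.U S.meanCurv
  regular : ∃ x, x * (S.U S.meanCurv ^ 2 + S.V S.meanCurv ^ 2) = 1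
  ker_U : S.U S.meanCurv * S.hUU + S.V S.meanCurv * S.hUV = 0
  ker_V : S.U S.meanCurv * S.hUV + S.V S.meanCurv * S.hVV = 0

namespace GradientFrame

variable {S} {c s : R} (G : S.GradientFrame c s)

include G

theorem kernel : c * S.hUU + s * S.hUV = 0 ∧ c * S.hUV + s * S.hVV = 0 := by
  obtain ⟨x, hx⟩ := G.regular
  have hd := G.direction
  have h1 := G.ker_U
  have h2 := G.ker_V
  constructor
  · linear_combination -(c * S.hUU + s * S.hUV) * hx +
      x * (c * S.U S.meanCurv + s * S.V S.meanCurv) * h1 +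
      x * (S.V S.meanCurv * S.hUU - S.U S.meanCurv * S.hUV) * hd
  · linear_combination -(c * S.hUV + s * S.hVV) * hx +
      x * (c * S.U S.meanCurv + s * S.V S.meanCurv) * h2 +
      x * (S.V S.meanCurv * S.hUV - S.U S.meanCurv * S.hVV) * hd

theorem hVV_rotate : (S.rotate c s G.unit).hVV = 2 * S.meanCurv := by
  rw [rotate_hVV]
  linear_combination S.two_meanCurv * (c ^ 2 + s ^ 2) * (-1) + 2 * S.meanCurv * G.unit
    - c * G.kernel.1 - s * G.kernel.2

theorem V_meanCurv : (S.rotate c s G.unit).V S.meanCurv = 0 := by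
  change -s * S.U S.meanCurv + c * S.V S.meanCurv = 0
  linear_combination G.direction

theorem U_meanCurv_sq : S.E * (S.rotate c s G.unit).U S.meanCurv ^ 2 =
    S.U S.meanCurv ^ 2 + S.V S.meanCurv ^ 2 := by
  change S.E * (c * S.U S.meanCurv + s * S.V S.meanCurv) ^ 2 = _
  linear_combination (S.U S.meanCurv ^ 2 + S.V S.meanCurv ^ 2) * G.unit +
    S.E * (s * S.U S.meanCurv - c * S.V S.meanCurv) * G.direction

/-- The structure equations in the gradient frame. -/
noncomputable def frame : FrameSystem R :=
  (S.rotate c s G.unit).toFrameSystem rfl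
    (by rw [rotate_hUU]; linear_combination c * G.kernel.1 + s * G.kernel.2)
    (by rw [rotate_hUV]; linear_combination -s * G.kernel.1 + c * G.kernel.2)
    (by
      have h2 : (S.rotate c s G.unit).V 2 = 0 := by
        simpa using (S.rotate c s G.unit).V.map_natCast 2
      rw [G.hVV_rotate, Derivation.leibniz, G.V_meanCurv, h2]; simp)

theorem eq_zero_of_frame {f : R} (hU : G.frame.U f = 0) (hV : G.frame.V f = 0) :
    S.U f = 0 ∧ S.V f = 0 := by
  change c * S.U f + s * S.V f = 0 at hU
  change -s * S.U f + c * S.V f = 0 at hV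
  have h := G.unit
  constructor
  · linear_combination S.E * (c * hU - s * hV) - S.U f * h
  · linear_combination S.E * (s * hU + c * hV) - S.V f * h

theorem frame_k : G.frame.k = 2 * S.meanCurv := G.hVV_rotate

theorem frame_Uk : S.E * G.frame.U G.frame.k ^ 2 =
    4 * (S.U S.meanCurv ^ 2 + S.V S.meanCurv ^ 2) := by
  have h2 : G.frame.U 2 = 0 := by simpa using G.frame.U.map_natCast 2
  rw [frame_k, Derivation.leibniz, h2, smul_zero, add_zero, smul_eq_mul]
  have h := G.U_meanCurv_sq
  change S.E * G.frame.U S.meanCurv ^ 2 = _ at h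
  linear_combination 4 * h

/-- The derivative of the height along the level curves of `H` is not invertible where `H` is. -/
theorem one_eq_zero [Algebra ℝ R] {κ' H' b' : R} (hκ : S.κ * κ' = 1) (hH : H' * S.meanCurv = 1)
    (hb : (-s * S.tU + c * S.tV) * b' = 1) : (1 : R) = 0 :=
  G.frame.one_eq_zero hκ (k' := S.half * H')
    (by rw [frame_k]; linear_combination S.half * 2 * hH + S.two_half) hb

/-- If the height is constant along the level curves of `H`, then the angle function `ν` is
constant, and `|dH|²` is determined by `H` and `ν`; moreover `1 - ν²` divides `|dH|²`, so that it
has no zeros at regular points of `H`. -/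
theorem curved_case (hb : -s * S.tU + c * S.tV = 0) :
    S.U S.ν = 0 ∧ S.V S.ν = 0 ∧
      S.ε * (1 - S.ν ^ 2) * (4 * (S.U S.meanCurv ^ 2 + S.V S.meanCurv ^ 2)) =
        S.E * (S.ν ^ 2 * (4 * S.meanCurv ^ 2 + S.κ * S.ε * (1 - S.ν ^ 2)) ^ 2) ∧
      ∃ x, x * (1 - S.ν ^ 2) = S.U S.meanCurv ^ 2 + S.V S.meanCurv ^ 2 := by
  have hb' : G.frame.b = 0 := hb
  have hν := G.eq_zero_of_frame (f := S.ν) G.frame.Uν (by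
    have h := G.frame.Vν
    rwa [hb', mul_zero] at h)
  have hε : S.ε * S.ε = 1 := S.εε
  have ha : G.frame.a ^ 2 = S.ε * (1 - S.ν ^ 2) := by
    have h : S.ε * (G.frame.a ^ 2 + G.frame.b ^ 2) + S.ν ^ 2 = 1 := G.frame.norm
    rw [hb'] at h
    linear_combination S.ε * h - G.frame.a ^ 2 * hε
  have h1 : G.frame.a * G.frame.U G.frame.k =
      -S.ε * S.ν * (G.frame.k ^ 2 + S.κ * G.frame.a ^ 2) := G.frame.a_mul_Uk hb'
  have h2 : G.frame.a * G.frame.U G.frame.β = S.ε * S.ν * G.frame.U G.frame.k :=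
    G.frame.a_mul_Uβ hb'
  have hk := G.frame_k
  have hUk := G.frame_Uk
  refine ⟨hν.1, hν.2, ?_, ?_⟩
  · rw [← hUk]
    have h4 : S.ε * (1 - S.ν ^ 2) * G.frame.U G.frame.k ^ 2 =
        S.ν ^ 2 * (4 * S.meanCurv ^ 2 + S.κ * S.ε * (1 - S.ν ^ 2)) ^ 2 := by
      rw [hk, ← ha, ← mul_pow, ← hk, h1, ha, hk]
      linear_combination S.ν ^ 2 * (4 * S.meanCurv ^ 2 + S.κ * S.ε * (1 - S.ν ^ 2)) ^ 2 * hε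
    linear_combination S.E * h4
  · refine ⟨(S.U S.meanCurv ^ 2 + S.V S.meanCurv ^ 2) +
      S.half ^ 2 * S.E * S.ε * G.frame.U G.frame.β ^ 2, ?_⟩
    have h3 : S.ν ^ 2 * G.frame.U G.frame.k ^ 2 =
        S.ε * (1 - S.ν ^ 2) * G.frame.U G.frame.β ^ 2 := by
      rw [← ha, ← mul_pow, ← mul_pow, h2]
      linear_combination -(S.ν * G.frame.U G.frame.k) ^ 2 * hε
    linear_combination -S.half ^ 2 * S.E * h3 + S.half ^ 2 * S.ν ^ 2 * hUk +
      S.ν ^ 2 * (S.U S.meanCurv ^ 2 + S.V S.meanCurv ^ 2) * (2 * S.half + 1) * S.two_half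

/-- In flat space, `|dH|²` is a constant multiple of `H⁴`. -/
theorem flat_case (hκ : S.κ = 0) {H' : R} (hH : H' * S.meanCurv = 1) :
    ∃ j, S.U j = 0 ∧ S.V j = 0 ∧ 4 * (S.U S.meanCurv ^ 2 + S.V S.meanCurv ^ 2) =
      S.E * (j * (4 * S.meanCurv ^ 2) ^ 2) := by
  have hk := G.frame_k
  obtain ⟨h1, h2, h3⟩ := G.frame.flat_case hκ (w := S.half * H')
    (by rw [hk]; linear_combination S.half * 2 * hH + S.two_half)
  obtain ⟨h4, h5⟩ := G.eq_zero_of_frame h1 h2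
  refine ⟨(S.half * H' * G.frame.β) ^ 2, ?_, ?_, ?_⟩
  · rw [Derivation.leibniz_pow, h4]; simp
  · rw [Derivation.leibniz_pow, h5]; simp
  · rw [← G.frame_Uk, h3, hk]; ring

/-- In flat space, `H` divides `|dH|²`, so that `H` has no zeros at its regular points. -/
theorem flat_regular (hκ : S.κ = 0) :
    ∃ x, x * S.meanCurv = S.U S.meanCurv ^ 2 + S.V S.meanCurv ^ 2 := by
  have h := G.frame.Uk
  rw [show G.frame.κ = 0 from hκ, G.frame_k] at h
  have hUk := G.frame_Uk
  rw [G.frame_k, h] at hUk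
  refine ⟨S.E * G.frame.β ^ 2 * S.meanCurv, ?_⟩
  apply S.two_cancel
  apply S.two_cancel
  linear_combination hUk

end GradientFrame

end SurfaceData

/-! ### Propagation of critical points -/

/-- The squared norm of the differential of `H` at `z`, for the flat metric of `ℂ`. -/
noncomputable def gradSq (H : ℂ → ℝ) (z : ℂ) : ℝ := fderiv ℝ H z 1 ^ 2 + fderiv ℝ H z Complex.I ^ 2

theorem real_linear_apply {E : Type*} [NormedAddCommGroup E] [NormedSpace ℝ E] (L : ℂ →L[ℝ] E)
    (v : ℂ) : L v = v.re • L 1 + v.im • L Complex.I := by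
  conv_lhs => rw [show v = v.re • (1 : ℂ) + v.im • Complex.I by simp]
  rw [map_add, map_smul, map_smul]

theorem gradSq_eq_zero {H : ℂ → ℝ} {z : ℂ} : gradSq H z = 0 ↔ fderiv ℝ H z = 0 := by
  constructor
  · intro h
    simp only [gradSq] at h
    have h1 : fderiv ℝ H z 1 = 0 := by
      nlinarith [sq_nonneg (fderiv ℝ H z 1), sq_nonneg (fderiv ℝ H z Complex.I)]
    have h2 : fderiv ℝ H z Complex.I = 0 := by
      nlinarith [sq_nonneg (fderiv ℝ H z 1), sq_nonneg (fderiv ℝ H z Complex.I)]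
    ext v
    rw [real_linear_apply, h1, h2]
    simp
  · intro h
    simp [gradSq, h]

theorem sq_fderiv_apply_le (H : ℂ → ℝ) (z v : ℂ) :
    fderiv ℝ H z v ^ 2 ≤ ‖v‖ ^ 2 * gradSq H z := by
  rw [real_linear_apply, ← Complex.normSq_eq_norm_sq, Complex.normSq_apply, gradSq]
  simp only [smul_eq_mul]
  nlinarith [sq_nonneg (v.re * fderiv ℝ H z Complex.I - v.im * fderiv ℝ H z 1)]

theorem continuousOn_gradSq {B : Set ℂ} (hB : IsOpen B) {H : ℂ → ℝ} (hH : ContDiffOn ℝ ∞ H B) :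
    ContinuousOn (gradSq H) B :=
  ((contDiffOn_fderiv_apply hB hH 1).continuousOn.pow 2).add
    ((contDiffOn_fderiv_apply hB hH Complex.I).continuousOn.pow 2)

/-- If, away from its critical points, `|dH|² = E g (4 H² + δ)² / 4` with `g` and `δ` locally
constant, then either all or no points of a convex open set are critical. On a segment from a
critical point to a regular one, `4 H² + δ` would vanish at the last critical point, and hence
beyond it, by Grönwall's inequality. -/
theorem fderiv_eq_zero_of_rigid {B : Set ℂ} (hB : IsOpen B) (hconv : Convex ℝ B) {H E g δ : ℂ → ℝ}
    (hH : ContDiffOn ℝ ∞ H B) (hE : ContinuousOn E B) (hEpos : ∀ z ∈ B, 0 < E z)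
    (hg : ∀ z ∈ B, fderiv ℝ H z ≠ 0 → HasFDerivAt g (0 : ℂ →L[ℝ] ℝ) z)
    (hδ : ∀ z ∈ B, fderiv ℝ H z ≠ 0 → HasFDerivAt δ (0 : ℂ →L[ℝ] ℝ) z)
    (hkey : ∀ z ∈ B, fderiv ℝ H z ≠ 0 →
      4 * gradSq H z = E z * (g z * (4 * H z ^ 2 + δ z) ^ 2))
    {z₀ : ℂ} (hz₀ : z₀ ∈ B) (h₀ : fderiv ℝ H z₀ = 0) {x : ℂ} (hx : x ∈ B) : fderiv ℝ H x = 0 := by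
  by_contra hne
  set γ : ℝ → ℂ := fun s => z₀ + s • (x - z₀) with hγ
  have hγB : ∀ s ∈ Set.Icc (0 : ℝ) 1, γ s ∈ B := fun s hs =>
    hconv.add_smul_sub_mem hz₀ hx hs
  have hγd : ∀ s, HasDerivAt γ (x - z₀) s := fun s => by
    have h := ((hasDerivAt_id s).smul_const (x - z₀)).const_add z₀
    rwa [one_smul] at h
  have hγc : Continuous γ := by fun_prop
  have hγ1 : γ 1 = x := by simp [hγ]
  have hcg : ContinuousOn (fun s => gradSq H (γ s)) (Set.Icc 0 1) :=
    (continuousOn_gradSq hB hH).comp hγc.continuousOn hγB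
  -- the last critical point on the segment
  set Z : Set ℝ := Set.Icc 0 1 ∩ (fun s => gradSq H (γ s)) ⁻¹' {0} with hZ
  have hZc : IsCompact Z :=
    isCompact_Icc.of_isClosed_subset (hcg.preimage_isClosed_of_isClosed isClosed_Icc
      isClosed_singleton) Set.inter_subset_left
  have hZn : Z.Nonempty := ⟨0, by simp, by simp [hγ, gradSq_eq_zero, h₀]⟩
  obtain ⟨a, haZ, hamax⟩ := hZc.exists_isGreatest hZn
  have ha01 : a ∈ Set.Icc (0 : ℝ) 1 := haZ.1
  have hga : gradSq H (γ a) = 0 := haZ.2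
  have ha1 : a < 1 := lt_of_le_of_ne ha01.2 (by
    rintro rfl
    rw [hγ1, gradSq_eq_zero] at hga
    exact hne hga)
  have hreg : ∀ s ∈ Set.Ioc a 1, fderiv ℝ H (γ s) ≠ 0 := by
    intro s hs h
    have : s ∈ Z := ⟨⟨ha01.1.trans hs.1.le, hs.2⟩, gradSq_eq_zero.2 h⟩
    exact absurd (hamax this) (not_le.2 hs.1)
  have hsub : Set.Icc a 1 ⊆ Set.Icc 0 1 := Set.Icc_subset_Icc_left ha01.1
  have hconst : ∀ f : ℂ → ℝ, (∀ z ∈ B, fderiv ℝ H z ≠ 0 → HasFDerivAt f (0 : ℂ →L[ℝ] ℝ) z) →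
      ∀ s ∈ Set.Ioc a 1, f (γ s) = f x := by
    intro f hf s hs
    have hd : ∀ t ∈ Set.Icc s 1, HasDerivAt (f ∘ γ) 0 t := by
      intro t ht
      have h1 : t ∈ Set.Ioc a 1 := ⟨hs.1.trans_le ht.1, ht.2⟩
      simpa using (hf (γ t) (hγB t (hsub ⟨h1.1.le, h1.2⟩)) (hreg t h1)).comp_hasDerivAt t (hγd t)
    have h2 := constant_of_has_deriv_right_zero (f := f ∘ γ) (a := s) (b := 1)
      (fun t ht => (hd t ht).continuousAt.continuousWithinAt)
      (fun t ht => (hd t ⟨ht.1, ht.2.le⟩).hasDerivWithinAt) 1 ⟨hs.2, le_rfl⟩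
    simpa [hγ1] using h2.symm
  have hrel : ∀ s ∈ Set.Ioc a 1,
      4 * gradSq H (γ s) = E (γ s) * (g x * (4 * H (γ s) ^ 2 + δ x) ^ 2) := by
    intro s hs
    rw [hkey (γ s) (hγB s (hsub ⟨hs.1.le, hs.2⟩)) (hreg s hs), hconst g hg s hs, hconst δ hδ s hs]
  have hHc : ContinuousOn (fun s => H (γ s)) (Set.Icc 0 1) :=
    hH.continuousOn.comp hγc.continuousOn hγB
  have hEc : ContinuousOn (fun s => E (γ s)) (Set.Icc 0 1) :=
    hE.comp hγc.continuousOn hγB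
  have hgx : 0 < gradSq H x :=
    lt_of_le_of_ne (by unfold gradSq; positivity) fun h => hne (gradSq_eq_zero.1 h.symm)
  have hG : 0 < g x := by
    have h1 := hrel 1 ⟨ha1, le_rfl⟩
    rw [hγ1] at h1
    by_contra hG
    have h2 : g x * (4 * H x ^ 2 + δ x) ^ 2 ≤ 0 :=
      mul_nonpos_of_nonpos_of_nonneg (not_lt.1 hG) (sq_nonneg _)
    nlinarith [mul_nonneg (hEpos x hx).le (neg_nonneg.2 h2)]
  -- the relation extends to the last critical point by continuity
  have hrel' : ∀ s ∈ Set.Icc a 1,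
      4 * gradSq H (γ s) = E (γ s) * (g x * (4 * H (γ s) ^ 2 + δ x) ^ 2) := by
    have hcl : Set.Icc a 1 ⊆ closure (Set.Ioc a 1) := by rw [closure_Ioc ha1.ne]
    have hEq : Set.EqOn (fun s => 4 * gradSq H (γ s))
        (fun s => E (γ s) * (g x * (4 * H (γ s) ^ 2 + δ x) ^ 2)) (Set.Ioc a 1) := hrel
    refine hEq.of_subset_closure ?_ ?_ Set.Ioc_subset_Icc_self hcl
    · exact (continuousOn_const.mul hcg).mono hsub
    · exact (hEc.mul (continuousOn_const.mul
        (((continuousOn_const.mul (hHc.pow 2)).add continuousOn_const).pow 2))).mono hsub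
  set f : ℝ → ℝ := fun s => 4 * H (γ s) ^ 2 + δ x with hf
  have hfa : f a = 0 := by
    have h1 := hrel' a ⟨le_rfl, ha1.le⟩
    rw [hga, mul_zero] at h1
    have h2 : (4 * H (γ a) ^ 2 + δ x) ^ 2 = 0 := by
      rcases mul_eq_zero.1 h1.symm with h | h
      · exact absurd h (hEpos _ (hγB a ha01)).ne'
      · exact (mul_eq_zero.1 h).resolve_left hG.ne'
    exact pow_eq_zero_iff (two_ne_zero) |>.1 h2
  have hfd : ∀ s ∈ Set.Icc a 1,
      HasDerivAt f (8 * H (γ s) * fderiv ℝ H (γ s) (x - z₀)) s := by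
    intro s hs
    have h1 : HasDerivAt (fun s => H (γ s)) (fderiv ℝ H (γ s) (x - z₀)) s :=
      (differentiableAt_of_smooth hB hH (hγB s (hsub hs))).hasFDerivAt.comp_hasDerivAt s (hγd s)
    have h2 := ((h1.pow 2).const_mul 4).add_const (δ x)
    refine h2.congr_deriv ?_
    simp only [Nat.cast_ofNat]
    ring
  -- Grönwall's inequality for `f = 4 H² + δ`: its derivative is at most a multiple of `f`
  obtain ⟨K, hK⟩ := isCompact_Icc.exists_bound_of_continuousOn (s := Set.Icc a 1)
    (f := fun s => 8 * H (γ s) * (‖x - z₀‖ * Real.sqrt (E (γ s) * g x / 4)))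
    (((continuousOn_const.mul hHc).mul (continuousOn_const.mul
      ((hEc.mul continuousOn_const).div_const 4).sqrt)).mono hsub)
  have hbound : ∀ s ∈ Set.Ico a 1,
      ‖8 * H (γ s) * fderiv ℝ H (γ s) (x - z₀)‖ ≤ K * ‖f s‖ := by
    intro s hs
    have hs' : s ∈ Set.Icc a 1 := ⟨hs.1, hs.2.le⟩
    have hEs := hEpos _ (hγB s (hsub hs'))
    have h1 : |fderiv ℝ H (γ s) (x - z₀)| ≤
        ‖x - z₀‖ * Real.sqrt (E (γ s) * g x / 4) * |f s| := by
      apply abs_le_of_sq_le_sq _ (by positivity)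
      rw [mul_pow, mul_pow, Real.sq_sqrt (by positivity), sq_abs]
      refine (sq_fderiv_apply_le H (γ s) (x - z₀)).trans (le_of_eq ?_)
      linear_combination ‖x - z₀‖ ^ 2 / 4 * hrel' s hs'
    have h2 := hK s hs'
    rw [Real.norm_eq_abs, abs_mul] at h2 ⊢
    rw [abs_of_nonneg (by positivity : 0 ≤ ‖x - z₀‖ * Real.sqrt (E (γ s) * g x / 4))] at h2
    calc |8 * H (γ s)| * |fderiv ℝ H (γ s) (x - z₀)|
        ≤ |8 * H (γ s)| * (‖x - z₀‖ * Real.sqrt (E (γ s) * g x / 4) * |f s|) := by gcongr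
      _ = |8 * H (γ s)| * (‖x - z₀‖ * Real.sqrt (E (γ s) * g x / 4)) * |f s| := by ring
      _ ≤ K * ‖f s‖ := by rw [Real.norm_eq_abs]; gcongr
  have hf1 := eq_zero_of_abs_deriv_le_mul_abs_self_of_eq_zero_right
    (fun s hs => (hfd s hs).continuousAt.continuousWithinAt)
    (fun s hs => (hfd s ⟨hs.1, hs.2.le⟩).hasDerivWithinAt) hfa hbound 1 ⟨ha1.le, le_rfl⟩
  have h1 := hrel' 1 ⟨ha1.le, le_rfl⟩
  rw [show 4 * H (γ 1) ^ 2 + δ x = 0 from hf1, hγ1] at h1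
  nlinarith

/-! ### Surfaces in a coordinate domain -/

/-- The four linear coordinates of the ambient space. -/
noncomputable def coord : Fin 4 → Ambient →L[ℝ] ℝ :=
  ![(ContinuousLinearMap.proj 0).comp (ContinuousLinearMap.fst ℝ (Fin 3 → ℝ) ℝ),
    (ContinuousLinearMap.proj 1).comp (ContinuousLinearMap.fst ℝ (Fin 3 → ℝ) ℝ),
    (ContinuousLinearMap.proj 2).comp (ContinuousLinearMap.fst ℝ (Fin 3 → ℝ) ℝ),
    ContinuousLinearMap.snd ℝ (Fin 3 → ℝ) ℝ]

theorem coord_zero (x : Ambient) : coord 0 x = x.1 0 := rfl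
theorem coord_one (x : Ambient) : coord 1 x = x.1 1 := rfl
theorem coord_two (x : Ambient) : coord 2 x = x.1 2 := rfl
theorem coord_three (x : Ambient) : coord 3 x = x.2 := rfl

/-- The sign of the third coordinate in the flat metric. -/
noncomputable def thirdSign (κ : ℝ) : ℝ := if κ < 0 then -1 else 1

theorem thirdSign_mul_self (κ : ℝ) : thirdSign κ * thirdSign κ = 1 := by
  unfold thirdSign; split_ifs <;> norm_num

/-- The normal of `M²(κ) × ℝ` at `(p, t)` in a normalization free of square roots: it is `p` if `κ ≠
0`, and the constant normal of the plane if `κ = 0`. -/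
noncomputable def quadricNormal (κ : ℝ) (x : Ambient) : Ambient :=
  (if κ = 0 then ![0, 0, 1] else x.1, 0)

theorem radius_pos {κ : ℝ} (hκ : κ ≠ 0) : 0 < radius κ := by
  refine Real.sqrt_pos.2 ?_
  rcases lt_or_gt_of_ne hκ with h | h
  · simpa [curvSign, sign_neg h] using div_pos_of_neg_of_neg neg_one_lt_zero h
  · simpa [curvSign, sign_pos h] using h

theorem curvSign_div_radius_sq {κ : ℝ} (hκ : κ ≠ 0) : curvSign κ / radius κ ^ 2 = κ := by
  have h1 : 0 < curvSign κ / κ := Real.sqrt_pos.1 (radius_pos hκ)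
  rw [radius, Real.sq_sqrt h1.le]
  have : curvSign κ ≠ 0 := fun h => by simp [h] at h1
  field_simp

/-- The coefficient `ϵ / r` of `Ψ²` absorbs the radius in the normalization of the second normal. -/
theorem curvSign_mul_ambientForm_productNormal (κ ε : ℝ) (x y : Ambient) :
    curvSign κ / radius κ * ambientForm κ ε x (productNormal κ y) =
      κ * ambientForm κ ε x (quadricNormal κ y) := by
  by_cases hκ : κ = 0
  · simp [curvSign, hκ]
  · have hr := (radius_pos hκ).ne'
    have : ambientForm κ ε x (productNormal κ y) =
        (radius κ)⁻¹ * ambientForm κ ε x (quadricNormal κ y) := by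
      simp only [ambientForm, productNormal, quadricNormal, hκ, if_false, flatForm, Pi.smul_apply,
        smul_eq_mul]
      ring
    rw [this]
    calc curvSign κ / radius κ * ((radius κ)⁻¹ * ambientForm κ ε x (quadricNormal κ y))
        = curvSign κ / radius κ ^ 2 * ambientForm κ ε x (quadricNormal κ y) := by field_simp
      _ = κ * ambientForm κ ε x (quadricNormal κ y) := by rw [curvSign_div_radius_sq hκ]

theorem ambientForm_quadricNormal_eq_zero {κ ε : ℝ} {x y : Ambient}
    (h : ambientForm κ ε x (productNormal κ y) = 0) :
    ambientForm κ ε x (quadricNormal κ y) = 0 := by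
  by_cases hκ : κ = 0
  · simpa [productNormal, quadricNormal, hκ] using h
  · have h1 := curvSign_mul_ambientForm_productNormal κ ε x y
    rw [h, mul_zero] at h1
    exact (mul_eq_zero.1 h1.symm).resolve_left hκ

/-- The mean curvature of a local surface. -/
noncomputable def localMeanCurvature (κ ε : ℝ) (F G : ℂ → Ambient) (z : ℂ) : ℝ :=
  (ambientForm κ ε (dU (dU F) z) (G z) + ambientForm κ ε (dV (dV F) z) (G z)) /
    (2 * ambientForm κ ε (dU F z) (dU F z))

/-- A conformal immersion with unit normal in a coordinate: `F` and `G` are the immersion and the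
normal field as functions on the open set `W` of `ℂ`. -/
structure LocalSurface (κ ε : ℝ) (W : Set ℂ) (F G : ℂ → Ambient) : Prop where
  isOpen : IsOpen W
  sign : ε * ε = 1
  smooth : ContDiffOn ℝ ∞ F W
  smooth_normal : ContDiffOn ℝ ∞ G W
  mem : ∀ z ∈ W, (F z).1 ∈ spaceForm κ
  pos : ∀ z ∈ W, 0 < ambientForm κ ε (dU F z) (dU F z)
  eq : ∀ z ∈ W, ambientForm κ ε (dV F z) (dV F z) = ambientForm κ ε (dU F z) (dU F z)
  orthogonal : ∀ z ∈ W, ambientForm κ ε (dU F z) (dV F z) = 0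
  unit : ∀ z ∈ W, ambientForm κ ε (G z) (G z) = ε
  tangent : ∀ z ∈ W, ambientForm κ ε (G z) (productNormal κ (F z)) = 0
  orthogonal_u : ∀ z ∈ W, ambientForm κ ε (dU F z) (G z) = 0
  orthogonal_v : ∀ z ∈ W, ambientForm κ ε (dV F z) (G z) = 0

theorem LocalSurface.mono {κ ε : ℝ} {W W' : Set ℂ} {F G : ℂ → Ambient}
    (L : LocalSurface κ ε W F G) (hW' : IsOpen W') (h : W' ⊆ W) : LocalSurface κ ε W' F G where
  isOpen := hW'
  sign := L.sign
  smooth := L.smooth.mono h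
  smooth_normal := L.smooth_normal.mono h
  mem z hz := L.mem z (h hz)
  pos z hz := L.pos z (h hz)
  eq z hz := L.eq z (h hz)
  orthogonal z hz := L.orthogonal z (h hz)
  unit z hz := L.unit z (h hz)
  tangent z hz := L.tangent z (h hz)
  orthogonal_u z hz := L.orthogonal_u z (h hz)
  orthogonal_v z hz := L.orthogonal_v z (h hz)

section Vectors

variable {W : Set ℂ}

/-- The derivative in the direction `v`, as a derivation over `ℤ`, as required by `SurfaceData`. -/
noncomputable def coordDeriv (hW : IsOpen W) (v : ℂ) :
    Derivation ℤ (smoothRing W) (smoothRing W) :=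
  (dirDeriv hW v).restrictScalars ℤ

theorem coordDeriv_toSmooth (hW : IsOpen W) (v : ℂ) (g : ℂ → ℝ) (hg : ContDiffOn ℝ ∞ g W) :
    coordDeriv hW v (toSmooth g hg) =
      toSmooth (fun z => fderiv ℝ g z v) (contDiffOn_fderiv_apply hW hg v) :=
  dirDeriv_toSmooth hW v g hg

theorem coordDeriv_algebraMap (hW : IsOpen W) (v : ℂ) (c : ℝ) :
    coordDeriv hW v (algebraMap ℝ (smoothRing W) c) = 0 :=
  (dirDeriv hW v).map_algebraMap c

/-- The coordinates of a smooth map to the ambient space, as a vector over the ring of smooth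
functions. -/
noncomputable def toVec (F : ℂ → Ambient) (hF : ContDiffOn ℝ ∞ F W) : Fin 4 → smoothRing W :=
  fun i => toSmooth (fun z => coord i (F z)) ((coord i).contDiff.comp_contDiffOn hF)

theorem dvec_toVec (hW : IsOpen W) (v : ℂ) (F : ℂ → Ambient) (hF : ContDiffOn ℝ ∞ F W) :
    dvec (coordDeriv hW v) (toVec F hF) =
      toVec (fun z => fderiv ℝ F z v) (contDiffOn_fderiv_apply hW hF v) := by
  funext i
  refine (coordDeriv_toSmooth hW v _ ((coord i).contDiff.comp_contDiffOn hF)).trans ?_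
  ext z
  change fderiv ℝ ((coord i) ∘ F) z v = coord i (fderiv ℝ F z v)
  rw [fderiv_comp _ (coord i).differentiableAt (differentiableAt_of_smooth hW hF z.2),
    ContinuousLinearMap.fderiv]
  rfl

theorem diagForm_toVec_apply (κ ε : ℝ) (F G : ℂ → Ambient) (hF : ContDiffOn ℝ ∞ F W)
    (hG : ContDiffOn ℝ ∞ G W) (z : W) :
    (diagForm (algebraMap ℝ (smoothRing W) (thirdSign κ)) (algebraMap ℝ (smoothRing W) ε)
      (toVec F hF) (toVec G hG)).1 z = ambientForm κ ε (F z) (G z) := rfl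

theorem contDiffOn_quadricNormal (κ : ℝ) {F : ℂ → Ambient} (hF : ContDiffOn ℝ ∞ F W) :
    ContDiffOn ℝ ∞ (fun z => quadricNormal κ (F z)) W := by
  by_cases hκ : κ = 0
  · simp only [quadricNormal, hκ, if_true]
    exact contDiffOn_const
  · simp only [quadricNormal, hκ, if_false]
    exact hF.fst.prodMk contDiffOn_const

theorem coordDeriv_quadricNormal {κ : ℝ} (hW : IsOpen W) (v : ℂ) {F : ℂ → Ambient}
    (hF : ContDiffOn ℝ ∞ F W) (i : Fin 4) (hi : i ≠ 3) :
    coordDeriv hW v (toVec (fun z => quadricNormal κ (F z)) (contDiffOn_quadricNormal κ hF) i) =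
      algebraMap ℝ (smoothRing W) (if κ = 0 then 0 else 1) * coordDeriv hW v (toVec F hF i) := by
  simp only [toVec, coordDeriv_toSmooth]
  ext z
  change fderiv ℝ (fun z => coord i (quadricNormal κ (F z))) z v =
    (if κ = 0 then 0 else 1) * fderiv ℝ (fun z => coord i (F z)) z v
  by_cases hκ : κ = 0
  · simp [quadricNormal, hκ]
  · have h : ∀ z, coord i (quadricNormal κ (F z)) = coord i (F z) := by
      intro z
      fin_cases i <;> first | exact absurd rfl hi | simp [coord, quadricNormal, hκ]
    simp [h, hκ]

end Vectors

namespace LocalSurface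

variable {κ ε : ℝ} {W : Set ℂ} {F G : ℂ → Ambient} (L : LocalSurface κ ε W F G)

include L

/-- The normal of `M²(κ) × ℝ` is orthogonal to the surface. -/
theorem tangent_quadricNormal (v : ℂ) {z : ℂ} (hz : z ∈ W) :
    ambientForm κ ε (fderiv ℝ F z v) (quadricNormal κ (F z)) = 0 := by
  have hd : DifferentiableAt ℝ F z := differentiableAt_of_smooth L.isOpen L.smooth hz
  have hc : ∀ i, HasFDerivAt (fun x => coord i (F x)) ((coord i).comp (fderiv ℝ F z)) z :=
    fun i => (coord i).hasFDerivAt.comp z hd.hasFDerivAt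
  by_cases hκ : κ = 0
  · have h1 : (fun x => coord 2 (F x)) =ᶠ[nhds z] fun _ => 0 :=
      eventuallyEq_of_eqOn L.isOpen (fun x hx => (L.mem x hx).2.2 hκ) hz
    have h2 : (fderiv ℝ F z v).1 2 = 0 := by
      have h3 := (hc 2).congr_of_eventuallyEq h1.symm
      have h4 := h3.unique (hasFDerivAt_const (0 : ℝ) z)
      exact congrArg (fun l : ℂ →L[ℝ] ℝ => l v) h4
    simp [ambientForm, flatForm, quadricNormal, hκ, h2]
  · have h1 : (fun x => flatForm κ (F x).1 (F x).1) =ᶠ[nhds z] fun _ => 1 / κ :=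
      eventuallyEq_of_eqOn L.isOpen (fun x hx => (L.mem x hx).1 hκ) hz
    have h2 := (((hc 0).mul (hc 0)).add ((hc 1).mul (hc 1))).add
      (((hc 2).mul (hc 2)).const_mul (thirdSign κ))
    have h3 := h2.congr_of_eventuallyEq (f₁ := fun x => flatForm κ (F x).1 (F x).1)
      Filter.EventuallyEq.rfl
    have h4 := (h3.congr_of_eventuallyEq h1.symm).unique (hasFDerivAt_const (1 / κ) z)
    have h5 := congrArg (fun l : ℂ →L[ℝ] ℝ => l v) h4
    simp only [add_apply, smul_apply,
      ContinuousLinearMap.comp_apply, smul_eq_mul, zero_apply,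
      coord_zero, coord_one, coord_two] at h5
    simp only [ambientForm, flatForm, quadricNormal, hκ, if_false, mul_zero, add_zero]
    change _ + thirdSign κ * _ = 0
    linear_combination h5 / 2

theorem quadricNormal_norm {z : ℂ} (hz : z ∈ W) :
    (if κ = 0 then 1 else κ) *
      ambientForm κ ε (quadricNormal κ (F z)) (quadricNormal κ (F z)) = 1 := by
  by_cases hκ : κ = 0
  · simp [ambientForm, flatForm, quadricNormal, hκ]
  · have h := (L.mem z hz).1 hκ
    simp only [ambientForm, quadricNormal, hκ, if_false, h]
    field_simp
    ring

/-- The squared norm `e^{2ω}` of the coordinate fields. -/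
noncomputable def normSq : smoothRing W :=
  diagForm (algebraMap ℝ (smoothRing W) (thirdSign κ)) (algebraMap ℝ (smoothRing W) ε)
    (dvec (coordDeriv L.isOpen 1) (toVec F L.smooth))
    (dvec (coordDeriv L.isOpen 1) (toVec F L.smooth))

theorem normSq_apply (z : W) : L.normSq.1 z = ambientForm κ ε (dU F z) (dU F z) := by
  rw [normSq, dvec_toVec, diagForm_toVec_apply]; rfl

theorem exists_inv_normSq : ∃ g, L.normSq * g = 1 :=
  exists_mul_eq_one _ fun z => by rw [L.normSq_apply]; exact (L.pos z z.2).ne'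

/-- The algebraic surface data of a local surface, for the coordinate derivatives. -/
noncomputable def data : SurfaceData (smoothRing W) where
  U := coordDeriv L.isOpen 1
  V := coordDeriv L.isOpen Complex.I
  half := algebraMap ℝ _ (1 / 2)
  κ := algebraMap ℝ _ κ
  ε := algebraMap ℝ _ ε
  σ := algebraMap ℝ _ (thirdSign κ)
  lam := algebraMap ℝ _ (if κ = 0 then 0 else 1)
  rho := algebraMap ℝ _ (if κ = 0 then 1 else κ)
  E := L.normSq
  E' := L.exists_inv_normSq.choose
  p := 0
  q := 0
  F := toVec F L.smooth
  N := toVec G L.smooth_normal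
  η := toVec (fun z => quadricNormal κ (F z)) (contDiffOn_quadricNormal κ L.smooth)
  two_half := by
    rw [show (2 : smoothRing W) = algebraMap ℝ _ 2 from (map_ofNat _ 2).symm, ← map_mul]
    norm_num
  comm f := by
    rw [zero_mul, zero_mul, add_zero, add_zero]
    exact dirDeriv_comm L.isOpen _ _ f
  Uκ := coordDeriv_algebraMap _ _ _
  Vκ := coordDeriv_algebraMap _ _ _
  Uε := coordDeriv_algebraMap _ _ _
  Vε := coordDeriv_algebraMap _ _ _
  Uσ := coordDeriv_algebraMap _ _ _
  Vσ := coordDeriv_algebraMap _ _ _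
  εε := by rw [← map_mul, L.sign, map_one]
  σσ := by rw [← map_mul, thirdSign_mul_self, map_one]
  lam_rho := by
    rw [← map_mul, ← map_mul]
    congr 1
    split_ifs with h <;> simp [h]
  ηη := by
    ext z
    exact L.quadricNormal_norm z.2
  η3 := rfl
  Uη i hi := coordDeriv_quadricNormal L.isOpen 1 L.smooth i hi
  Vη i hi := coordDeriv_quadricNormal L.isOpen Complex.I L.smooth i hi
  EE := by rw [mul_comm]; exact L.exists_inv_normSq.choose_spec
  UU := rfl
  VV := by
    ext z
    rw [L.normSq_apply, ← L.eq z z.2, dvec_toVec, diagForm_toVec_apply]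
    rfl
  UV := by
    ext z
    rw [dvec_toVec, dvec_toVec, diagForm_toVec_apply]
    exact L.orthogonal z z.2
  UN := by
    ext z
    rw [dvec_toVec, diagForm_toVec_apply]
    exact L.orthogonal_u z z.2
  VN := by
    ext z
    rw [dvec_toVec, diagForm_toVec_apply]
    exact L.orthogonal_v z z.2
  NN := by
    ext z
    exact L.unit z z.2
  Nη := by
    ext z
    exact ambientForm_quadricNormal_eq_zero (L.tangent z z.2)
  UFη := by
    ext z
    rw [dvec_toVec, diagForm_toVec_apply]
    exact L.tangent_quadricNormal 1 z.2
  VFη := by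
    ext z
    rw [dvec_toVec, diagForm_toVec_apply]
    exact L.tangent_quadricNormal Complex.I z.2

theorem data_hUU (z : W) : L.data.hUU.1 z = ambientForm κ ε (dU (dU F) z) (G z) := by
  simp only [SurfaceData.hUU, SurfaceData.FU, SurfaceData.B, data]
  rw [dvec_toVec, dvec_toVec, diagForm_toVec_apply]
  rfl

theorem data_hUV (z : W) : L.data.hUV.1 z = ambientForm κ ε (dU (dV F) z) (G z) := by
  simp only [SurfaceData.hUV, SurfaceData.FV, SurfaceData.B, data]
  rw [dvec_toVec, dvec_toVec, diagForm_toVec_apply]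
  rfl

theorem data_hVV (z : W) : L.data.hVV.1 z = ambientForm κ ε (dV (dV F) z) (G z) := by
  simp only [SurfaceData.hVV, SurfaceData.FV, SurfaceData.B, data]
  rw [dvec_toVec, dvec_toVec, diagForm_toVec_apply]
  rfl

theorem data_tU (z : W) : L.data.tU.1 z = (dU F z).2 := by
  have h := congrFun (dvec_toVec L.isOpen 1 F L.smooth) 3
  exact congrArg (fun f : smoothRing W => f.1 z) h

theorem data_tV (z : W) : L.data.tV.1 z = (dV F z).2 := by
  have h := congrFun (dvec_toVec L.isOpen Complex.I F L.smooth) 3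
  exact congrArg (fun f : smoothRing W => f.1 z) h

theorem data_meanCurv (z : W) : L.data.meanCurv.1 z = localMeanCurvature κ ε F G z := by
  have h := congrArg (fun f : smoothRing W => f.1 z) L.data.two_meanCurv
  change 2 * L.normSq.1 z * L.data.meanCurv.1 z = L.data.hUU.1 z + L.data.hVV.1 z at h
  rw [L.normSq_apply, L.data_hUU, L.data_hVV] at h
  have hp := (L.pos z z.2).ne'
  rw [localMeanCurvature, ← h]
  field_simp

theorem data_meanCurv_eq : ∃ h : ContDiffOn ℝ ∞ (localMeanCurvature κ ε F G) W,
    L.data.meanCurv = toSmooth (localMeanCurvature κ ε F G) h := by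
  refine ⟨(contDiffOn_extendZero L.data.meanCurv).congr fun z hz => ?_, ?_⟩
  · rw [extendZero_apply _ ⟨z, hz⟩, L.data_meanCurv]
  · ext z
    exact L.data_meanCurv z

theorem contDiffOn_localMeanCurvature : ContDiffOn ℝ ∞ (localMeanCurvature κ ε F G) W :=
  L.data_meanCurv_eq.choose

theorem data_U_meanCurv (z : W) :
    (L.data.U L.data.meanCurv).1 z = fderiv ℝ (localMeanCurvature κ ε F G) z 1 := by
  obtain ⟨h, e⟩ := L.data_meanCurv_eq
  rw [e]
  exact congrArg (fun f : smoothRing W => f.1 z) (coordDeriv_toSmooth L.isOpen 1 _ h)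

theorem data_V_meanCurv (z : W) :
    (L.data.V L.data.meanCurv).1 z = fderiv ℝ (localMeanCurvature κ ε F G) z Complex.I := by
  obtain ⟨h, e⟩ := L.data_meanCurv_eq
  rw [e]
  exact congrArg (fun f : smoothRing W => f.1 z) (coordDeriv_toSmooth L.isOpen Complex.I _ h)

/-- The second fundamental form of the second normal is determined by the height function. -/
theorem second_form_quadricNormal (z : W) :
    κ * ambientForm κ ε (dU (dU F) z) (quadricNormal κ (F z)) =
        -κ * (ambientForm κ ε (dU F z) (dU F z) - ε * (dU F z).2 ^ 2) ∧
      κ * ambientForm κ ε (dV (dV F) z) (quadricNormal κ (F z)) =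
        -κ * (ambientForm κ ε (dU F z) (dU F z) - ε * (dV F z).2 ^ 2) ∧
      κ * ambientForm κ ε (dU (dV F) z) (quadricNormal κ (F z)) =
        κ * ε * (dU F z).2 * (dV F z).2 := by
  have h1 := congrArg (fun f : smoothRing W => f.1 z) L.data.UFU_η
  have h2 := congrArg (fun f : smoothRing W => f.1 z) L.data.VFV_η
  have h3 := congrArg (fun f : smoothRing W => f.1 z) L.data.UFV_η
  change _ = -(if κ = 0 then 0 else 1) * (L.normSq.1 z - ε * L.data.tU.1 z ^ 2) at h1
  change _ = -(if κ = 0 then 0 else 1) * (L.normSq.1 z - ε * L.data.tV.1 z ^ 2) at h2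
  change _ = (if κ = 0 then 0 else 1) * ε * L.data.tU.1 z * L.data.tV.1 z at h3
  rw [L.normSq_apply, L.data_tU] at h1
  rw [L.normSq_apply, L.data_tV] at h2
  rw [L.data_tU, L.data_tV] at h3
  simp only [SurfaceData.FU, SurfaceData.FV, SurfaceData.B, data] at h1 h2 h3
  rw [dvec_toVec, dvec_toVec, diagForm_toVec_apply] at h1 h2 h3
  change ambientForm κ ε (dU (dU F) z) _ = _ at h1
  change ambientForm κ ε (dV (dV F) z) _ = _ at h2
  change ambientForm κ ε (dU (dV F) z) _ = _ at h3
  rw [h1, h2, h3]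
  by_cases hκ : κ = 0
  · simp [hκ]
  · simp only [hκ, if_false]
    refine ⟨by ring, by ring, by ring⟩

end LocalSurface

/-! ### Holomorphy of the quadratic differential -/

/-- The coefficient of `Q` for a local surface. -/
noncomputable def localQ (κ ε : ℝ) (F G : ℂ → Ambient) (z : ℂ) : ℂ :=
  2 * ((localMeanCurvature κ ε F G z : ℝ) : ℂ) *
    ((((ambientForm κ ε (dU (dU F) z) (G z) - ambientForm κ ε (dV (dV F) z) (G z)) / 2 : ℝ) : ℂ) -
      Complex.I * ((ambientForm κ ε (dU (dV F) z) (G z) : ℝ) : ℂ)) -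
    ((ε * (curvSign κ / radius κ) : ℝ) : ℂ) *
    ((((ambientForm κ ε (dU (dU F) z) (productNormal κ (F z)) -
      ambientForm κ ε (dV (dV F) z) (productNormal κ (F z))) / 2 : ℝ) : ℂ) -
      Complex.I * ((ambientForm κ ε (dU (dV F) z) (productNormal κ (F z)) : ℝ) : ℂ))

namespace LocalSurface

variable {κ ε : ℝ} {W : Set ℂ} {F G : ℂ → Ambient} (L : LocalSurface κ ε W F G)

include L

theorem localQ_eq (z : W) :
    localQ κ ε F G z = (L.data.reQ.1 z : ℂ) + (L.data.imQ.1 z : ℂ) * Complex.I := by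
  have hre : L.data.reQ.1 z = L.data.meanCurv.1 z * (L.data.hUU.1 z - L.data.hVV.1 z) -
    κ * (1 / 2) * (L.data.tU.1 z ^ 2 - L.data.tV.1 z ^ 2) := rfl
  have him : L.data.imQ.1 z = -2 * L.data.meanCurv.1 z * L.data.hUV.1 z +
    κ * (L.data.tU.1 z * L.data.tV.1 z) := rfl
  rw [hre, him, L.data_meanCurv, L.data_hUU, L.data_hUV, L.data_hVV, L.data_tU, L.data_tV]
  obtain ⟨h1, h2, h3⟩ := L.second_form_quadricNormal z
  rw [← curvSign_mul_ambientForm_productNormal] at h1 h2 h3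
  have hε := L.sign
  apply Complex.ext
  · simp only [localQ, Complex.sub_re, Complex.mul_re, Complex.add_re, Complex.ofReal_re,
      Complex.ofReal_im, Complex.I_re, Complex.I_im, Complex.re_ofNat, Complex.im_ofNat,
      Complex.mul_im, Complex.sub_im]
    linear_combination -ε / 2 * h1 + ε / 2 * h2 -
      κ / 2 * ((dU F z).2 ^ 2 - (dV F z).2 ^ 2) * hε
  · simp only [localQ, Complex.sub_re, Complex.mul_re, Complex.add_im, Complex.ofReal_re,
      Complex.ofReal_im, Complex.I_re, Complex.I_im, Complex.re_ofNat, Complex.im_ofNat,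
      Complex.mul_im, Complex.sub_im]
    linear_combination ε * h3 + κ * (dU F z).2 * (dV F z).2 * hε

/-- `Q` is holomorphic if and only if the gradient of the mean curvature lies in the kernel of the
second fundamental form. -/
theorem differentiableOn_localQ_iff : DifferentiableOn ℂ (localQ κ ε F G) W ↔
    L.data.U L.data.meanCurv * L.data.hUU + L.data.V L.data.meanCurv * L.data.hUV = 0 ∧
      L.data.U L.data.meanCurv * L.data.hUV + L.data.V L.data.meanCurv * L.data.hVV = 0 := by
  obtain ⟨g, hg, eg⟩ := exists_toSmooth L.data.reQ
  obtain ⟨g', hg', eg'⟩ := exists_toSmooth L.data.imQ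
  have hUg : L.data.U L.data.reQ = _ :=
    (congrArg L.data.U eg).trans (coordDeriv_toSmooth L.isOpen 1 g hg)
  have hVg : L.data.V L.data.reQ = _ :=
    (congrArg L.data.V eg).trans (coordDeriv_toSmooth L.isOpen Complex.I g hg)
  have hUg' : L.data.U L.data.imQ = _ :=
    (congrArg L.data.U eg').trans (coordDeriv_toSmooth L.isOpen 1 g' hg')
  have hVg' : L.data.V L.data.imQ = _ :=
    (congrArg L.data.V eg').trans (coordDeriv_toSmooth L.isOpen Complex.I g' hg')
  have hQ : ∀ z ∈ W, localQ κ ε F G z = (g z : ℂ) + (g' z : ℂ) * Complex.I := by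
    intro z hz
    rw [L.localQ_eq ⟨z, hz⟩, eg, eg']
    rfl
  have hd : ∀ z ∈ W, HasFDerivAt (localQ κ ε F G)
      (Complex.ofRealCLM.comp (fderiv ℝ g z) +
        (Complex.I • Complex.ofRealCLM).comp (fderiv ℝ g' z)) z := by
    intro z hz
    have h1 := (differentiableAt_of_smooth L.isOpen hg hz).hasFDerivAt
    have h2 := (differentiableAt_of_smooth L.isOpen hg' hz).hasFDerivAt
    have h3 := (Complex.ofRealCLM.hasFDerivAt.comp z h1).add
      ((Complex.I • Complex.ofRealCLM).hasFDerivAt.comp z h2)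
    refine h3.congr_of_eventuallyEq (eventuallyEq_of_eqOn L.isOpen (fun x hx => ?_) hz)
    rw [hQ x hx]
    simp [mul_comm]
  have h1 := L.data.cauchyRiemann_U rfl rfl
  have h2 := L.data.cauchyRiemann_V rfl rfl
  have key : DifferentiableOn ℂ (localQ κ ε F G) W ↔
      L.data.U L.data.reQ - L.data.V L.data.imQ = 0 ∧
        L.data.V L.data.reQ + L.data.U L.data.imQ = 0 := by
    have hpt : ∀ z (hz : z ∈ W), DifferentiableAt ℂ (localQ κ ε F G) z ↔
        fderiv ℝ g z 1 - fderiv ℝ g' z Complex.I = 0 ∧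
          fderiv ℝ g z Complex.I + fderiv ℝ g' z 1 = 0 := by
      intro z hz
      rw [differentiableAt_complex_iff_differentiableAt_real, (hd z hz).fderiv,
        and_iff_right (hd z hz).differentiableAt, Complex.ext_iff]
      simp
      constructor
      · rintro ⟨h1, h2⟩; constructor <;> linarith
      · rintro ⟨h1, h2⟩; constructor <;> linarith
    rw [hUg, hVg, hUg', hVg']
    constructor
    · intro h
      constructor
      · ext z
        exact ((hpt z z.2).1 ((h z z.2).differentiableAt (L.isOpen.mem_nhds z.2))).1
      · ext z
        exact ((hpt z z.2).1 ((h z z.2).differentiableAt (L.isOpen.mem_nhds z.2))).2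
    · rintro ⟨e1, e2⟩ z hz
      refine ((hpt z hz).2 ⟨?_, ?_⟩).differentiableWithinAt
      · exact congrArg (fun f : smoothRing W => f.1 ⟨z, hz⟩) e1
      · exact congrArg (fun f : smoothRing W => f.1 ⟨z, hz⟩) e2
  rw [key, h1, h2]
  constructor
  · rintro ⟨e1, e2⟩
    exact ⟨L.data.two_cancel (by rw [e1, mul_zero]),
      L.data.two_cancel (by linear_combination -e2)⟩
  · rintro ⟨e1, e2⟩
    exact ⟨by rw [e1, mul_zero], by linear_combination -2 * e2⟩

end LocalSurface

/-! ### The critical points of the mean curvature in a coordinate -/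

theorem hasFDerivAt_zero_of_deriv {W : Set ℂ} (hW : IsOpen W) {f : smoothRing W} {g : ℂ → ℝ}
    (hfg : ∀ z : W, f.1 z = g z) (hU : coordDeriv hW 1 f = 0) (hV : coordDeriv hW Complex.I f = 0)
    {z : ℂ} (hz : z ∈ W) : HasFDerivAt g (0 : ℂ →L[ℝ] ℝ) z := by
  have hg : ContDiffOn ℝ ∞ g W := (contDiffOn_extendZero f).congr fun x hx => by
    rw [extendZero_apply _ ⟨x, hx⟩, hfg]
  have e : f = toSmooth g hg := Subtype.ext (funext hfg)
  rw [e, coordDeriv_toSmooth] at hU hV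
  have h1 : fderiv ℝ g z 1 = 0 := congrArg (fun f : smoothRing W => f.1 ⟨z, hz⟩) hU
  have h2 : fderiv ℝ g z Complex.I = 0 := congrArg (fun f : smoothRing W => f.1 ⟨z, hz⟩) hV
  have h3 : fderiv ℝ g z = 0 := by
    rw [← gradSq_eq_zero, gradSq, h1, h2]; norm_num
  rw [← h3]
  exact (differentiableAt_of_smooth hW hg hz).hasFDerivAt

namespace LocalSurface

variable {κ ε : ℝ} {W : Set ℂ} {F G : ℂ → Ambient}

theorem contDiffOn_normSq (L : LocalSurface κ ε W F G) :
    ContDiffOn ℝ ∞ (fun z => ambientForm κ ε (dU F z) (dU F z)) W :=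
  (contDiffOn_extendZero L.normSq).congr fun z hz => by
    rw [extendZero_apply _ ⟨z, hz⟩, L.normSq_apply]

/-- The norm of the differential of the mean curvature, multiplied by `e^{2ω}`. -/
noncomputable def gradNorm (κ ε : ℝ) (F G : ℂ → Ambient) (z : ℂ) : ℝ :=
  Real.sqrt (ambientForm κ ε (dU F z) (dU F z) * gradSq (localMeanCurvature κ ε F G) z)

/-- The coefficient of `∂_u` in the normalized gradient of the mean curvature. -/
noncomputable def gradU (κ ε : ℝ) (F G : ℂ → Ambient) (z : ℂ) : ℝ :=
  fderiv ℝ (localMeanCurvature κ ε F G) z 1 / gradNorm κ ε F G z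

/-- The coefficient of `∂_v` in the normalized gradient of the mean curvature. -/
noncomputable def gradV (κ ε : ℝ) (F G : ℂ → Ambient) (z : ℂ) : ℝ :=
  fderiv ℝ (localMeanCurvature κ ε F G) z Complex.I / gradNorm κ ε F G z

theorem gradSq_pos {H : ℂ → ℝ} {z : ℂ} (h : fderiv ℝ H z ≠ 0) : 0 < gradSq H z :=
  lt_of_le_of_ne (by unfold gradSq; positivity) fun h' => h (gradSq_eq_zero.1 h'.symm)

/-- At regular points of the mean curvature, the normalized gradient is a gradient frame. -/
theorem gradientFrame (L : LocalSurface κ ε W F G) (hQ : DifferentiableOn ℂ (localQ κ ε F G) W)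
    (hne : ∀ z ∈ W, fderiv ℝ (localMeanCurvature κ ε F G) z ≠ 0) :
    ∃ (hU : ContDiffOn ℝ ∞ (gradU κ ε F G) W) (hV : ContDiffOn ℝ ∞ (gradV κ ε F G) W),
      L.data.GradientFrame (toSmooth _ hU) (toSmooth _ hV) := by
  have hH := L.contDiffOn_localMeanCurvature
  have hHU := contDiffOn_fderiv_apply L.isOpen hH 1
  have hHV := contDiffOn_fderiv_apply L.isOpen hH Complex.I
  have hpos : ∀ z ∈ W, 0 < ambientForm κ ε (dU F z) (dU F z) *
      gradSq (localMeanCurvature κ ε F G) z := fun z hz =>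
    mul_pos (L.pos z hz) (gradSq_pos (hne z hz))
  have hn : ContDiffOn ℝ ∞ (gradNorm κ ε F G) W :=
    (L.contDiffOn_normSq.mul ((hHU.pow 2).add (hHV.pow 2))).sqrt fun z hz => (hpos z hz).ne'
  have hn0 : ∀ z ∈ W, gradNorm κ ε F G z ≠ 0 := fun z hz => (Real.sqrt_pos.2 (hpos z hz)).ne'
  obtain ⟨k1, k2⟩ := L.differentiableOn_localQ_iff.1 hQ
  refine ⟨hHU.div hn hn0, hHV.div hn hn0, ?_, ?_, ?_, k1, k2⟩
  · ext z
    change L.normSq.1 z * (gradU κ ε F G z ^ 2 + gradV κ ε F G z ^ 2) = 1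
    have h1 : gradNorm κ ε F G z ^ 2 = _ := Real.sq_sqrt (hpos z z.2).le
    rw [L.normSq_apply, gradU, gradV, div_pow, div_pow, ← add_div, h1, gradSq, ← mul_div_assoc,
      div_self]
    exact (hpos z z.2).ne'
  · ext z
    change gradU κ ε F G z * (L.data.V L.data.meanCurv).1 z =
      gradV κ ε F G z * (L.data.U L.data.meanCurv).1 z
    rw [L.data_U_meanCurv, L.data_V_meanCurv, gradU, gradV]
    ring
  · obtain ⟨x, hx⟩ := exists_mul_eq_one (L.data.U L.data.meanCurv ^ 2 +
      L.data.V L.data.meanCurv ^ 2) (fun z => by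
        change (L.data.U L.data.meanCurv).1 z ^ 2 + (L.data.V L.data.meanCurv).1 z ^ 2 ≠ 0
        rw [L.data_U_meanCurv, L.data_V_meanCurv]
        exact (gradSq_pos (hne z z.2)).ne')
    exact ⟨x, by rw [mul_comm]; exact hx⟩

/-- The set of regular points of the mean curvature is open. -/
theorem isOpen_regular (L : LocalSurface κ ε W F G) :
    IsOpen (W ∩ {z | fderiv ℝ (localMeanCurvature κ ε F G) z ≠ 0}) := by
  have h := (L.contDiffOn_localMeanCurvature.fderiv_of_isOpen (m := ∞) L.isOpen
    (by simp)).continuousOn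
  exact h.isOpen_inter_preimage L.isOpen isOpen_compl_singleton

/-- The derivative of the height along the level curves of the mean curvature, up to a factor. -/
noncomputable def heightAlongLevel (κ ε : ℝ) (F G : ℂ → Ambient) (z : ℂ) : ℝ :=
  -gradV κ ε F G z * (dU F z).2 + gradU κ ε F G z * (dV F z).2

/-- If `κ ≠ 0`, the height is constant along the level curves of the mean curvature. -/
theorem heightAlongLevel_eq_zero (L : LocalSurface κ ε W F G)
    (hQ : DifferentiableOn ℂ (localQ κ ε F G) W) (hκ : κ ≠ 0)
    (hne : ∀ z ∈ W, fderiv ℝ (localMeanCurvature κ ε F G) z ≠ 0) {z : ℂ} (hz : z ∈ W) :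
    heightAlongLevel κ ε F G z = 0 := by
  by_contra hb
  obtain ⟨hU, hV, -⟩ := L.gradientFrame hQ hne
  have hbc : ContinuousOn (heightAlongLevel κ ε F G) W :=
    (hV.continuousOn.neg.mul (contDiffOn_fderiv_apply L.isOpen L.smooth 1).snd.continuousOn).add
      (hU.continuousOn.mul (contDiffOn_fderiv_apply L.isOpen L.smooth Complex.I).snd.continuousOn)
  have hW1 : IsOpen (W ∩ heightAlongLevel κ ε F G ⁻¹' {0}ᶜ) :=
    hbc.isOpen_inter_preimage L.isOpen isOpen_compl_singleton
  have hHc := L.contDiffOn_localMeanCurvature.continuousOn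
  have hW2 : IsOpen ((W ∩ heightAlongLevel κ ε F G ⁻¹' {0}ᶜ) ∩
      localMeanCurvature κ ε F G ⁻¹' {0}ᶜ) :=
    (hHc.mono Set.inter_subset_left).isOpen_inter_preimage hW1 isOpen_compl_singleton
  -- the mean curvature cannot vanish near `z`, since its differential does not
  obtain ⟨x, hx⟩ : ((W ∩ heightAlongLevel κ ε F G ⁻¹' {0}ᶜ) ∩
      localMeanCurvature κ ε F G ⁻¹' {0}ᶜ).Nonempty := by
    by_contra hemp
    apply hne z hz
    have h1 : localMeanCurvature κ ε F G =ᶠ[nhds z] fun _ => 0 :=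
      eventuallyEq_of_eqOn hW1 (fun x hx => by
        by_contra h
        exact hemp ⟨x, hx, h⟩) ⟨hz, hb⟩
    rw [h1.fderiv_eq]
    simp
  -- on the open set where both functions are nonzero they are units of the ring of smooth functions
  have hsub : (W ∩ heightAlongLevel κ ε F G ⁻¹' {0}ᶜ) ∩
      localMeanCurvature κ ε F G ⁻¹' {0}ᶜ ⊆ W := fun y hy => hy.1.1
  have L2 := L.mono hW2 hsub
  obtain ⟨hU2, hV2, G2⟩ := L2.gradientFrame (hQ.mono hsub) fun y hy => hne y (hsub hy)
  obtain ⟨H', hH'⟩ := exists_mul_eq_one L2.data.meanCurv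
    (fun y => by rw [L2.data_meanCurv]; exact y.2.2)
  obtain ⟨b', hb'⟩ := exists_mul_eq_one (-toSmooth _ hV2 * L2.data.tU + toSmooth _ hU2 * L2.data.tV)
    (fun y => by
      change -gradV κ ε F G y * L2.data.tU.1 y + gradU κ ε F G y * L2.data.tV.1 y ≠ 0
      rw [L2.data_tU, L2.data_tV]
      exact y.2.1.2)
  have h10 := G2.one_eq_zero (κ' := algebraMap ℝ _ κ⁻¹)
    (by
      change algebraMap ℝ _ κ * _ = 1
      rw [← map_mul, mul_inv_cancel₀ hκ, map_one])
    (by rw [mul_comm]; exact hH') hb'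
  exact one_ne_zero (congrArg (fun f : smoothRing _ => f.1 ⟨x, hx⟩) h10 : (1 : ℝ) = 0)

/-- The rigidity of the mean curvature of a surface with holomorphic `Q`: at regular points, `|dH|²`
is a function of `H`, up to locally constant parameters. -/
theorem exists_rigid (L : LocalSurface κ ε W F G)
    (hQ : DifferentiableOn ℂ (localQ κ ε F G) W)
    (hne : ∀ z ∈ W, fderiv ℝ (localMeanCurvature κ ε F G) z ≠ 0) :
    ∃ g δ : ℂ → ℝ, ∀ z ∈ W, HasFDerivAt g (0 : ℂ →L[ℝ] ℝ) z ∧ HasFDerivAt δ (0 : ℂ →L[ℝ] ℝ) z ∧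
      4 * gradSq (localMeanCurvature κ ε F G) z = ambientForm κ ε (dU F z) (dU F z) *
        (g z * (4 * localMeanCurvature κ ε F G z ^ 2 + δ z) ^ 2) := by
  obtain ⟨hU, hV, Gr⟩ := L.gradientFrame hQ hne
  by_cases hκ : κ = 0
  · have hκ' : L.data.κ = 0 := by
      change algebraMap ℝ _ κ = 0
      rw [hκ, map_zero]
    have hH0 : ∀ z, L.data.meanCurv.1 z ≠ 0 := by
      intro z h0
      obtain ⟨x, hx⟩ := Gr.flat_regular hκ'
      have h1 := congrArg (fun f : smoothRing W => f.1 z) hx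
      change x.1 z * L.data.meanCurv.1 z = (L.data.U L.data.meanCurv).1 z ^ 2 +
        (L.data.V L.data.meanCurv).1 z ^ 2 at h1
      rw [h0, mul_zero, L.data_U_meanCurv, L.data_V_meanCurv] at h1
      exact (gradSq_pos (hne z z.2)).ne h1
    obtain ⟨H', hH'⟩ := exists_mul_eq_one L.data.meanCurv hH0
    obtain ⟨j, hj1, hj2, hj3⟩ := Gr.flat_case hκ' (by rw [mul_comm]; exact hH')
    refine ⟨extendZero j.1, fun _ => 0, fun z hz => ⟨?_, hasFDerivAt_const 0 z, ?_⟩⟩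
    · exact hasFDerivAt_zero_of_deriv L.isOpen (fun x => (extendZero_apply j.1 x).symm) hj1 hj2 hz
    · have h1 := congrArg (fun f : smoothRing W => f.1 ⟨z, hz⟩) hj3
      change 4 * ((L.data.U L.data.meanCurv).1 ⟨z, hz⟩ ^ 2 +
        (L.data.V L.data.meanCurv).1 ⟨z, hz⟩ ^ 2) = L.normSq.1 ⟨z, hz⟩ * (j.1 ⟨z, hz⟩ *
          (4 * L.data.meanCurv.1 ⟨z, hz⟩ ^ 2) ^ 2) at h1
      rw [L.data_U_meanCurv, L.data_V_meanCurv, L.normSq_apply, L.data_meanCurv,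
        ← extendZero_apply j.1] at h1
      rw [add_zero]
      exact h1
  · obtain ⟨h1, h2, h3, x, hx⟩ := Gr.curved_case (by
      ext z
      change -gradV κ ε F G z * L.data.tU.1 z + gradU κ ε F G z * L.data.tV.1 z = 0
      rw [L.data_tU, L.data_tV]
      exact L.heightAlongLevel_eq_zero hQ hκ hne z.2)
    have hν : ∀ z ∈ W, HasFDerivAt (fun z => (G z).2) (0 : ℂ →L[ℝ] ℝ) z := fun z hz =>
      hasFDerivAt_zero_of_deriv L.isOpen (f := L.data.ν) (fun _ => rfl) h1 h2 hz
    have hν1 : ∀ z ∈ W, 1 - (G z).2 ^ 2 ≠ 0 := by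
      intro z hz h0
      have h4 := congrArg (fun f : smoothRing W => f.1 ⟨z, hz⟩) hx
      change x.1 ⟨z, hz⟩ * (1 - (G z).2 ^ 2) = (L.data.U L.data.meanCurv).1 ⟨z, hz⟩ ^ 2 +
        (L.data.V L.data.meanCurv).1 ⟨z, hz⟩ ^ 2 at h4
      rw [h0, mul_zero, L.data_U_meanCurv, L.data_V_meanCurv] at h4
      exact (gradSq_pos (hne z hz)).ne h4
    have hε0 : ε ≠ 0 := left_ne_zero_of_mul_eq_one L.sign
    have hcomp : ∀ f : ℝ → ℝ, ∀ z ∈ W, DifferentiableAt ℝ f (G z).2 →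
        HasFDerivAt (fun z => f (G z).2) (0 : ℂ →L[ℝ] ℝ) z := by
      intro f z hz hf
      have h4 := hf.hasFDerivAt.comp z (hν z hz)
      rwa [ContinuousLinearMap.comp_zero] at h4
    refine ⟨fun z => (G z).2 ^ 2 / (ε * (1 - (G z).2 ^ 2)), fun z => κ * ε * (1 - (G z).2 ^ 2),
      fun z hz => ⟨?_, ?_, ?_⟩⟩
    · exact hcomp (fun t => t ^ 2 / (ε * (1 - t ^ 2))) z hz
        (DifferentiableAt.div (by fun_prop) (by fun_prop) (mul_ne_zero hε0 (hν1 z hz)))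
    · exact hcomp (fun t => κ * ε * (1 - t ^ 2)) z hz (by fun_prop)
    · have h4 := congrArg (fun f : smoothRing W => f.1 ⟨z, hz⟩) h3
      change ε * (1 - (G z).2 ^ 2) * (4 * ((L.data.U L.data.meanCurv).1 ⟨z, hz⟩ ^ 2 +
        (L.data.V L.data.meanCurv).1 ⟨z, hz⟩ ^ 2)) = L.normSq.1 ⟨z, hz⟩ * ((G z).2 ^ 2 *
          (4 * L.data.meanCurv.1 ⟨z, hz⟩ ^ 2 + κ * ε * (1 - (G z).2 ^ 2)) ^ 2) at h4
      rw [L.data_U_meanCurv, L.data_V_meanCurv, L.normSq_apply, L.data_meanCurv] at h4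
      have h5 := hν1 z hz
      have h6 : 4 * gradSq (localMeanCurvature κ ε F G) z =
          (ε * (1 - (G z).2 ^ 2) * (4 * gradSq (localMeanCurvature κ ε F G) z)) /
            (ε * (1 - (G z).2 ^ 2)) := by
        field_simp
      rw [h6, gradSq, h4]
      ring

/-- In a convex coordinate domain, the critical points of the mean curvature of a surface with
holomorphic `Q` are all points or none. -/
theorem fderiv_eq_zero (L : LocalSurface κ ε W F G) (hQ : DifferentiableOn ℂ (localQ κ ε F G) W)
    (hconv : Convex ℝ W) {z₀ : ℂ} (hz₀ : z₀ ∈ W)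
    (h₀ : fderiv ℝ (localMeanCurvature κ ε F G) z₀ = 0) {z : ℂ} (hz : z ∈ W) :
    fderiv ℝ (localMeanCurvature κ ε F G) z = 0 := by
  have L0 := L.mono L.isOpen_regular Set.inter_subset_left
  obtain ⟨g, δ, h⟩ := L0.exists_rigid (hQ.mono Set.inter_subset_left) fun z hz => hz.2
  exact fderiv_eq_zero_of_rigid L.isOpen hconv L.contDiffOn_localMeanCurvature
    L.contDiffOn_normSq.continuousOn L.pos (fun z hz hr => (h z ⟨hz, hr⟩).1)
    (fun z hz hr => (h z ⟨hz, hr⟩).2.1) (fun z hz hr => (h z ⟨hz, hr⟩).2.2) hz₀ h₀ hz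

end LocalSurface

/-! ### Changes of coordinate -/

section ChartChange

variable {W W' : Set ℂ} {Y : ℂ → Ambient} {g : ℂ → ℂ}

theorem fderiv_comp_holomorphic {E : Type*} [NormedAddCommGroup E] [NormedSpace ℝ E] {Y : ℂ → E}
    {z : ℂ} (hY : DifferentiableAt ℝ Y (g z))
    (hg : DifferentiableAt ℂ g z) (v : ℂ) :
    fderiv ℝ (Y ∘ g) z v = fderiv ℝ Y (g z) (deriv g z * v) := by
  have h := hY.hasFDerivAt.comp z (hg.hasDerivAt.hasFDerivAt.restrictScalars ℝ)
  rw [h.fderiv]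
  simp [mul_comm]

/-- The second derivative of a composition with a holomorphic map. -/
theorem fderiv_fderiv_comp_holomorphic (hW : IsOpen W) (hW' : IsOpen W') (hY : ContDiffOn ℝ ∞ Y W')
    (hg : DifferentiableOn ℂ g W) (hm : Set.MapsTo g W W') {z : ℂ} (hz : z ∈ W) (v w : ℂ) :
    fderiv ℝ (fun x => fderiv ℝ (Y ∘ g) x v) z w =
      fderiv ℝ (fderiv ℝ Y) (g z) (deriv g z * w) (deriv g z * v) +
        fderiv ℝ Y (g z) (deriv (deriv g) z * w * v) := by
  have hgz : DifferentiableAt ℂ g z := (hg z hz).differentiableAt (hW.mem_nhds hz)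
  have hg2 : DifferentiableAt ℂ (deriv g) z :=
    ((hg.deriv hW) z hz).differentiableAt (hW.mem_nhds hz)
  have h1 : (fun x => fderiv ℝ (Y ∘ g) x v) =ᶠ[nhds z]
      fun x => fderiv ℝ Y (g x) (deriv g x * v) :=
    eventuallyEq_of_eqOn hW (fun x hx => fderiv_comp_holomorphic
      (differentiableAt_of_smooth hW' hY (hm hx))
      ((hg x hx).differentiableAt (hW.mem_nhds hx)) v) hz
  have hd : DifferentiableAt ℝ (fderiv ℝ Y) (g z) :=
    differentiableAt_of_smooth hW' (hY.fderiv_of_isOpen hW' (by simp)) (hm hz)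
  have h2 := hd.hasFDerivAt.comp z (hgz.hasDerivAt.hasFDerivAt.restrictScalars ℝ)
  have h3 := (hg2.hasDerivAt.mul_const v).hasFDerivAt.restrictScalars ℝ
  have h4 := h2.clm_apply h3
  simp only [Function.comp_apply] at h4
  rw [h1.fderiv_eq, h4.fderiv]
  simp only [add_apply, ContinuousLinearMap.comp_apply, ContinuousLinearMap.flip_apply]
  rw [add_comm]
  simp [mul_comm, mul_left_comm]

theorem fderiv_fderiv_apply (hW' : IsOpen W') (hY : ContDiffOn ℝ ∞ Y W') {w : ℂ} (hw : w ∈ W')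
    (a b : ℂ) : fderiv ℝ (fderiv ℝ Y) w a b = fderiv ℝ (fun x => fderiv ℝ Y x b) w a := by
  have hd : DifferentiableAt ℝ (fderiv ℝ Y) w :=
    differentiableAt_of_smooth hW' (hY.fderiv_of_isOpen hW' (by simp)) hw
  rw [fderiv_clm_apply hd (by fun_prop)]
  simp

theorem ambientForm_add_left (κ ε : ℝ) (x x' y : Ambient) :
    ambientForm κ ε (x + x') y = ambientForm κ ε x y + ambientForm κ ε x' y := by
  simp only [ambientForm, flatForm, Prod.fst_add, Prod.snd_add, Pi.add_apply]; ring

theorem ambientForm_smul_left (κ ε c : ℝ) (x y : Ambient) :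
    ambientForm κ ε (c • x) y = c * ambientForm κ ε x y := by
  simp only [ambientForm, flatForm, Prod.smul_fst, Prod.smul_snd, Pi.smul_apply, smul_eq_mul]; ring

/-- Under a holomorphic change of coordinate, the second fundamental form in the direction of a
vector orthogonal to the surface transforms as a quadratic form: the second derivative of the change
of coordinate only contributes tangential terms. -/
theorem second_form_comp (κ ε : ℝ) (hW : IsOpen W) (hW' : IsOpen W') (hY : ContDiffOn ℝ ∞ Y W')
    (hg : DifferentiableOn ℂ g W) (hm : Set.MapsTo g W W') {z : ℂ} (hz : z ∈ W) {n : Ambient}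
    (hn : ∀ v, ambientForm κ ε (fderiv ℝ Y (g z) v) n = 0) {p q A B C : ℝ}
    (hp : p = (deriv g z).re) (hq : q = (deriv g z).im)
    (hA : A = ambientForm κ ε (dU (dU Y) (g z)) n)
    (hB : B = ambientForm κ ε (dU (dV Y) (g z)) n)
    (hC : C = ambientForm κ ε (dV (dV Y) (g z)) n) :
    ambientForm κ ε (dU (dU (Y ∘ g)) z) n = p ^ 2 * A + 2 * p * q * B + q ^ 2 * C ∧
      ambientForm κ ε (dU (dV (Y ∘ g)) z) n = -p * q * A + (p ^ 2 - q ^ 2) * B + p * q * C ∧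
      ambientForm κ ε (dV (dV (Y ∘ g)) z) n = q ^ 2 * A - 2 * p * q * B + p ^ 2 * C := by
  have key : ∀ v w : ℂ, ambientForm κ ε (fderiv ℝ (fun x => fderiv ℝ (Y ∘ g) x v) z w) n =
      (deriv g z * w).re * (deriv g z * v).re * A + ((deriv g z * w).re * (deriv g z * v).im +
        (deriv g z * w).im * (deriv g z * v).re) * B +
        (deriv g z * w).im * (deriv g z * v).im * C := by
    intro v w
    have hgz := hm hz
    rw [fderiv_fderiv_comp_holomorphic hW hW' hY hg hm hz, ambientForm_add_left, hn, add_zero]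
    have e : ∀ a b : ℂ, fderiv ℝ (fderiv ℝ Y) (g z) a b =
        (a.re * b.re) • dU (dU Y) (g z) + (a.re * b.im + a.im * b.re) • dU (dV Y) (g z) +
          (a.im * b.im) • dV (dV Y) (g z) := by
      intro a b
      have e1 : fderiv ℝ (fderiv ℝ Y) (g z) 1 1 = dU (dU Y) (g z) :=
        fderiv_fderiv_apply hW' hY hgz 1 1
      have e2 : fderiv ℝ (fderiv ℝ Y) (g z) 1 Complex.I = dU (dV Y) (g z) :=
        fderiv_fderiv_apply hW' hY hgz 1 Complex.I
      have e3 : fderiv ℝ (fderiv ℝ Y) (g z) Complex.I 1 = dU (dV Y) (g z) :=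
        (fderiv_fderiv_apply hW' hY hgz Complex.I 1).trans
          (fderiv_fderiv_apply_comm hW' hY hgz 1 Complex.I)
      have e4 : fderiv ℝ (fderiv ℝ Y) (g z) Complex.I Complex.I = dV (dV Y) (g z) :=
        fderiv_fderiv_apply hW' hY hgz Complex.I Complex.I
      rw [real_linear_apply _ a]
      simp only [add_apply, smul_apply]
      rw [real_linear_apply _ b, real_linear_apply (fderiv ℝ (fderiv ℝ Y) (g z) Complex.I) b,
        e1, e2, e3, e4]
      module
    rw [e, ambientForm_add_left, ambientForm_add_left, ambientForm_smul_left, ambientForm_smul_left,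
      ambientForm_smul_left, ← hA, ← hB, ← hC]
  refine ⟨(key 1 1).trans ?_, (key Complex.I 1).trans ?_, (key Complex.I Complex.I).trans ?_⟩ <;>
  · simp only [mul_one, Complex.mul_I_re, Complex.mul_I_im, ← hp, ← hq]
    ring

end ChartChange

/-! ### The mean curvature and the quadratic differential on a Riemann surface -/

section Surface

variable {S : Type*} [TopologicalSpace S] [ChartedSpace ℂ S]

theorem holCharts_subset_real {φ : OpenPartialHomeomorph S ℂ} (hφ : φ ∈ holCharts S) :
    φ ∈ IsManifold.maximalAtlas 𝓘(ℝ, ℂ) ∞ S := by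
  intro e he
  have h := hφ e he
  have key : ∀ f : OpenPartialHomeomorph ℂ ℂ, f ∈ contDiffGroupoid ω 𝓘(ℂ) →
      f ∈ contDiffGroupoid ∞ 𝓘(ℝ, ℂ) := by
    intro f hf
    have h1 := contDiffGroupoid_le (I := 𝓘(ℂ)) (le_top : (∞ : WithTop ℕ∞) ≤ ω) hf
    have h2 := mem_groupoid_of_pregroupoid.1 h1
    exact mem_groupoid_of_pregroupoid.2
      ⟨ContDiffOn.restrict_scalars ℝ h2.1, ContDiffOn.restrict_scalars ℝ h2.2⟩
  exact ⟨key _ h.1, key _ h.2⟩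

theorem chartAt_mem_holCharts [IsManifold 𝓘(ℂ) ω S] (x : S) : chartAt ℂ x ∈ holCharts S :=
  IsManifold.chart_mem_maximalAtlas x

variable {κ ε : ℝ} {X N : S → Ambient}

/-- A conformal immersion with unit normal in a holomorphic coordinate. -/
theorem localSurface (hε : ε = 1 ∨ ε = -1) (hX : IsConformalImmersion κ ε X)
    (hN : IsUnitNormal κ ε X N) {φ : OpenPartialHomeomorph S ℂ} (hφ : φ ∈ holCharts S) :
    LocalSurface κ ε φ.target (X ∘ φ.symm) (N ∘ φ.symm) where
  isOpen := φ.open_target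
  sign := by rcases hε with rfl | rfl <;> norm_num
  smooth := contMDiffOn_iff_contDiffOn.1 (hX.smooth.comp_contMDiffOn
    (contMDiffOn_symm_of_mem_maximalAtlas (holCharts_subset_real hφ)))
  smooth_normal := contMDiffOn_iff_contDiffOn.1 (hN.smooth.comp_contMDiffOn
    (contMDiffOn_symm_of_mem_maximalAtlas (holCharts_subset_real hφ)))
  mem z _ := hX.mem _
  pos := hX.pos φ hφ
  eq := hX.eq φ hφ
  orthogonal := hX.orthogonal φ hφ
  unit z _ := hN.unit _
  tangent z _ := hN.tangent _
  orthogonal_u := hN.orthogonal_u φ hφ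
  orthogonal_v := hN.orthogonal_v φ hφ

/-- The change of coordinate between two holomorphic coordinates. -/
theorem differentiableOn_transition [IsManifold 𝓘(ℂ) ω S] {φ φ' : OpenPartialHomeomorph S ℂ}
    (hφ : φ ∈ holCharts S) (hφ' : φ' ∈ holCharts S) :
    DifferentiableOn ℂ (φ' ∘ φ.symm) (φ.symm ≫ₕ φ').source := by
  have h := IsManifold.compatible_of_mem_maximalAtlas hφ hφ'
  have h1 := (mem_groupoid_of_pregroupoid.1 h).1
  have h2 : ContDiffOn ℂ ω (φ' ∘ φ.symm) (φ.symm ≫ₕ φ').source := by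
    simpa [contDiffPregroupoid] using h1
  exact h2.differentiableOn (by simp)

/-- The transformation laws of the conformal factor and of the second fundamental form under a
change of holomorphic coordinate. Here `n` is an ambient vector orthogonal to the surface at the
point. -/
theorem transformation [IsManifold 𝓘(ℂ) ω S] (hε : ε = 1 ∨ ε = -1)
    (hX : IsConformalImmersion κ ε X) (hN : IsUnitNormal κ ε X N)
    {φ φ' : OpenPartialHomeomorph S ℂ} (hφ : φ ∈ holCharts S) (hφ' : φ' ∈ holCharts S) {x : S}
    (hx : x ∈ φ.source) (hx' : x ∈ φ'.source) {p q : ℝ}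
    (hp : p = (deriv (φ' ∘ φ.symm) (φ x)).re) (hq : q = (deriv (φ' ∘ φ.symm) (φ x)).im) :
    ambientForm κ ε (dU (X ∘ φ.symm) (φ x)) (dU (X ∘ φ.symm) (φ x)) =
        (p ^ 2 + q ^ 2) * ambientForm κ ε (dU (X ∘ φ'.symm) (φ' x)) (dU (X ∘ φ'.symm) (φ' x)) ∧
      ∀ n : S → Ambient, (∀ v, ambientForm κ ε (fderiv ℝ (X ∘ φ'.symm) (φ' x) v) (n x) = 0) →
        hUU κ ε X n φ (φ x) = p ^ 2 * hUU κ ε X n φ' (φ' x) +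
          2 * p * q * hUV κ ε X n φ' (φ' x) + q ^ 2 * hVV κ ε X n φ' (φ' x) ∧
        hUV κ ε X n φ (φ x) = -p * q * hUU κ ε X n φ' (φ' x) +
          (p ^ 2 - q ^ 2) * hUV κ ε X n φ' (φ' x) + p * q * hVV κ ε X n φ' (φ' x) ∧
        hVV κ ε X n φ (φ x) = q ^ 2 * hUU κ ε X n φ' (φ' x) -
          2 * p * q * hUV κ ε X n φ' (φ' x) + p ^ 2 * hVV κ ε X n φ' (φ' x) := by
  have L := localSurface hε hX hN hφ
  have L' := localSurface hε hX hN hφ'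
  have hW : IsOpen (φ.symm ≫ₕ φ').source := (φ.symm ≫ₕ φ').open_source
  have hg := differentiableOn_transition hφ hφ'
  have hz : φ x ∈ (φ.symm ≫ₕ φ').source := by
    simp [hx, hx']
  have hm : Set.MapsTo (φ' ∘ φ.symm) (φ.symm ≫ₕ φ').source φ'.target := by
    intro z hz
    exact φ'.map_source (by simpa using hz.2)
  have hgz : (φ' ∘ φ.symm) (φ x) = φ' x := by simp [hx]
  have hEq : Set.EqOn (X ∘ φ.symm) ((X ∘ φ'.symm) ∘ (φ' ∘ φ.symm)) (φ.symm ≫ₕ φ').source := by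
    intro z hz
    have h2 : φ.symm z ∈ φ'.source := by simpa using hz.2
    simp [h2]
  have hF : ∀ z ∈ (φ.symm ≫ₕ φ').source, fderiv ℝ (X ∘ φ.symm) z =
      fderiv ℝ ((X ∘ φ'.symm) ∘ (φ' ∘ φ.symm)) z := fun z hz =>
    (eventuallyEq_of_eqOn hW hEq hz).fderiv_eq
  have hF2 : ∀ v w, fderiv ℝ (fun y => fderiv ℝ (X ∘ φ.symm) y v) (φ x) w =
      fderiv ℝ (fun y => fderiv ℝ ((X ∘ φ'.symm) ∘ (φ' ∘ φ.symm)) y v) (φ x) w := fun v w => by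
    have h : (fun y => fderiv ℝ (X ∘ φ.symm) y v) =ᶠ[nhds (φ x)]
        fun y => fderiv ℝ ((X ∘ φ'.symm) ∘ (φ' ∘ φ.symm)) y v :=
      eventuallyEq_of_eqOn hW (fun z hz => by simp only [hF z hz]) hz
    rw [h.fderiv_eq]
  constructor
  · have h1 : dU (X ∘ φ.symm) (φ x) =
        p • dU (X ∘ φ'.symm) (φ' x) + q • dV (X ∘ φ'.symm) (φ' x) := by
      rw [dU, hF _ hz, fderiv_comp_holomorphic
        (differentiableAt_of_smooth L'.isOpen L'.smooth (hm hz))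
        ((hg _ hz).differentiableAt (hW.mem_nhds hz)), mul_one, real_linear_apply, hgz, ← hp, ← hq]
      rfl
    have hy : φ' x ∈ φ'.target := φ'.map_source hx'
    have h2 := L'.eq (φ' x) hy
    have h3 := L'.orthogonal (φ' x) hy
    rw [h1]
    simp only [ambientForm, flatForm, Prod.fst_add, Prod.snd_add, Prod.smul_fst, Prod.smul_snd,
      Pi.add_apply, Pi.smul_apply, smul_eq_mul] at h2 h3 ⊢
    linear_combination q ^ 2 * h2 + 2 * p * q * h3
  · intro n hn
    have h := second_form_comp κ ε hW L'.isOpen L'.smooth hg hm hz (n := n x)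
      (by rw [hgz]; exact hn) hp hq rfl rfl rfl
    rw [hgz] at h
    simp only [hUU, hUV, hVV, φ.left_inv hx, φ'.left_inv hx']
    have a1 : dU (dU (X ∘ φ.symm)) (φ x) = _ := hF2 1 1
    have a2 : dU (dV (X ∘ φ.symm)) (φ x) = _ := hF2 Complex.I 1
    have a3 : dV (dV (X ∘ φ.symm)) (φ x) = _ := hF2 Complex.I Complex.I
    rw [a1, a2, a3]
    exact h

theorem normal_orthogonal (hε : ε = 1 ∨ ε = -1)
    (hX : IsConformalImmersion κ ε X) (hN : IsUnitNormal κ ε X N)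
    {φ : OpenPartialHomeomorph S ℂ} (hφ : φ ∈ holCharts S) {x : S} (hx : x ∈ φ.source) (v : ℂ) :
    ambientForm κ ε (fderiv ℝ (X ∘ φ.symm) (φ x) v) (N x) = 0 := by
  have L := localSurface hε hX hN hφ
  have h1 := L.orthogonal_u (φ x) (φ.map_source hx)
  have h2 := L.orthogonal_v (φ x) (φ.map_source hx)
  simp only [Function.comp_apply, φ.left_inv hx] at h1 h2
  rw [real_linear_apply, ambientForm_add_left, ambientForm_smul_left, ambientForm_smul_left]
  change _ * ambientForm κ ε (dU _ _) _ + _ * ambientForm κ ε (dV _ _) _ = 0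
  rw [h1, h2]; ring

theorem ambientForm_productNormal_eq_zero {x y : Ambient}
    (h : ambientForm κ ε x (quadricNormal κ y) = 0) :
    ambientForm κ ε x (productNormal κ y) = 0 := by
  by_cases hκ : κ = 0
  · simpa [productNormal, quadricNormal, hκ] using h
  · have h1 := curvSign_mul_ambientForm_productNormal κ ε x y
    rw [h, mul_zero] at h1
    refine (mul_eq_zero.1 h1).resolve_left ?_
    have h2 := curvSign_div_radius_sq hκ
    intro h3
    apply hκ
    rw [← h2, pow_two, ← div_div, h3, zero_div]

theorem productNormal_orthogonal (hε : ε = 1 ∨ ε = -1)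
    (hX : IsConformalImmersion κ ε X) (hN : IsUnitNormal κ ε X N)
    {φ : OpenPartialHomeomorph S ℂ} (hφ : φ ∈ holCharts S) {x : S} (hx : x ∈ φ.source) (v : ℂ) :
    ambientForm κ ε (fderiv ℝ (X ∘ φ.symm) (φ x) v) (productNormal κ (X x)) = 0 := by
  have h := (localSurface hε hX hN hφ).tangent_quadricNormal v (φ.map_source hx)
  simp only [Function.comp_apply, φ.left_inv hx] at h
  exact ambientForm_productNormal_eq_zero h

variable [IsManifold 𝓘(ℂ) ω S]

/-- The mean curvature may be computed in any holomorphic coordinate. -/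
theorem meanCurvature_eq (hε : ε = 1 ∨ ε = -1)
    (hX : IsConformalImmersion κ ε X) (hN : IsUnitNormal κ ε X N)
    {φ : OpenPartialHomeomorph S ℂ} (hφ : φ ∈ holCharts S) {x : S} (hx : x ∈ φ.source) :
    meanCurvature κ ε X N x = localMeanCurvature κ ε (X ∘ φ.symm) (N ∘ φ.symm) (φ x) := by
  have hc := chartAt_mem_holCharts x
  have hxc := mem_chart_source ℂ x
  obtain ⟨h1, h2⟩ := transformation hε hX hN hc hφ hxc hx rfl rfl
  obtain ⟨h3, -, h4⟩ := h2 N (normal_orthogonal hε hX hN hφ hx)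
  have hpos := hX.pos _ hc _ (mem_chart_target ℂ x)
  have hpos' := hX.pos _ hφ _ (φ.map_source hx)
  rw [h1] at hpos
  have hg : (deriv (φ ∘ (chartAt ℂ x).symm) (chartAt ℂ x x)).re ^ 2 +
      (deriv (φ ∘ (chartAt ℂ x).symm) (chartAt ℂ x x)).im ^ 2 ≠ 0 := fun h => by simp [h] at hpos
  rw [meanCurvature, h1, h3, h4]
  change _ = (hUU κ ε X N φ (φ x) + hVV κ ε X N φ (φ x)) / _
  field_simp
  ring

theorem qCoeff_eq (hε : ε = 1 ∨ ε = -1)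
    (hX : IsConformalImmersion κ ε X) (hN : IsUnitNormal κ ε X N)
    {φ : OpenPartialHomeomorph S ℂ} (hφ : φ ∈ holCharts S) {z : ℂ} (hz : z ∈ φ.target) :
    qCoeff κ ε X N φ z = localQ κ ε (X ∘ φ.symm) (N ∘ φ.symm) z := by
  have h := meanCurvature_eq hε hX hN hφ (φ.map_target hz)
  rw [φ.right_inv hz] at h
  rw [qCoeff, h]
  rfl

theorem hopf_transformation (hε : ε = 1 ∨ ε = -1)
    (hX : IsConformalImmersion κ ε X) (hN : IsUnitNormal κ ε X N)
    {φ φ' : OpenPartialHomeomorph S ℂ} (hφ : φ ∈ holCharts S) (hφ' : φ' ∈ holCharts S) {x : S}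
    (hx : x ∈ φ.source) (hx' : x ∈ φ'.source) {n : S → Ambient}
    (hn : ∀ v, ambientForm κ ε (fderiv ℝ (X ∘ φ'.symm) (φ' x) v) (n x) = 0) :
    hopf κ ε X n φ (φ x) = hopf κ ε X n φ' (φ' x) * deriv (φ' ∘ φ.symm) (φ x) ^ 2 := by
  obtain ⟨h1, h2, h3⟩ := (transformation hε hX hN hφ hφ' hx hx' rfl rfl).2 n hn
  rw [hopf, hopf, h1, h2, h3]
  generalize deriv (φ' ∘ φ.symm) (φ x) = d
  apply Complex.ext
  · simp [pow_two]
    ring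
  · simp [pow_two]
    ring

theorem isQuadraticDifferential_qCoeff (hε : ε = 1 ∨ ε = -1)
    (hX : IsConformalImmersion κ ε X) (hN : IsUnitNormal κ ε X N) :
    IsQuadraticDifferential (qCoeff κ ε X N) (S := S) := by
  intro φ hφ φ' hφ' x hx
  rw [qCoeff, qCoeff, φ.left_inv hx.1, φ'.left_inv hx.2,
    hopf_transformation hε hX hN hφ hφ' hx.1 hx.2 (normal_orthogonal hε hX hN hφ' hx.2),
    hopf_transformation hε hX hN hφ hφ' hx.1 hx.2
      (n := fun x => productNormal κ (X x)) (productNormal_orthogonal hε hX hN hφ' hx.2)]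
  ring

end Surface

/-! ### Critical points and gradients on a Riemann surface -/

section Surface

variable {S : Type*} [TopologicalSpace S] [ChartedSpace ℂ S]

theorem mfderiv_eq_zero_iff {H : S → ℝ} (hH : ContMDiff 𝓘(ℝ, ℂ) 𝓘(ℝ) ∞ H)
    {φ : OpenPartialHomeomorph S ℂ} (hφ : φ ∈ holCharts S) {x : S} (hx : x ∈ φ.source) :
    mfderiv 𝓘(ℝ, ℂ) 𝓘(ℝ) H x = 0 ↔ fderiv ℝ (H ∘ φ.symm) (φ x) = 0 := by
  have hr := holCharts_subset_real hφ
  have hy := φ.map_source hx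
  have h1 : MDifferentiableAt 𝓘(ℝ, ℂ) 𝓘(ℝ, ℂ) φ x :=
    (contMDiffAt_of_mem_maximalAtlas hr hx).mdifferentiableAt (by simp)
  have h2 : MDifferentiableAt 𝓘(ℝ, ℂ) 𝓘(ℝ, ℂ) φ.symm (φ x) :=
    (contMDiffAt_symm_of_mem_maximalAtlas hr hy).mdifferentiableAt (by simp)
  have h3' : MDifferentiableAt 𝓘(ℝ, ℂ) 𝓘(ℝ) H (φ.symm (φ x)) :=
    (hH _).mdifferentiableAt (by simp)
  have h4 : MDifferentiableAt 𝓘(ℝ, ℂ) 𝓘(ℝ) (H ∘ φ.symm) (φ x) := h3'.comp _ h2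
  rw [← mfderiv_eq_fderiv]
  constructor
  · intro h
    have h' : mfderiv 𝓘(ℝ, ℂ) 𝓘(ℝ) H (φ.symm (φ x)) = 0 := by
      rw [φ.left_inv hx]
      exact h
    refine (mfderiv_comp (φ x) h3' h2).trans ?_
    rw [h']
    exact ContinuousLinearMap.zero_comp _
  · intro h
    have e : H =ᶠ[nhds x] (H ∘ φ.symm) ∘ φ := by
      filter_upwards [φ.open_source.mem_nhds hx] with y hy
      simp [φ.left_inv hy]
    rw [e.mfderiv_eq, mfderiv_comp x h4 h1, h]
    exact ContinuousLinearMap.zero_comp _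

/-- The gradient of `H` in a coordinate, for the conformal metric with factor `E`, as a complex
number. -/
noncomputable def coordGradient (H : S → ℝ) (E : OpenPartialHomeomorph S ℂ → ℂ → ℝ)
    (φ : OpenPartialHomeomorph S ℂ) (z : ℂ) : ℂ :=
  ((fderiv ℝ (H ∘ φ.symm) z 1 / E φ z : ℝ) : ℂ) +
    ((fderiv ℝ (H ∘ φ.symm) z Complex.I / E φ z : ℝ) : ℂ) * Complex.I

variable [IsManifold 𝓘(ℂ) ω S]

/-- The coordinate gradients of a function for a conformal metric define a tangent vector field. -/
theorem coordGradient_transformation {H : S → ℝ} (hH : ContMDiff 𝓘(ℝ, ℂ) 𝓘(ℝ) ∞ H)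
    {E : OpenPartialHomeomorph S ℂ → ℂ → ℝ} {φ φ' : OpenPartialHomeomorph S ℂ}
    (hφ : φ ∈ holCharts S) (hφ' : φ' ∈ holCharts S) {x : S}
    (hx : x ∈ φ.source) (hx' : x ∈ φ'.source) (hpos : 0 < E φ (φ x))
    (hE : E φ (φ x) = ((deriv (φ' ∘ φ.symm) (φ x)).re ^ 2 + (deriv (φ' ∘ φ.symm) (φ x)).im ^ 2) *
      E φ' (φ' x)) :
    coordGradient H E φ' (φ' x) = deriv (φ' ∘ φ.symm) (φ x) * coordGradient H E φ (φ x) := by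
  have hW : IsOpen (φ.symm ≫ₕ φ').source := (φ.symm ≫ₕ φ').open_source
  have hg := differentiableOn_transition hφ hφ'
  have hz : φ x ∈ (φ.symm ≫ₕ φ').source := by simp [hx, hx']
  have hgz : (φ' ∘ φ.symm) (φ x) = φ' x := by simp [hx]
  have hEq : Set.EqOn (H ∘ φ.symm) ((H ∘ φ'.symm) ∘ (φ' ∘ φ.symm)) (φ.symm ≫ₕ φ').source := by
    intro z hz
    have h2 : φ.symm z ∈ φ'.source := by simpa using hz.2
    simp [h2]
  have hd : ContDiffOn ℝ ∞ (H ∘ φ'.symm) φ'.target := contMDiffOn_iff_contDiffOn.1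
    (hH.comp_contMDiffOn (contMDiffOn_symm_of_mem_maximalAtlas (holCharts_subset_real hφ')))
  have hF : ∀ v, fderiv ℝ (H ∘ φ.symm) (φ x) v =
      fderiv ℝ (H ∘ φ'.symm) (φ' x) (deriv (φ' ∘ φ.symm) (φ x) * v) := by
    intro v
    rw [(eventuallyEq_of_eqOn hW hEq hz).fderiv_eq, fderiv_comp_holomorphic
      (differentiableAt_of_smooth φ'.open_target hd (by rw [hgz]; exact φ'.map_source hx'))
      ((hg _ hz).differentiableAt (hW.mem_nhds hz)), hgz]
  rw [hE] at hpos
  simp only [coordGradient, hF, hE]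
  generalize deriv (φ' ∘ φ.symm) (φ x) = d at *
  rw [real_linear_apply _ (d * 1), real_linear_apply _ (d * Complex.I)]
  generalize fderiv ℝ (H ∘ φ'.symm) (φ' x) 1 = a
  generalize fderiv ℝ (H ∘ φ'.symm) (φ' x) Complex.I = b
  generalize E φ' (φ' x) = e at *
  have h1 : d.re ^ 2 + d.im ^ 2 ≠ 0 := left_ne_zero_of_mul hpos.ne'
  have h2 : e ≠ 0 := right_ne_zero_of_mul hpos.ne'
  apply Complex.ext
  · simp only [Complex.add_re, Complex.add_im, Complex.mul_re, Complex.mul_im, Complex.ofReal_re,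
      Complex.ofReal_im, Complex.I_re, Complex.I_im, mul_one, mul_zero, sub_zero, zero_sub,
      add_zero, zero_add]
    field_simp
    ring
  · simp only [Complex.add_re, Complex.add_im, Complex.mul_re, Complex.mul_im, Complex.ofReal_re,
      Complex.ofReal_im, Complex.I_re, Complex.I_im, mul_one, mul_zero, sub_zero, zero_sub,
      add_zero, zero_add]
    field_simp
    ring

/-- A function without critical points on a surface with a conformal metric has a gradient without
zeros. -/
theorem admitsNonvanishingVectorField {H : S → ℝ} (hH : ContMDiff 𝓘(ℝ, ℂ) 𝓘(ℝ) ∞ H)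
    (hne : ∀ x, mfderiv 𝓘(ℝ, ℂ) 𝓘(ℝ) H x ≠ 0) {E : OpenPartialHomeomorph S ℂ → ℂ → ℝ}
    (hEs : ∀ φ ∈ holCharts S, ContDiffOn ℝ ∞ (E φ) φ.target)
    (hpos : ∀ φ ∈ holCharts S, ∀ z ∈ φ.target, 0 < E φ z)
    (hE : ∀ φ ∈ holCharts S, ∀ φ' ∈ holCharts S, ∀ x ∈ φ.source ∩ φ'.source, E φ (φ x) =
      ((deriv (φ' ∘ φ.symm) (φ x)).re ^ 2 + (deriv (φ' ∘ φ.symm) (φ x)).im ^ 2) * E φ' (φ' x)) :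
    AdmitsNonvanishingVectorField S := by
  refine ⟨fun x => coordGradient H E (chartAt ℂ x) (chartAt ℂ x x), ?_, ?_⟩
  · intro x₀
    rw [Bundle.contMDiffAt_totalSpace]
    refine ⟨contMDiffAt_id, ?_⟩
    have hc := chartAt_mem_holCharts x₀
    have hx₀ := mem_chart_source ℂ x₀
    -- in the trivialization over the chart at `x₀`, the field is the coordinate gradient there
    have hloc : (fun x => (trivializationAt ℂ (TangentSpace 𝓘(ℝ, ℂ)) x₀
        (⟨x, coordGradient H E (chartAt ℂ x) (chartAt ℂ x x)⟩ : TangentBundle 𝓘(ℝ, ℂ) S)).2)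
        =ᶠ[nhds x₀] (coordGradient H E (chartAt ℂ x₀)) ∘ chartAt ℂ x₀ := by
      filter_upwards [(chartAt ℂ x₀).open_source.mem_nhds hx₀] with x hx
      have hxc := chartAt_mem_holCharts x
      have hxx := mem_chart_source ℂ x
      have hg := differentiableOn_transition hxc hc
      have hz : chartAt ℂ x x ∈ ((chartAt ℂ x).symm ≫ₕ chartAt ℂ x₀).source := by simp [hx]
      have hd := ((hg _ hz).differentiableAt
        (((chartAt ℂ x).symm ≫ₕ chartAt ℂ x₀).open_source.mem_nhds hz)).hasDerivAt
      have hf := (hd.hasFDerivAt.restrictScalars ℝ).fderiv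
      rw [TangentBundle.trivializationAt_apply]
      simp only [mfld_simps, fderivWithin_univ]
      rw [coordGradient_transformation hH hxc hc hxx hx
        (hpos _ hxc _ (mem_chart_target ℂ x)) (hE _ hxc _ hc x ⟨hxx, hx⟩), hf]
      simp [mul_comm]
    refine ContMDiffAt.congr_of_eventuallyEq ?_ hloc
    have hd : ContDiffOn ℝ ∞ (H ∘ (chartAt ℂ x₀).symm) (chartAt ℂ x₀).target :=
      contMDiffOn_iff_contDiffOn.1 (hH.comp_contMDiffOn
        (contMDiffOn_symm_of_mem_maximalAtlas (holCharts_subset_real hc)))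
    have hs : ContDiffOn ℝ ∞ (coordGradient H E (chartAt ℂ x₀)) (chartAt ℂ x₀).target := by
      have ho := (chartAt ℂ x₀).open_target
      have h0 : ∀ z ∈ (chartAt ℂ x₀).target, E (chartAt ℂ x₀) z ≠ 0 := fun z hz =>
        (hpos _ hc z hz).ne'
      exact (Complex.ofRealCLM.contDiff.comp_contDiffOn
        ((contDiffOn_fderiv_apply ho hd 1).div (hEs _ hc) h0)).add
        ((Complex.ofRealCLM.contDiff.comp_contDiffOn
        ((contDiffOn_fderiv_apply ho hd Complex.I).div (hEs _ hc) h0)).mul contDiffOn_const)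
    have hs' := (hs.contDiffAt ((chartAt ℂ x₀).open_target.mem_nhds
      (mem_chart_target ℂ x₀))).contMDiffAt
    exact hs'.comp x₀ (contMDiffAt_of_mem_maximalAtlas (holCharts_subset_real hc) hx₀)
  · intro x h
    have hc := chartAt_mem_holCharts x
    apply hne x
    rw [mfderiv_eq_zero_iff hH hc (mem_chart_source ℂ x), ← gradSq_eq_zero]
    have hp := (hpos _ hc _ (mem_chart_target ℂ x)).ne'
    have h1 := congrArg Complex.re h
    have h2 := congrArg Complex.im h
    simp only [coordGradient, Complex.add_re, Complex.add_im, Complex.ofReal_re, Complex.ofReal_im,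
      Complex.mul_re, Complex.mul_im, Complex.I_re, Complex.I_im, mul_zero, mul_one,
      sub_zero, add_zero, zero_add] at h1 h2
    rw [gradSq, (div_eq_zero_iff.1 h1).resolve_right hp, (div_eq_zero_iff.1 h2).resolve_right hp]
    norm_num

variable {κ ε : ℝ} {X N : S → Ambient}

theorem eqOn_meanCurvature (hε : ε = 1 ∨ ε = -1)
    (hX : IsConformalImmersion κ ε X) (hN : IsUnitNormal κ ε X N)
    {φ : OpenPartialHomeomorph S ℂ} (hφ : φ ∈ holCharts S) :
    Set.EqOn (meanCurvature κ ε X N ∘ φ.symm)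
      (localMeanCurvature κ ε (X ∘ φ.symm) (N ∘ φ.symm)) φ.target := by
  intro z hz
  have h := meanCurvature_eq hε hX hN hφ (φ.map_target hz)
  rwa [φ.right_inv hz] at h

theorem contMDiff_meanCurvature (hε : ε = 1 ∨ ε = -1)
    (hX : IsConformalImmersion κ ε X) (hN : IsUnitNormal κ ε X N) :
    ContMDiff 𝓘(ℝ, ℂ) 𝓘(ℝ) ∞ (meanCurvature κ ε X N) := by
  intro x
  have hc := chartAt_mem_holCharts x
  have hx := mem_chart_source ℂ x
  have L := localSurface hε hX hN hc
  have e : meanCurvature κ ε X N =ᶠ[nhds x]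
      localMeanCurvature κ ε (X ∘ (chartAt ℂ x).symm) (N ∘ (chartAt ℂ x).symm) ∘ chartAt ℂ x := by
    filter_upwards [(chartAt ℂ x).open_source.mem_nhds hx] with y hy
    exact meanCurvature_eq hε hX hN hc hy
  refine ContMDiffAt.congr_of_eventuallyEq ?_ e
  exact ((L.contDiffOn_localMeanCurvature.contDiffAt
    (L.isOpen.mem_nhds (mem_chart_target ℂ x))).contMDiffAt).comp x
    (contMDiffAt_of_mem_maximalAtlas (holCharts_subset_real hc) hx)

theorem isHolomorphic_iff (hε : ε = 1 ∨ ε = -1)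
    (hX : IsConformalImmersion κ ε X) (hN : IsUnitNormal κ ε X N) :
    IsHolomorphic (qCoeff κ ε X N) (S := S) ↔ ∀ φ ∈ holCharts S,
      DifferentiableOn ℂ (localQ κ ε (X ∘ φ.symm) (N ∘ φ.symm)) φ.target :=
  forall₂_congr fun _ hφ => differentiableOn_congr fun _ hz => qCoeff_eq hε hX hN hφ hz

theorem isHolomorphic_of_const (hε : ε = 1 ∨ ε = -1)
    (hX : IsConformalImmersion κ ε X) (hN : IsUnitNormal κ ε X N) {c : ℝ}
    (hc : ∀ x, meanCurvature κ ε X N x = c) : IsHolomorphic (qCoeff κ ε X N) (S := S) := by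
  rw [isHolomorphic_iff hε hX hN]
  intro φ hφ
  have L := localSurface hε hX hN hφ
  have h0 : ∀ z ∈ φ.target, fderiv ℝ (localMeanCurvature κ ε (X ∘ φ.symm) (N ∘ φ.symm)) z = 0 := by
    intro z hz
    have h : localMeanCurvature κ ε (X ∘ φ.symm) (N ∘ φ.symm) =ᶠ[nhds z] fun _ => c :=
      eventuallyEq_of_eqOn L.isOpen (fun y hy => by
        rw [← eqOn_meanCurvature hε hX hN hφ hy, Function.comp_apply, hc]) hz
    rw [h.fderiv_eq]
    simp
  have hU : L.data.U L.data.meanCurv = 0 := by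
    ext z
    rw [L.data_U_meanCurv, h0 z z.2]; rfl
  have hV : L.data.V L.data.meanCurv = 0 := by
    ext z
    rw [L.data_V_meanCurv, h0 z z.2]; rfl
  rw [L.differentiableOn_localQ_iff, hU, hV]
  constructor <;> ring

theorem mfderiv_meanCurvature_eq_zero_iff (hε : ε = 1 ∨ ε = -1)
    (hX : IsConformalImmersion κ ε X) (hN : IsUnitNormal κ ε X N)
    {φ : OpenPartialHomeomorph S ℂ} (hφ : φ ∈ holCharts S) {x : S} (hx : x ∈ φ.source) :
    mfderiv 𝓘(ℝ, ℂ) 𝓘(ℝ) (meanCurvature κ ε X N) x = 0 ↔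
      fderiv ℝ (localMeanCurvature κ ε (X ∘ φ.symm) (N ∘ φ.symm)) (φ x) = 0 := by
  rw [mfderiv_eq_zero_iff (contMDiff_meanCurvature hε hX hN) hφ hx,
    (eventuallyEq_of_eqOn φ.open_target (eqOn_meanCurvature hε hX hN hφ)
      (φ.map_source hx)).fderiv_eq]

/-- On a connected surface with holomorphic `Q`, either the mean curvature is constant or it has no
critical points. -/
theorem const_or_no_critical_points [ConnectedSpace S] (hε : ε = 1 ∨ ε = -1)
    (hX : IsConformalImmersion κ ε X) (hN : IsUnitNormal κ ε X N)
    (hQ : IsHolomorphic (qCoeff κ ε X N) (S := S)) :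
    (∃ c : ℝ, ∀ x, meanCurvature κ ε X N x = c) ∨
      ∀ x, mfderiv 𝓘(ℝ, ℂ) 𝓘(ℝ) (meanCurvature κ ε X N) x ≠ 0 := by
  rw [isHolomorphic_iff hε hX hN] at hQ
  -- near a critical point, all points are critical
  have hball : ∀ x, mfderiv 𝓘(ℝ, ℂ) 𝓘(ℝ) (meanCurvature κ ε X N) x = 0 →
      ∃ r > 0, Metric.ball (chartAt ℂ x x) r ⊆ (chartAt ℂ x).target ∧
        ∀ z ∈ Metric.ball (chartAt ℂ x x) r, fderiv ℝ (localMeanCurvature κ ε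
          (X ∘ (chartAt ℂ x).symm) (N ∘ (chartAt ℂ x).symm)) z = 0 := by
    intro x hx
    have hc := chartAt_mem_holCharts x
    have L := localSurface hε hX hN hc
    obtain ⟨r, hr, hsub⟩ := Metric.isOpen_iff.1 L.isOpen _ (mem_chart_target ℂ x)
    refine ⟨r, hr, hsub, fun z hz => ?_⟩
    exact (L.mono Metric.isOpen_ball hsub).fderiv_eq_zero ((hQ _ hc).mono hsub)
      (convex_ball _ _) (Metric.mem_ball_self hr)
      ((mfderiv_meanCurvature_eq_zero_iff hε hX hN hc (mem_chart_source ℂ x)).1 hx) hz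
  have hnhds : ∀ (x : S) (r : ℝ), 0 < r → ∀ᶠ y in nhds x, y ∈ (chartAt ℂ x).source ∧
      chartAt ℂ x y ∈ Metric.ball (chartAt ℂ x x) r := by
    intro x r hr
    have hx := mem_chart_source ℂ x
    exact Filter.Eventually.and ((chartAt ℂ x).open_source.mem_nhds hx)
      ((chartAt ℂ x).continuousAt hx (Metric.ball_mem_nhds _ hr))
  have hopen : IsOpen {x | mfderiv 𝓘(ℝ, ℂ) 𝓘(ℝ) (meanCurvature κ ε X N) x = 0} := by
    rw [isOpen_iff_mem_nhds]
    intro x hx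
    obtain ⟨r, hr, -, h⟩ := hball x hx
    filter_upwards [hnhds x r hr] with y hy
    exact (mfderiv_meanCurvature_eq_zero_iff hε hX hN (chartAt_mem_holCharts x) hy.1).2 (h _ hy.2)
  have hclosed : IsClosed {x | mfderiv 𝓘(ℝ, ℂ) 𝓘(ℝ) (meanCurvature κ ε X N) x = 0} := by
    rw [← isOpen_compl_iff, isOpen_iff_mem_nhds]
    intro x hx
    have hc := chartAt_mem_holCharts x
    have hxs := mem_chart_source ℂ x
    have L := localSurface hε hX hN hc
    have h1 := L.isOpen_regular.mem_nhds ⟨mem_chart_target ℂ x, fun h =>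
      hx ((mfderiv_meanCurvature_eq_zero_iff hε hX hN hc hxs).2 h)⟩
    filter_upwards [(chartAt ℂ x).open_source.mem_nhds hxs,
      (chartAt ℂ x).continuousAt hxs h1] with y hy1 hy2 hy3
    exact hy2.2 ((mfderiv_meanCurvature_eq_zero_iff hε hX hN hc hy1).1 hy3)
  rcases isClopen_iff.1 ⟨hclosed, hopen⟩ with h | h
  · exact Or.inr fun x hx => (Set.eq_empty_iff_forall_notMem.1 h x) hx
  · left
    have hlc : IsLocallyConstant (meanCurvature κ ε X N) := by
      rw [IsLocallyConstant.iff_eventually_eq]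
      intro x
      have hc := chartAt_mem_holCharts x
      obtain ⟨r, hr, hsub, h0⟩ := hball x (Set.eq_univ_iff_forall.1 h x)
      have L := localSurface hε hX hN hc
      filter_upwards [hnhds x r hr] with y hy
      rw [meanCurvature_eq hε hX hN hc hy.1,
        meanCurvature_eq hε hX hN hc (mem_chart_source ℂ x)]
      exact Metric.isOpen_ball.is_const_of_fderiv_eq_zero (convex_ball _ _).isPreconnected
        ((L.contDiffOn_localMeanCurvature.mono hsub).differentiableOn (by simp)) h0 hy.2
        (Metric.mem_ball_self hr)
    obtain ⟨x₀⟩ := (inferInstance : Nonempty S)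
    exact ⟨_, fun x => hlc.apply_eq_of_isPreconnected isPreconnected_univ (Set.mem_univ x)
      (Set.mem_univ x₀)⟩

end Surface

end HopfProduct

theorem theorem7 {S : Type*} [TopologicalSpace S] [T2Space S] [ConnectedSpace S]
    [ChartedSpace ℂ S] [IsManifold 𝓘(ℂ) ω S]
    (κ ε : ℝ) (hε : ε = 1 ∨ ε = -1)
    (X N : S → HopfProduct.Ambient)
    (hX : HopfProduct.IsConformalImmersion κ ε X)
    (hN : HopfProduct.IsUnitNormal κ ε X N) :
    HopfProduct.IsQuadraticDifferential (HopfProduct.qCoeff κ ε X N) ∧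
    ((∃ c : ℝ, ∀ x, HopfProduct.meanCurvature κ ε X N x = c) →
      HopfProduct.IsHolomorphic (HopfProduct.qCoeff κ ε X N)) ∧
    ((CompactSpace S ∨ ¬ HopfProduct.AdmitsFunctionWithoutCriticalPoints S ∨
        ¬ HopfProduct.AdmitsNonvanishingVectorField S) →
      HopfProduct.IsHolomorphic (HopfProduct.qCoeff κ ε X N) →
      ∃ c : ℝ, ∀ x, HopfProduct.meanCurvature κ ε X N x = c) := by
  refine ⟨HopfProduct.isQuadraticDifferential_qCoeff hε hX hN,
    fun ⟨c, hc⟩ => HopfProduct.isHolomorphic_of_const hε hX hN hc, fun hS hQ => ?_⟩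
  have hH := HopfProduct.contMDiff_meanCurvature hε hX hN
  rcases HopfProduct.const_or_no_critical_points hε hX hN hQ with h | h
  · exact h
  exfalso
  rcases hS with hS | hS | hS
  · -- the maximum of the mean curvature on a compact surface is a critical point
    obtain ⟨x, -, hx⟩ := isCompact_univ.exists_isMaxOn Set.univ_nonempty hH.continuous.continuousOn
    have hc := HopfProduct.chartAt_mem_holCharts x
    apply h x
    rw [HopfProduct.mfderiv_eq_zero_iff hH hc (mem_chart_source ℂ x)]
    apply IsLocalMax.fderiv_eq_zero
    refine Filter.Eventually.of_forall fun z => ?_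
    simp only [Function.comp_apply, (chartAt ℂ x).left_inv (mem_chart_source ℂ x)]
    exact hx (Set.mem_univ _)
  · exact hS ⟨_, hH, h⟩
  · refine hS (HopfProduct.admitsNonvanishingVectorField hH h
      (E := fun φ z => HopfProduct.ambientForm κ ε (HopfProduct.dU (X ∘ φ.symm) z)
        (HopfProduct.dU (X ∘ φ.symm) z))
      (fun φ hφ => (HopfProduct.localSurface hε hX hN hφ).contDiffOn_normSq) hX.pos ?_)
    intro φ hφ φ' hφ' x hx
    exact (HopfProduct.transformation hε hX hN hφ hφ' hx.1 hx.2 rfl rfl).1
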